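/- Let $\zeta(j)$, $j\in\mathbb Z$, be a $T$-periodically correlated ($T$-PC) complex stochastic sequence: $\mathsf E\zeta(j)=0$, $\mathsf E|\zeta(j)|^2<\infty$, $\mathsf E\zeta(n+T)\overline{\zeta(m+T)}=\mathsf E\zeta(n)\overline{\zeta(m)}$ for all $n,m\in\mathbb Z$, and $T\ge 1$ is the least such period. Let $\vec\zeta(n)=(\zeta(nT+\nu))_{\nu=1}^T$ be the blocked $T$-variate stationary sequence, and assume that it has a spectral density matrix $f(\lambda)$, $\lambda\in(-\pi,\pi]$ (integrable, nonnegative definite), i.e. $\mathsf E\zeta_\nu(n)\overline{\zeta_\mu(m)}=\frac1{2\pi}\int_{-\pi}^{\pi}e^{i(n-m)\lambda}f_{\nu\mu}(\lambda)\,d\lambda$. Assume the minimality condition: $f(\lambda)$ is invertible for a.e. $\lambda$ and $\int_{-\pi}^{\pi}\mathrm{Tr}\,[f(\lambda)^{-1}]\,d\lambda<\infty$. Let $s\ge 0$, let $N_l,K_l\ge 0$ ($1\le l\le s$) be integers, $M_l=\sum_{k=1}^{l}(N_k+K_k)$, and put $\widetilde S=\bigcup_{l=1}^{s}\{-M_l,\dots,-M_{l-1}-N_l-1\}$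 and $\Gamma=\widetilde S\cup\{0,1,2,\dots\}$. The observations are $\vec\zeta(j)$, $j\in\{\dots,-2,-1\}\setminus\widetilde S$. Let $B(d)=\frac1{2\pi}\int_{-\pi}^{\pi}[f(\lambda)^{-1}]^{\top}e^{-id\lambda}\,d\lambda$ for $d\in\mathbb Z$. Let $\mathbf B$ be the linear operator in $\ell^2(\Gamma;\mathbb C^T)$ with the block matrix $\{B(k-j)\}_{k,j\in\Gamma}$, $(\mathbf B\mathbf c)(k)=\sum_{j\in\Gamma}B(k-j)\vec c(j)$, on its maximal domain (all $\mathbf c\in\ell^2$ for which these series converge absolutely and $\mathbf B\mathbf c\in\ell^2$); it is assumed that the columns of the matrix are square-summable, so that finitely supported sequences are in the domain, but $\mathbf B$ need not be bounded. Assume that $\mathbf B$ is invertible, i.e. maps its domain bijectively onto $\ell^2(\Gamma;\mathbb C^T)$. Let $N\ge 0$ and $A_N\zeta=\sum_{j=1}^{NT}a(j)\zeta(j)$, where $a(\nu+jT)=a_\nu(j):=\alpha(j)e^{2\pi i j\nu/T}$, $\nu=1,\dots,T$, $j\ge 0$, for some complex numbers $\alpha(j)$. Write $\vec a(j)=(a_\nu(j))_{\nu=1}^T$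 and $A_N(e^{i\lambda})=\sum_{j=0}^{N-1}\vec a(j)e^{ij\lambda}$, let $\mathbf a_N\in\ell^2(\Gamma;\mathbb C^T)$ have the components $\vec a(k)$ for $0\le k\le N-1$ and $\vec 0$ for all other $k\in\Gamma$, and put $$\mathbf c=\mathbf B^{-1}\mathbf a_N,\qquad C(e^{i\lambda})=\sum_{n\in\Gamma}\vec c(n)e^{in\lambda}\quad\text{(convergence in } L^2(-\pi,\pi)).$$ Let $L_2(f)$ be the space of functions $\vec b:(-\pi,\pi]\to\mathbb C^T$ with $\int_{-\pi}^{\pi}\vec b^{\top}f\,\overline{\vec b}\,d\lambda<\infty$, and $L_2^s(f)$ its closed subspace generated by $e^{ij\lambda}\delta_\nu$, $j\in\{\dots,-2,-1\}\setminus\widetilde S$, $\nu=1,\dots,T$, where $\delta_1,\dots,\delta_T$ is the standard basis of $\mathbb C^T$. Let $\widehat{A_N\zeta}$ be the optimal mean-square linear estimate of $A_N\zeta$ from the observations, i.e. the orthogonal projection of $A_N\zeta$ in $L^2(\mathsf P)$ onto the closed linear span of the observed variables $\zeta_\nu(j)$. Its spectral characteristic is the function $\vec h\in L_2^s(f)$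 with $\widehat{A_N\zeta}=\int_{-\pi}^{\pi}\vec h^{\top}(e^{i\lambda})Z(d\lambda)$, where $Z$ is the orthogonal random measure of $\vec\zeta$; here the integral is the isometric linear map $L_2(f)\to L^2(\mathsf P)$ (for the norm $\frac1{2\pi}\int\vec b^{\top}f\,\overline{\vec b}\,d\lambda$ squared) that sends $e^{ij\lambda}\delta_\nu$ to $\zeta_\nu(j)$. Then the spectral characteristic is, uniquely up to Lebesgue-null sets, $$\vec h_N^{\top}(e^{i\lambda})=A_N^{\top}(e^{i\lambda})-C^{\top}(e^{i\lambda})\,[f(\lambda)]^{-1}.$$ It minimizes $\Delta(\vec h;f)=\frac1{2\pi}\int_{-\pi}^{\pi}[A_N(e^{i\lambda})-\vec h]^{\top}f(\lambda)\,\overline{[A_N(e^{i\lambda})-\vec h]}\,d\lambda$ over $\vec h\in L_2^s(f)$, and the mean-square error is $$\Delta(f)=\mathsf E\bigl|A_N\zeta-\widehat{A_N\zeta}\bigr|^2=\Delta(\vec h_N;f)=\langle\mathbf c,\mathbf a_N\rangle=\sum_{k\in\Gamma}\vec c(k)^{\top}\,\overline{\vec a_N(k)}.$$ -/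

import Mathlib

open MeasureTheory Matrix
open scoped ENNReal ComplexConjugate ComplexOrder

namespace PCSeq

noncomputable section

/-! ### Periodically correlated sequences, blocking, spectral densities -/

/-- `ζ` is a `T`-PC (periodically correlated) sequence: zero mean, finite variance,
`E ζ(n+T) conj ζ(m+T) = E ζ(n) conj ζ(m)` for all `n, m`, and `T > 0` is the least such period. -/
structure IsPeriodicallyCorrelated {Ω : Type*} [MeasurableSpace Ω] (P : Measure Ω)
    (ζ : ℤ → Ω → ℂ) (T : ℕ) : Prop where
  memLp : ∀ n, MemLp (ζ n) 2 P
  mean_zero : ∀ n, ∫ ω, ζ n ω ∂P = 0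
  isLeast_period : IsLeast {τ : ℕ | 0 < τ ∧ ∀ n m : ℤ,
    ∫ ω, ζ (n + τ) ω * conj (ζ (m + τ) ω) ∂P = ∫ ω, ζ n ω * conj (ζ m ω) ∂P} T

/-- The `T`-blocking of a sequence, `[ζ⃗(n)]_ν = ζ(nT + ν)`, `ν = 1, …, T`
(the component `ν` has the index `p = ν - 1` in `Fin T`). -/
def block {α : Type*} (T : ℕ) (ζ : ℤ → α) (n : ℤ) (p : Fin T) : α :=
  ζ (n * (T : ℤ) + ((p : ℕ) + 1 : ℤ))

/-- Lebesgue measure on the interval `(-π, π]` of frequencies. -/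
abbrev freq : Measure ℝ := volume.restrict (Set.Ioc (-Real.pi) Real.pi)

/-- `e^{inx}`. -/
def expi (n : ℤ) (x : ℝ) : ℂ := Complex.exp (Complex.I * (n : ℂ) * (x : ℂ))

/-- `f` is the spectral density matrix of the `T`-variate sequence `ξ`: a nonnegative definite
integrable matrix function such that
`E ξ_ν(n) conj ξ_μ(m) = (1/2π) ∫ e^{i(n-m)x} f_{νμ}(x) dx`. -/
structure IsSpectralDensity {Ω : Type*} [MeasurableSpace Ω] (P : Measure Ω) {T : ℕ}
    (ξ : ℤ → Fin T → Ω → ℂ) (f : ℝ → Matrix (Fin T) (Fin T) ℂ) : Prop where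
  posSemidef : ∀ᵐ x ∂freq, (f x).PosSemidef
  integrable : ∀ ν μ, Integrable (fun x => f x ν μ) freq
  covariance : ∀ (n m : ℤ) (ν μ : Fin T),
    ∫ ω, ξ n ν ω * conj (ξ m μ ω) ∂P =
      (1 / (2 * Real.pi) : ℂ) * ∫ x, expi (n - m) x * f x ν μ ∂freq

/-- The minimality condition `∫ Tr [f(x)⁻¹] dx < ∞`; it includes that `f(x)` is invertible for
almost every `x`. -/
def MinimalityCondition {T : ℕ} (f : ℝ → Matrix (Fin T) (Fin T) ℂ) : Prop :=
  (∀ᵐ x ∂freq, IsUnit (f x).det) ∧ Integrable (fun x => ((f x)⁻¹).trace) freq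

/-! ### The missing observations -/

/-- `M_l = ∑_{k=0}^{l} (N_k + K_k)`, where `N_0 = K_0 = 0`. -/
def M (Nobs Kmis : ℕ → ℕ) (l : ℕ) : ℕ := ∑ k ∈ Finset.Icc 1 l, (Nobs k + Kmis k)

/-- `S̃ = ⋃_{l=1}^{s} {-M_l, …, -M_{l-1} - N_l - 1}`. -/
def missing (s : ℕ) (Nobs Kmis : ℕ → ℕ) : Set ℤ :=
  ⋃ l ∈ Finset.Icc 1 s,
    Set.Icc (-(M Nobs Kmis l : ℤ)) (-(M Nobs Kmis (l - 1) : ℤ) - (Nobs l : ℤ) - 1)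

/-- The observation times `{…, -2, -1} \ S̃`. -/
def observed (s : ℕ) (Nobs Kmis : ℕ → ℕ) : Set ℤ := Set.Iio 0 \ missing s Nobs Kmis

/-- `Γ = S̃ ∪ {0, 1, 2, …}`. -/
def Gam (s : ℕ) (Nobs Kmis : ℕ → ℕ) : Set ℤ := missing s Nobs Kmis ∪ Set.Ici 0

/-! ### The space `L₂(f)` and its subspaces spanned by exponentials -/

/-- The density `b(x)ᵀ f(x) conj b(x)`. -/
def quad {T : ℕ} (f : ℝ → Matrix (Fin T) (Fin T) ℂ) (b : ℝ → Fin T → ℂ) (x : ℝ) : ℂ :=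
  b x ⬝ᵥ (f x *ᵥ star (b x))

/-- `b ∈ L₂(f)`. -/
def MemL2 {T : ℕ} (f : ℝ → Matrix (Fin T) (Fin T) ℂ) (b : ℝ → Fin T → ℂ) : Prop :=
  AEStronglyMeasurable b freq ∧ Integrable (quad f b) freq

/-- `(1/2π) ∫ b(x)ᵀ f(x) conj b(x) dx`. -/
def normSq {T : ℕ} (f : ℝ → Matrix (Fin T) (Fin T) ℂ) (b : ℝ → Fin T → ℂ) : ℝ :=
  1 / (2 * Real.pi) * ∫ x, (quad f b x).re ∂freq

/-- The vector trigonometric polynomial `∑_j p(j) e^{ijx}`. -/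
def trigPoly {T : ℕ} (p : ℤ →₀ (Fin T → ℂ)) (x : ℝ) : Fin T → ℂ :=
  p.sum fun j v => expi j x • v

/-- `h` lies in the closed subspace of `L₂(f)` generated by the functions `e^{ijx} δ_ν`,
`j ∈ D`, `ν = 1, …, T`. For `D` the set of observation times this is `L₂ˢ(f)`. -/
def MemSpan {T : ℕ} (f : ℝ → Matrix (Fin T) (Fin T) ℂ) (D : Set ℤ) (h : ℝ → Fin T → ℂ) : Prop :=
  MemL2 f h ∧ ∀ ε > 0, ∃ p : ℤ →₀ (Fin T → ℂ), (p.support : Set ℤ) ⊆ D ∧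
    normSq f (h - trigPoly p) < ε

/-! ### Estimates in `L²(P)` -/

/-- The sequence `ζ` of random variables with finite variance as a sequence in `L²(P)`. -/
def toL2 {Ω : Type*} [MeasurableSpace Ω] {P : Measure Ω} {ζ : ℤ → Ω → ℂ}
    (hζ : ∀ n, MemLp (ζ n) 2 P) (n : ℤ) : Lp ℂ 2 P := (hζ n).toLp

/-- The closed linear subspace of `L²(P)` generated by `ξ_ν(j)`, `j ∈ D`, `ν = 1, …, T`. -/
def obsSpace {Ω : Type*} [MeasurableSpace Ω] {P : Measure Ω} {T : ℕ}
    (ξ : ℤ → Fin T → Lp ℂ 2 P) (D : Set ℤ) : Submodule ℂ (Lp ℂ 2 P) :=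
  (Submodule.span ℂ {y | ∃ j ∈ D, ∃ ν, y = ξ j ν}).topologicalClosure

/-- The optimal mean-square linear estimate of `X` from `ξ_ν(j)`, `j ∈ D`: the orthogonal
projection of `X` onto the closed subspace generated by these variables. -/
def optEstimate {Ω : Type*} [MeasurableSpace Ω] {P : Measure Ω} {T : ℕ}
    (ξ : ℤ → Fin T → Lp ℂ 2 P) (D : Set ℤ) (X : Lp ℂ 2 P) : Lp ℂ 2 P :=
  haveI : CompleteSpace (obsSpace ξ D) :=
    (Submodule.isClosed_topologicalClosure _).completeSpace_coe
  (obsSpace ξ D).starProjection X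

/-- `Y = ∫ h(x)ᵀ Z(dx)`, where `Z` is the orthogonal random measure of the stationary sequence `ξ`
with spectral density `f`. The stochastic integral is the isometric extension to `L₂(f)` of the
map `e^{ijx} δ_ν ↦ ξ_ν(j) = ∫ e^{ijx} Z_ν(dx)`; so `Y` is the integral of `h` when
`(h, Y)` is a limit of pairs `(∑_j p(j) e^{ijx}, ∑_j p(j)ᵀ ξ(j))`. -/
def IsSpectralIntegral {Ω : Type*} [MeasurableSpace Ω] {P : Measure Ω} {T : ℕ}
    (ξ : ℤ → Fin T → Lp ℂ 2 P) (f : ℝ → Matrix (Fin T) (Fin T) ℂ)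
    (h : ℝ → Fin T → ℂ) (Y : Lp ℂ 2 P) : Prop :=
  MemL2 f h ∧ ∀ ε > 0, ∃ p : ℤ →₀ (Fin T → ℂ),
    normSq f (h - trigPoly p) < ε ∧ ‖Y - p.sum fun j v => ∑ ν, v ν • ξ j ν‖ < ε

/-- `h` is the spectral characteristic of the optimal linear estimate of `X` from `ξ_ν(j)`,
`j ∈ D`: `h` belongs to the closed span of `e^{ijx} δ_ν`, `j ∈ D`, in `L₂(f)`, and the
estimate is `∫ h(x)ᵀ Z(dx)`. -/
def IsSpectralCharacteristic {Ω : Type*} [MeasurableSpace Ω] {P : Measure Ω} {T : ℕ}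
    (ξ : ℤ → Fin T → Lp ℂ 2 P) (f : ℝ → Matrix (Fin T) (Fin T) ℂ) (D : Set ℤ) (X : Lp ℂ 2 P)
    (h : ℝ → Fin T → ℂ) : Prop :=
  MemSpan f D h ∧ IsSpectralIntegral ξ f h (optEstimate ξ D X)

/-! ### The functional `A_N ζ` -/

/-- The components `a_ν(j) = α(j) e^{2πi jν/T}`, `ν = 1, …, T`, of the vector `a⃗(j)`. -/
def vecCoeff (T : ℕ) (α : ℕ → ℂ) (j : ℕ) (p : Fin T) : ℂ :=
  α j * Complex.exp (2 * Real.pi * Complex.I * (j : ℂ) * (((p : ℕ) : ℂ) + 1) / (T : ℂ))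

/-- The coefficients `a` have the form `a(ν + jT) = α(j) e^{2πi jν/T}`, `ν = 1, …, T`, `j ≥ 0`. -/
def HasBlockForm (T : ℕ) (α a : ℕ → ℂ) : Prop :=
  ∀ (j : ℕ) (p : Fin T), a ((p : ℕ) + 1 + j * T) = vecCoeff T α j p

/-- `A_N ζ = ∑_{j=1}^{NT} a(j) ζ(j)`. -/
def functional {E : Type*} [AddCommMonoid E] [SMul ℂ E] (T N : ℕ) (a : ℕ → ℂ) (ζ : ℤ → E) : E :=
  ∑ j ∈ Finset.Icc 1 (N * T), a j • ζ (j : ℤ)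

/-- `A_N(e^{ix}) = ∑_{j=0}^{N-1} a⃗(j) e^{ijx}`. -/
def AN (T N : ℕ) (α : ℕ → ℂ) (x : ℝ) : Fin T → ℂ :=
  ∑ j ∈ Finset.range N, expi (j : ℤ) x • vecCoeff T α j

/-! ### The operator `B` in `ℓ²(Γ; ℂ^T)` -/

/-- `ℓ²(G; ℂ^T)`. -/
abbrev l2 (G : Set ℤ) (T : ℕ) := lp (fun _ : G => EuclideanSpace ℂ (Fin T)) 2

/-- `B(d) = (1/2π) ∫ [f(x)⁻¹]ᵀ e^{-idx} dx`. -/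
def Bcoef {T : ℕ} (f : ℝ → Matrix (Fin T) (Fin T) ℂ) (d : ℤ) : Matrix (Fin T) (Fin T) ℂ :=
  Matrix.of fun ν μ => (1 / (2 * Real.pi) : ℂ) * ∫ x, ((f x)⁻¹)ᵀ ν μ * expi (-d) x ∂freq

/-- The term `B(k-j) c(j)` of `(B c)(k) = ∑_{j ∈ G} B(k-j) c(j)`. -/
def Bterm {T : ℕ} (f : ℝ → Matrix (Fin T) (Fin T) ℂ) (G : Set ℤ)
    (c : G → EuclideanSpace ℂ (Fin T)) (k j : G) : EuclideanSpace ℂ (Fin T) :=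
  Matrix.toEuclideanLin (Bcoef f ((k : ℤ) - (j : ℤ))) (c j)

theorem Bterm_add {T : ℕ} (f : ℝ → Matrix (Fin T) (Fin T) ℂ) (G : Set ℤ) (a b : l2 G T) (k : G) :
    Bterm f G (⇑(a + b)) k = Bterm f G (⇑a) k + Bterm f G (⇑b) k := by
  funext j
  simp only [Bterm, lp.coeFn_add, Pi.add_apply, map_add]

theorem Bterm_smul {T : ℕ} (f : ℝ → Matrix (Fin T) (Fin T) ℂ) (G : Set ℤ) (r : ℂ) (a : l2 G T)
    (k : G) : Bterm f G (⇑(r • a)) k = r • Bterm f G (⇑a) k := by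
  funext j
  simp only [Bterm, lp.coeFn_smul, Pi.smul_apply, map_smul]

/-- `(B c)(k) = ∑_{j ∈ G} B(k-j) c(j)`. -/
def Bapply {T : ℕ} (f : ℝ → Matrix (Fin T) (Fin T) ℂ) (G : Set ℤ)
    (c : G → EuclideanSpace ℂ (Fin T)) (k : G) : EuclideanSpace ℂ (Fin T) :=
  ∑' j, Bterm f G c k j

theorem Bapply_add {T : ℕ} (f : ℝ → Matrix (Fin T) (Fin T) ℂ) (G : Set ℤ) (a b : l2 G T)
    (ha : ∀ k, Summable (Bterm f G (⇑a) k)) (hb : ∀ k, Summable (Bterm f G (⇑b) k)) :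
    Bapply f G (⇑(a + b)) = Bapply f G (⇑a) + Bapply f G (⇑b) := by
  funext k
  unfold Bapply
  rw [Bterm_add]
  exact (ha k).tsum_add (hb k)

theorem Bapply_smul {T : ℕ} (f : ℝ → Matrix (Fin T) (Fin T) ℂ) (G : Set ℤ) (r : ℂ) (a : l2 G T)
    (ha : ∀ k, Summable (Bterm f G (⇑a) k)) :
    Bapply f G (⇑(r • a)) = r • Bapply f G (⇑a) := by
  funext k
  unfold Bapply
  rw [Bterm_smul]
  exact (ha k).tsum_const_smul r

/-- The maximal domain of `B` in `ℓ²(G; ℂ^T)`: all `c ∈ ℓ²` for which the series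
`∑_{j ∈ G} B(k-j) c(j)` converge absolutely and `B c ∈ ℓ²`. -/
def Bdom {T : ℕ} (f : ℝ → Matrix (Fin T) (Fin T) ℂ) (G : Set ℤ) : Submodule ℂ (l2 G T) where
  carrier := {c | (∀ k, Summable (Bterm f G (⇑c) k)) ∧ Memℓp (Bapply f G (⇑c)) 2}
  zero_mem' := by
    have h0 : ∀ k, Bterm f G (⇑(0 : l2 G T)) k = fun _ => 0 := by
      intro k; funext j; simp only [Bterm, lp.coeFn_zero, Pi.zero_apply, map_zero]
    have h1 : Bapply f G (⇑(0 : l2 G T)) = 0 := by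
      funext k; simp only [Bapply, h0, tsum_zero, Pi.zero_apply]
    exact ⟨fun k => by rw [h0]; exact summable_zero, by rw [h1]; exact zero_memℓp⟩
  add_mem' := by
    rintro a b ⟨ha, ha'⟩ ⟨hb, hb'⟩
    exact ⟨fun k => by rw [Bterm_add]; exact (ha k).add (hb k),
      by rw [Bapply_add f G a b ha hb]; exact ha'.add hb'⟩
  smul_mem' := by
    rintro r a ⟨ha, ha'⟩
    exact ⟨fun k => by rw [Bterm_smul]; exact (ha k).const_smul r,
      by rw [Bapply_smul f G r a ha]; exact ha'.const_smul r⟩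

/-- The linear operator `B` in `ℓ²(G; ℂ^T)` defined by the block matrix `{B(k-j)}_{k,j ∈ G}`,
on its maximal domain. -/
def Bop {T : ℕ} (f : ℝ → Matrix (Fin T) (Fin T) ℂ) (G : Set ℤ) : Bdom f G →ₗ[ℂ] l2 G T where
  toFun c := ⟨Bapply f G (⇑c.1), c.2.2⟩
  map_add' a b := Subtype.ext (Bapply_add f G a.1 b.1 a.2.1 b.2.1)
  map_smul' r a := Subtype.ext (Bapply_smul f G r a.1 a.2.1)

/-- The matrix `{B(k-j)}` defines an operator in `ℓ²(G; ℂ^T)`: its columns are square-summable,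
i.e. every finitely supported sequence belongs to the domain of `B`. -/
def IsMatrixOperator {T : ℕ} (f : ℝ → Matrix (Fin T) (Fin T) ℂ) (G : Set ℤ) : Prop :=
  ∀ c : l2 G T, {k | c k ≠ 0}.Finite → c ∈ Bdom f G

/-- `B` is invertible: it maps its domain bijectively onto `ℓ²(G; ℂ^T)`. -/
def BInvertible {T : ℕ} (f : ℝ → Matrix (Fin T) (Fin T) ℂ) (G : Set ℤ) : Prop :=
  Function.Bijective (Bop f G)

/-- `B⁻¹ b` for an invertible `B`. -/
def Binv {T : ℕ} {f : ℝ → Matrix (Fin T) (Fin T) ℂ} {G : Set ℤ} (hB : BInvertible f G)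
    (b : l2 G T) : l2 G T :=
  ((LinearEquiv.ofBijective (Bop f G) hB).symm b : Bdom f G)

/-- The `k`-th component of `a_N`: it is `a⃗(k)` for `0 ≤ k ≤ N - 1`, and zero otherwise. -/
def aNfun (T N : ℕ) (α : ℕ → ℂ) (k : ℤ) : EuclideanSpace ℂ (Fin T) :=
  if 0 ≤ k ∧ k < N then WithLp.toLp 2 (vecCoeff T α k.toNat) else 0

theorem aNfun_memlp (T N : ℕ) (α : ℕ → ℂ) (G : Set ℤ) :
    Memℓp (fun k : G => aNfun T N α k) 2 := by
  have h : Memℓp (fun k : G => aNfun T N α k) 0 := by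
    refine memℓp_zero ?_
    refine Set.Finite.subset ((Set.finite_Ico (0 : ℤ) N).preimage
      (Subtype.val_injective.injOn (s := (Subtype.val : G → ℤ) ⁻¹' Set.Ico (0 : ℤ) N))) ?_
    intro k hk
    by_contra h
    exact hk (if_neg h)
  exact h.of_exponent_ge zero_le

/-- The vector `a_N ∈ ℓ²(G; ℂ^T)`. -/
def aN (T N : ℕ) (α : ℕ → ℂ) (G : Set ℤ) : l2 G T :=
  ⟨fun k => aNfun T N α k, aNfun_memlp T N α G⟩

/-- The function `x ↦ e^{inx} v` in `L²((-π, π]; ℂ^T)`. -/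
def expVec {T : ℕ} (n : ℤ) (v : EuclideanSpace ℂ (Fin T)) :
    Lp (EuclideanSpace ℂ (Fin T)) 2 freq :=
  MemLp.toLp (fun x => expi n x • v) (by
    refine MemLp.of_bound (C := ‖v‖) ?_ ?_
    · exact Continuous.aestronglyMeasurable (by unfold expi; fun_prop)
    · refine Filter.Eventually.of_forall fun x => ?_
      have h : ‖expi n x‖ = 1 := by
        unfold expi; rw [Complex.norm_exp]; simp
      rw [norm_smul, h, one_mul])

/-- `C(e^{ix}) = ∑_{n ∈ G} c(n) e^{inx}`, the series converging in `L²((-π, π]; ℂ^T)`. -/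
def Cfun {G : Set ℤ} {T : ℕ} (c : l2 G T) (x : ℝ) : Fin T → ℂ :=
  WithLp.ofLp ((∑' n : G, expVec (n : ℤ) (c n) : Lp (EuclideanSpace ℂ (Fin T)) 2 freq) x)

/-- `⟨c, b⟩ = ∑_{k ∈ G} c(k)ᵀ conj b(k)`. -/
def pairing {G : Set ℤ} {T : ℕ} (c b : l2 G T) : ℂ :=
  ∑' k : G, ∑ ν, c k ν * conj (b k ν)

/-- `h_N(e^{ix})ᵀ = A_N(e^{ix})ᵀ - C(e^{ix})ᵀ f(x)⁻¹`. -/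
def hN {G : Set ℤ} {T : ℕ} (N : ℕ) (α : ℕ → ℂ) (f : ℝ → Matrix (Fin T) (Fin T) ℂ) (c : l2 G T)
    (x : ℝ) : Fin T → ℂ :=
  AN T N α x - Cfun c x ᵥ* (f x)⁻¹

end

end PCSeq

open PCSeq

/-!
Write `F = f⁻¹`, `r = Cᵀ f⁻¹` and `h_N = A_N - r`. The theorem is the projection theorem in `L₂(f)`:
`A_N = h_N + r`, where `r` is orthogonal to all `e^{ijx} δ_ν` with `j` an observation time and `h_N`
lies in their closed span. The isometry `e^{ijx} δ_ν ↦ ζ_ν(j)` carries this decomposition to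
`L²(P)`, and the error is `‖r‖² = ⟨c, a_N⟩`.

*The function `r`.* The columns of the matrix of `B` are square-summable and the matrix is
Hermitian, so the components of `B x` are the inner products of `x` with the columns. Therefore `B`
is closed, `B⁻¹` is bounded by the closed graph theorem, and a vector orthogonal to all columns is
in the kernel of `B`, that is, zero. Hence there are finitely supported `x_n → c` with `B x_n → a_N`
(`exists_seq_tendsto_Binv`). For the trigonometric polynomials `C_n` with the coefficients `x_n` the
squared norm of `(C_n - C_m) F` in `L₂(f)` is `⟨x_n - x_m, B (x_n - x_m)⟩ → 0`, and by Fatou's lemma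
`C_n F → r` in `L₂(f)`. This gives the membership `r ∈ L₂(f)`, the Fourier coefficients `a_N(k)`,
`k ∈ Γ`, of `r`, its norm, and its orthogonality to the observations (`IsMinimalWeight.mulInv_Cfun`).

*The function `h_N`.* By the above, the Fourier coefficients of `h_N` vanish on `Γ`, the complement
of the set of observation times, which contains all but finitely many negative integers. It remains
to see that such a function `h ∈ L₂(f)` is in the closed span of the corresponding exponentials
(`memSpan_of_spectrum`). As `f` is only integrable, the Fourier series of `h` need not converge in
`L₂(f)`, and this needs an argument of Smirnov type. Let `g = |h|^{1/2} + |f|^{1/2} ∈ L²`. There is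
a function `H`, an almost everywhere limit of polynomials in `e^{-ix}` with nonnegative real parts,
such that `Re H = g`; and `u_n = 1 / (1 + H / (n + 1))` is a bounded limit of polynomials in
`e^{-ix}` (`exists_multipliers`). Then `|u_n| ≤ 1`, `u_n h ∈ L²`, `|u_n|² f` is bounded and
`u_n → 1`. So `u_n h` is close in `L²` to a trigonometric polynomial `p` with negative frequencies,
`u_n² h` is close in `L₂(f)` to `u_n p`, which is a limit of trigonometric polynomials with negative
frequencies, and `u_n² h → h`. The finitely many frequencies that are not observed are removed in
the end, since the corresponding coefficients tend to zero.
-/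

namespace PCSeq

open Filter Topology

/-! ### The semi-inner product space `L₂(f)` -/

section WeightedSpace

/-- A matrix weight: an almost everywhere nonnegative definite measurable matrix function. The
entries need not be integrable. -/
structure IsWeight {T : ℕ} (f : ℝ → Matrix (Fin T) (Fin T) ℂ) : Prop where
  posSemidef : ∀ᵐ x ∂freq, (f x).PosSemidef
  aesm : ∀ ν μ, AEStronglyMeasurable (fun x => f x ν μ) freq

/-- The sesquilinear density `a(x)ᵀ f(x) conj b(x)`. -/
noncomputable def form {T : ℕ} (f : ℝ → Matrix (Fin T) (Fin T) ℂ) (a b : ℝ → Fin T → ℂ) (x : ℝ) :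
    ℂ :=
  a x ⬝ᵥ (f x *ᵥ star (b x))

/-- The semi-inner product `(1/2π) ∫ a(x)ᵀ f(x) conj b(x) dx` of `L₂(f)`, linear in `a`. -/
noncomputable def ip {T : ℕ} (f : ℝ → Matrix (Fin T) (Fin T) ℂ) (a b : ℝ → Fin T → ℂ) : ℂ :=
  (1 / (2 * Real.pi) : ℂ) * ∫ x, form f a b x ∂freq

variable {T : ℕ} {f : ℝ → Matrix (Fin T) (Fin T) ℂ} {a b c : ℝ → Fin T → ℂ}

theorem form_self : form f b b = quad f b := rfl

theorem form_add_left : form f (a + b) c = form f a c + form f b c := by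
  funext x; simp [form, add_dotProduct]

theorem form_add_right : form f a (b + c) = form f a b + form f a c := by
  funext x; simp [form, mulVec_add, dotProduct_add]

theorem form_mul_left (r : ℝ → ℂ) (x : ℝ) :
    form f (fun x => r x • a x) b x = r x * form f a b x := by
  simp [form, smul_dotProduct]

theorem form_mul_right (r : ℝ → ℂ) (x : ℝ) :
    form f a (fun x => r x • b x) x = conj (r x) * form f a b x := by
  simp [form, mulVec_smul, dotProduct_smul, star_smul]

theorem form_smul_left (r : ℂ) : form f (r • a) b = r • form f a b := by
  funext x; exact form_mul_left (fun _ => r) x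

theorem form_smul_right (r : ℂ) : form f a (r • b) = conj r • form f a b := by
  funext x; exact form_mul_right (fun _ => r) x

theorem form_conj {x : ℝ} (hx : (f x).PosSemidef) : conj (form f a b x) = form f b a x := by
  have h := hx.isHermitian
  simp only [form]
  rw [starRingEnd_apply, ← star_dotProduct_star, star_mulVec, h.eq, star_star,
    ← dotProduct_mulVec]

theorem quad_nonneg {x : ℝ} (hx : (f x).PosSemidef) : 0 ≤ quad f b x := by
  have := hx.dotProduct_mulVec_nonneg (star (b x))
  rwa [star_star] at this

theorem quad_eq_ofReal {x : ℝ} (hx : (f x).PosSemidef) :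
    quad f b x = ((quad f b x).re : ℂ) := by
  have h := Complex.nonneg_iff.1 (quad_nonneg (b := b) hx)
  exact Complex.ext rfl (by simpa using h.2.symm)

theorem quad_re_nonneg {x : ℝ} (hx : (f x).PosSemidef) : 0 ≤ (quad f b x).re :=
  (Complex.nonneg_iff.1 (quad_nonneg (b := b) hx)).1

theorem norm_quad {x : ℝ} (hx : (f x).PosSemidef) : ‖quad f b x‖ = (quad f b x).re := by
  rw [quad_eq_ofReal hx, Complex.norm_real, Complex.ofReal_re, Real.norm_of_nonneg
    (quad_re_nonneg hx)]

theorem quad_add (x : ℝ) : quad f (a + b) x =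
    quad f a x + quad f b x + (form f a b x + form f b a x) := by
  simp only [← form_self, form_add_left, form_add_right, Pi.add_apply]; ring

theorem quad_smul (r : ℝ → ℂ) (x : ℝ) :
    quad f (fun x => r x • b x) x = (‖r x‖ ^ 2 : ℝ) * quad f b x := by
  rw [← form_self, form_mul_left, form_mul_right, form_self, ← mul_assoc, Complex.mul_conj,
    Complex.normSq_eq_norm_sq]

theorem quad_re_add_le {x : ℝ} (hx : (f x).PosSemidef) :
    (quad f (a + b) x).re ≤ 2 * (quad f a x).re + 2 * (quad f b x).re := by
  have h1 := quad_add (f := f) (a := a) (b := b) x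
  have h2 := quad_add (f := f) (a := a) (b := (-1 : ℂ) • b) x
  have h3 := quad_re_nonneg (b := a + (-1 : ℂ) • b) hx
  have h4 : quad f ((-1 : ℂ) • b) x = quad f b x := by
    simpa using! quad_smul (f := f) (b := b) (fun _ => (-1 : ℂ)) x
  rw [h2, h4, form_smul_left, form_smul_right] at h3
  rw [h1]
  simp at h3 ⊢
  linarith

theorem aesm_eval (hb : AEStronglyMeasurable b freq) (ν : Fin T) :
    AEStronglyMeasurable (fun x => b x ν) freq :=
  (continuous_apply ν).comp_aestronglyMeasurable hb

theorem aesm_pi (hb : ∀ ν, AEStronglyMeasurable (fun x => b x ν) freq) :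
    AEStronglyMeasurable b freq :=
  (aemeasurable_pi_lambda b fun ν => (hb ν).aemeasurable).aestronglyMeasurable

theorem form_aesm (hf : ∀ ν μ, AEStronglyMeasurable (fun x => f x ν μ) freq)
    (ha : AEStronglyMeasurable a freq) (hb : AEStronglyMeasurable b freq) :
    AEStronglyMeasurable (form f a b) freq := by
  unfold form dotProduct mulVec dotProduct
  refine Finset.aestronglyMeasurable_fun_sum _ fun ν _ => (aesm_eval ha ν).mul ?_
  refine Finset.aestronglyMeasurable_fun_sum _ fun μ _ => (hf ν μ).mul ?_
  exact Complex.continuous_conj.comp_aestronglyMeasurable (aesm_eval hb μ)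

theorem memL2_of_quad_le (hf : IsWeight f) (hb : AEStronglyMeasurable b freq) {g : ℝ → ℝ}
    (hg : Integrable g freq) (h : ∀ᵐ x ∂freq, (quad f b x).re ≤ g x) : MemL2 f b := by
  refine ⟨hb, hg.mono' (form_aesm hf.aesm hb hb) ?_⟩
  filter_upwards [h, hf.posSemidef] with x hx hp
  rwa [norm_quad hp]

theorem MemL2.integrable_re (hb : MemL2 f b) : Integrable (fun x => (quad f b x).re) freq :=
  hb.2.re

theorem MemL2.add (hf : IsWeight f) (ha : MemL2 f a) (hb : MemL2 f b) : MemL2 f (a + b) := by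
  refine memL2_of_quad_le hf (ha.1.add hb.1)
    ((ha.integrable_re.const_mul 2).add (hb.integrable_re.const_mul 2)) ?_
  filter_upwards [hf.posSemidef] with x hx
  exact quad_re_add_le hx

theorem MemL2.mul (hf : IsWeight f) (hb : MemL2 f b) {r : ℝ → ℂ}
    (hr : AEStronglyMeasurable r freq) {K : ℝ} (hK : ∀ᵐ x ∂freq, ‖r x‖ ≤ K) :
    MemL2 f fun x => r x • b x := by
  refine memL2_of_quad_le hf (hr.smul hb.1) (hb.integrable_re.const_mul (K ^ 2)) ?_
  filter_upwards [hf.posSemidef, hK] with x hx hK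
  rw [quad_smul, Complex.re_ofReal_mul]
  have := quad_re_nonneg (b := b) hx
  gcongr

theorem MemL2.smul (hf : IsWeight f) (hb : MemL2 f b) (r : ℂ) : MemL2 f (r • b) :=
  hb.mul hf (r := fun _ => r) aestronglyMeasurable_const (K := ‖r‖) (by simp)

theorem MemL2.sub (hf : IsWeight f) (ha : MemL2 f a) (hb : MemL2 f b) : MemL2 f (a - b) := by
  have := ha.add hf (hb.smul hf (-1))
  rwa [neg_one_smul, ← sub_eq_add_neg] at this

theorem MemL2.zero : MemL2 f 0 := by
  have : quad f (0 : ℝ → Fin T → ℂ) = 0 := by funext x; simp [quad]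
  exact ⟨aestronglyMeasurable_const, by rw [this]; exact integrable_zero _ _ _⟩

/-- By polarization the density `form f a b` is integrable for `a, b ∈ L₂(f)`. -/
theorem MemL2.integrable_form (hf : IsWeight f) (ha : MemL2 f a) (hb : MemL2 f b) :
    Integrable (form f a b) freq := by
  have h1 := (ha.add hf hb).2
  have h2 := (ha.add hf (hb.smul hf Complex.I)).2
  have h3 := (hb.smul hf Complex.I).2
  have h : form f a b = (1 / 2 : ℂ) • ((quad f (a + b) - quad f a - quad f b) +
      Complex.I • (quad f (a + Complex.I • b) - quad f a - quad f (Complex.I • b))) := by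
    funext x
    simp only [Pi.smul_apply, Pi.add_apply, Pi.sub_apply, quad_add, form_smul_left,
      form_smul_right, smul_eq_mul, Complex.conj_I]
    linear_combination (1 / 2 : ℂ) * (form f a b x - form f b a x) * Complex.I_sq
  rw [h]
  exact (((h1.sub ha.2).sub hb.2).add (((h2.sub ha.2).sub h3).smul Complex.I)).smul _

theorem ip_add_left (hf : IsWeight f) (ha : MemL2 f a) (hb : MemL2 f b) (hc : MemL2 f c) :
    ip f (a + b) c = ip f a c + ip f b c := by
  rw [ip, form_add_left, integral_add' (ha.integrable_form hf hc) (hb.integrable_form hf hc),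
    mul_add]; rfl

theorem ip_smul_left (r : ℂ) : ip f (r • a) b = r * ip f a b := by
  simp only [ip, form_smul_left, Pi.smul_apply, smul_eq_mul, integral_const_mul]; ring

theorem ip_conj (hf : IsWeight f) : conj (ip f a b) = ip f b a := by
  rw [ip, map_mul, ← integral_conj, ip]
  congr 1
  · simp [Complex.conj_ofNat]
  · refine integral_congr_ae ?_
    filter_upwards [hf.posSemidef] with x hx
    exact form_conj hx

theorem ip_self_re (hb : MemL2 f b) : (ip f b b).re = normSq f b := by
  have : (1 / (2 * Real.pi) : ℂ) = ((1 / (2 * Real.pi) : ℝ) : ℂ) := by push_cast; rfl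
  rw [ip, this, Complex.re_ofReal_mul, normSq]
  exact congrArg _ (integral_re hb.2).symm

theorem normSq_nonneg (hf : IsWeight f) : 0 ≤ normSq f b := by
  refine mul_nonneg (by positivity) (integral_nonneg_of_ae ?_)
  filter_upwards [hf.posSemidef] with x hx
  exact quad_re_nonneg hx

theorem ip_self (hf : IsWeight f) (hb : MemL2 f b) : ip f b b = (normSq f b : ℂ) := by
  have := Complex.conj_eq_iff_real.1 (ip_conj (a := b) (b := b) hf)
  obtain ⟨r, hr⟩ := this
  rw [← ip_self_re hb, hr, Complex.ofReal_re]

theorem ip_add_right (hf : IsWeight f) (ha : MemL2 f a) (hb : MemL2 f b) (hc : MemL2 f c) :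
    ip f a (b + c) = ip f a b + ip f a c := by
  rw [← ip_conj hf, ip_add_left hf hb hc ha, map_add, ip_conj hf, ip_conj hf]

theorem ip_smul_right (hf : IsWeight f) (r : ℂ) : ip f a (r • b) = conj r * ip f a b := by
  rw [← ip_conj hf, ip_smul_left, map_mul, ip_conj hf]

theorem ip_sub_left (hf : IsWeight f) (ha : MemL2 f a) (hb : MemL2 f b) (hc : MemL2 f c) :
    ip f (a - b) c = ip f a c - ip f b c := by
  have : a - b = a + (-1 : ℂ) • b := by rw [neg_one_smul, sub_eq_add_neg]
  rw [this, ip_add_left hf ha (hb.smul hf _) hc, ip_smul_left]; ring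

theorem ip_sub_right (hf : IsWeight f) (ha : MemL2 f a) (hb : MemL2 f b) (hc : MemL2 f c) :
    ip f a (b - c) = ip f a b - ip f a c := by
  rw [← ip_conj hf, ip_sub_left hf hb hc ha, map_sub, ip_conj hf, ip_conj hf]

theorem norm_ip_sq_le (hf : IsWeight f) (ha : MemL2 f a) (hb : MemL2 f b) :
    ‖ip f a b‖ ^ 2 ≤ normSq f a * normSq f b := by
  let V : Submodule ℂ (ℝ → Fin T → ℂ) :=
    { carrier := {b | MemL2 f b}
      zero_mem' := MemL2.zero
      add_mem' := fun ha hb => MemL2.add hf ha hb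
      smul_mem' := fun r _ hb => MemL2.smul hf hb r }
  let core : PreInnerProductSpace.Core ℂ V :=
    { inner := fun u v => ip f v u
      conj_inner_symm := fun u v => ip_conj hf
      re_inner_nonneg := fun u => by
        change 0 ≤ (ip f u.1 u.1).re
        rw [ip_self_re u.2]; exact normSq_nonneg hf
      add_left := fun u v w => ip_add_right hf w.2 u.2 v.2
      smul_left := fun u v r => ip_smul_right hf r }
  have h := InnerProductSpace.Core.inner_mul_inner_self_le (c := core) (⟨a, ha⟩ : V) ⟨b, hb⟩
  change ‖ip f b a‖ * ‖ip f a b‖ ≤ (ip f a a).re * (ip f b b).re at h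
  rwa [← ip_conj hf, RCLike.norm_conj, ← pow_two, ip_self_re ha, ip_self_re hb] at h

theorem normSq_add_le (hf : IsWeight f) (ha : MemL2 f a) (hb : MemL2 f b) :
    normSq f (a + b) ≤ 2 * normSq f a + 2 * normSq f b := by
  have h : ∫ x, (quad f (a + b) x).re ∂freq ≤
      ∫ x, (2 * (quad f a x).re + 2 * (quad f b x).re) ∂freq := by
    refine integral_mono_ae (ha.add hf hb).integrable_re
      ((ha.integrable_re.const_mul 2).add (hb.integrable_re.const_mul 2)) ?_
    filter_upwards [hf.posSemidef] with x hx
    exact quad_re_add_le hx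
  rw [integral_add (ha.integrable_re.const_mul 2) (hb.integrable_re.const_mul 2),
    integral_const_mul, integral_const_mul] at h
  have := mul_le_mul_of_nonneg_left h (by positivity : 0 ≤ 1 / (2 * Real.pi))
  unfold normSq
  linarith

theorem normSq_sub_comm : normSq f (a - b) = normSq f (b - a) := by
  have : quad f (a - b) = quad f (b - a) := by
    funext x
    have h := quad_smul (f := f) (b := b - a) (fun _ => (-1 : ℂ)) x
    have e : (fun x => (-1 : ℂ) • (b - a) x) = a - b := by funext x; simp
    rw [e] at h; simpa using h
  simp only [normSq, this]

/-- The quasi-triangle inequality for `normSq` through an intermediate point. -/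
theorem normSq_sub_le (hf : IsWeight f) (ha : MemL2 f a) (hb : MemL2 f b) (hc : MemL2 f c) :
    normSq f (a - c) ≤ 2 * normSq f (a - b) + 2 * normSq f (b - c) := by
  have := normSq_add_le hf (ha.sub hf hb) (hb.sub hf hc)
  rwa [sub_add_sub_cancel] at this

theorem normSq_add_of_ip_eq_zero (hf : IsWeight f) (ha : MemL2 f a) (hb : MemL2 f b)
    (h : ip f a b = 0) : normSq f (a + b) = normSq f a + normSq f b := by
  have h' : ip f b a = 0 := by rw [← ip_conj hf, h, map_zero]
  rw [← ip_self_re (ha.add hf hb), ip_add_left hf ha hb (ha.add hf hb), ip_add_right hf ha ha hb,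
    ip_add_right hf hb ha hb, h, h', ← ip_self_re ha, ← ip_self_re hb]
  simp

theorem normSq_congr (h : a =ᵐ[freq] b) : normSq f a = normSq f b := by
  unfold normSq
  congr 1
  refine integral_congr_ae ?_
  filter_upwards [h] with x hx
  simp only [quad, hx]

theorem MemL2.congr (ha : MemL2 f a) (h : a =ᵐ[freq] b) : MemL2 f b := by
  refine ⟨ha.1.congr h, ha.2.congr ?_⟩
  filter_upwards [h] with x hx
  simp only [quad, hx]

theorem tendsto_ip_left (hf : IsWeight f) {u : ℕ → ℝ → Fin T → ℂ} (hu : ∀ n, MemL2 f (u n))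
    (ha : MemL2 f a) (hb : MemL2 f b)
    (h : Tendsto (fun n => normSq f (a - u n)) atTop (𝓝 0)) :
    Tendsto (fun n => ip f (u n) b) atTop (𝓝 (ip f a b)) := by
  rw [tendsto_iff_norm_sub_tendsto_zero]
  have h2 : Tendsto (fun n => ‖ip f (u n) b - ip f a b‖ ^ 2) atTop (𝓝 0) := by
    have := h.mul_const (normSq f b)
    rw [zero_mul] at this
    refine squeeze_zero (fun n => by positivity) (fun n => ?_) this
    rw [norm_sub_rev, ← ip_sub_left hf ha (hu n) hb]
    exact norm_ip_sq_le hf (ha.sub hf (hu n)) hb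
  have := h2.sqrt
  simpa using this

theorem ae_eq_of_normSq_sub_eq_zero (hf : IsWeight f) (hinv : ∀ᵐ x ∂freq, IsUnit (f x).det)
    (ha : MemL2 f a) (hb : MemL2 f b) (h : normSq f (a - b) = 0) : a =ᵐ[freq] b := by
  have h1 : ∫ x, (quad f (a - b) x).re ∂freq = 0 := by
    rcases mul_eq_zero.1 h with h | h
    · have : (1 / (2 * Real.pi)) ≠ 0 := by positivity
      exact absurd h this
    · exact h
  rw [integral_eq_zero_iff_of_nonneg_ae ?_ (ha.sub hf hb).integrable_re] at h1
  · filter_upwards [h1, hf.posSemidef, hinv] with x hx hp hu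
    have hpd : (f x).PosDef := hp.posDef_iff_isUnit.2 ((Matrix.isUnit_iff_isUnit_det _).2 hu)
    by_contra hne
    have h0 : star (a x - b x) ≠ 0 := by
      rw [Ne, star_eq_zero, sub_eq_zero]; exact hne
    have := hpd.dotProduct_mulVec_pos h0
    rw [star_star] at this
    have h2 := (Complex.pos_iff.1 this).1
    exact h2.ne' hx
  · filter_upwards [hf.posSemidef] with x hx
    exact quad_re_nonneg hx

end WeightedSpace

/-! ### Exponentials and vector trigonometric polynomials -/

section Exponentials

theorem expi_add (m n : ℤ) (x : ℝ) : expi (m + n) x = expi m x * expi n x := by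
  simp only [expi, ← Complex.exp_add]; push_cast; ring_nf

theorem expi_zero (x : ℝ) : expi 0 x = 1 := by simp [expi]

theorem conj_expi (n : ℤ) (x : ℝ) : conj (expi n x) = expi (-n) x := by
  simp [expi, ← Complex.exp_conj]

theorem norm_expi (n : ℤ) (x : ℝ) : ‖expi n x‖ = 1 := by
  unfold expi; rw [Complex.norm_exp]; simp

theorem continuous_expi (n : ℤ) : Continuous (expi n) := by unfold expi; fun_prop

theorem integrable_of_continuous_norm_le {E : Type*} [NormedAddCommGroup E]
    [SecondCountableTopology E] {u : ℝ → E} (hu : Continuous u) {K : ℝ} (hK : ∀ x, ‖u x‖ ≤ K) :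
    Integrable u freq :=
  Integrable.of_bound hu.aestronglyMeasurable K (Eventually.of_forall hK)

theorem integrable_expi (n : ℤ) : Integrable (expi n) freq :=
  integrable_of_continuous_norm_le (continuous_expi n) fun x => (norm_expi n x).le

theorem integral_expi (n : ℤ) : ∫ x, expi n x ∂freq = if n = 0 then (2 * Real.pi : ℂ) else 0 := by
  have hpi : -Real.pi ≤ Real.pi := by linarith [Real.pi_pos]
  rw [freq, ← intervalIntegral.integral_of_le hpi]
  split_ifs with h
  · subst h; simp [expi]; ring
  · have hn : Complex.I * (n : ℂ) ≠ 0 := by simp [h]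
    simp only [expi]
    rw [integral_exp_mul_complex hn]
    have : Complex.exp (Complex.I * n * (Real.pi : ℝ)) =
        Complex.exp (Complex.I * n * ((-Real.pi : ℝ) : ℂ)) := by
      rw [Complex.exp_eq_exp_iff_exists_int]
      exact ⟨n, by push_cast; ring⟩
    rw [this, sub_self, zero_div]

/-- The function `x ↦ e^{ijx} δ_ν`. -/
noncomputable def unitExp {T : ℕ} (j : ℤ) (ν : Fin T) (x : ℝ) : Fin T → ℂ :=
  expi j x • Pi.single ν 1

variable {T : ℕ} {f : ℝ → Matrix (Fin T) (Fin T) ℂ} {a b c : ℝ → Fin T → ℂ}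

/-- `trigPoly` as a linear map. -/
noncomputable def trigLin (T : ℕ) : (ℤ →₀ (Fin T → ℂ)) →ₗ[ℂ] (ℝ → Fin T → ℂ) :=
  Finsupp.lsum ℂ fun j => LinearMap.pi fun x => expi j x • LinearMap.id

theorem trigLin_apply (p : ℤ →₀ (Fin T → ℂ)) : trigLin T p = trigPoly p := by
  funext x
  simp only [trigLin, Finsupp.lsum_apply, Finsupp.sum, Finset.sum_apply, trigPoly]
  rfl

theorem trigPoly_add (p q : ℤ →₀ (Fin T → ℂ)) : trigPoly (p + q) = trigPoly p + trigPoly q := by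
  simp only [← trigLin_apply, map_add]

theorem trigPoly_sub (p q : ℤ →₀ (Fin T → ℂ)) : trigPoly (p - q) = trigPoly p - trigPoly q := by
  simp only [← trigLin_apply, map_sub]

theorem trigPoly_neg (p : ℤ →₀ (Fin T → ℂ)) : trigPoly (-p) = -trigPoly p := by
  simp only [← trigLin_apply, map_neg]

theorem trigPoly_single (j : ℤ) (v : Fin T → ℂ) :
    trigPoly (Finsupp.single j v) = fun x => expi j x • v := by
  funext x; simp [trigPoly]

theorem trigPoly_eq_sum (p : ℤ →₀ (Fin T → ℂ)) :
    trigPoly p = ∑ j ∈ p.support, ∑ ν, p j ν • unitExp j ν := by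
  funext x
  simp only [trigPoly, Finsupp.sum, Finset.sum_apply]
  refine Finset.sum_congr rfl fun j _ => ?_
  ext μ
  simp [unitExp, Finset.sum_apply, Pi.single_apply, mul_comm]

theorem continuous_unitExp (j : ℤ) (ν : Fin T) : Continuous (unitExp (T := T) j ν) :=
  (continuous_expi j).smul continuous_const

theorem dotProduct_star_unitExp (v : Fin T → ℂ) (j : ℤ) (ν : Fin T) (x : ℝ) :
    v ⬝ᵥ star (unitExp j ν x) = v ν * expi (-j) x := by
  simp [unitExp, star_smul, dotProduct_smul, ← conj_expi, mul_comm]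

theorem quad_unitExp (j : ℤ) (ν : Fin T) (x : ℝ) : quad f (unitExp j ν) x = f x ν ν := by
  have := quad_smul (f := f) (b := fun _ => Pi.single ν 1) (expi j) x
  rw [norm_expi] at this
  refine this.trans ?_
  simp [quad]

theorem memL2_sum {ι : Type*} (hf : IsWeight f) (s : Finset ι) {u : ι → ℝ → Fin T → ℂ}
    (hu : ∀ i, MemL2 f (u i)) : MemL2 f (∑ i ∈ s, u i) := by
  classical
  induction s using Finset.induction_on with
  | empty => simpa using MemL2.zero
  | insert i s hi ih => rw [Finset.sum_insert hi]; exact (hu i).add hf ih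

theorem memL2_unitExp (hf : IsWeight f) (hd : ∀ ν, Integrable (fun x => f x ν ν) freq)
    (j : ℤ) (ν : Fin T) : MemL2 f (unitExp j ν) :=
  memL2_of_quad_le hf (continuous_unitExp j ν).aestronglyMeasurable (hd ν).re
    (Eventually.of_forall fun x => by rw [quad_unitExp]; rfl)

theorem memL2_trigPoly (hf : IsWeight f) (hd : ∀ ν, Integrable (fun x => f x ν ν) freq)
    (p : ℤ →₀ (Fin T → ℂ)) : MemL2 f (trigPoly p) := by
  rw [trigPoly_eq_sum]
  exact memL2_sum hf _ fun j => memL2_sum hf _ fun ν => (memL2_unitExp hf hd j ν).smul hf _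

theorem ip_sum_right {ι : Type*} (hf : IsWeight f) (ha : MemL2 f a) (s : Finset ι)
    {u : ι → ℝ → Fin T → ℂ} (hu : ∀ i, MemL2 f (u i)) :
    ip f a (∑ i ∈ s, u i) = ∑ i ∈ s, ip f a (u i) := by
  classical
  induction s using Finset.induction_on with
  | empty => simp [ip, form]
  | insert i s hi ih =>
    rw [Finset.sum_insert hi, Finset.sum_insert hi, ip_add_right hf ha (hu i) (memL2_sum hf s hu),
      ih]

theorem ip_trigPoly_right (hf : IsWeight f) (hd : ∀ ν, Integrable (fun x => f x ν ν) freq)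
    (ha : MemL2 f a) (p : ℤ →₀ (Fin T → ℂ)) :
    ip f a (trigPoly p) = ∑ j ∈ p.support, ∑ ν, conj (p j ν) * ip f a (unitExp j ν) := by
  have h := fun j ν => (memL2_unitExp hf hd j ν).smul hf (p j ν)
  rw [trigPoly_eq_sum, ip_sum_right hf ha _ fun j => memL2_sum hf _ (h j)]
  refine Finset.sum_congr rfl fun j _ => ?_
  rw [ip_sum_right hf ha _ (h j)]
  exact Finset.sum_congr rfl fun ν _ => ip_smul_right hf _

/-! ### The inverse weight -/

theorem aesm_det {A : ℝ → Matrix (Fin T) (Fin T) ℂ}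
    (hA : ∀ ν μ, AEStronglyMeasurable (fun x => A x ν μ) freq) :
    AEStronglyMeasurable (fun x => (A x).det) freq := by
  simp only [det_apply]
  refine Finset.aestronglyMeasurable_fun_sum _ fun σ _ => AEStronglyMeasurable.const_smul ?_ _
  exact Finset.aestronglyMeasurable_fun_prod _ fun i _ => hA _ _

theorem IsWeight.inv (hf : IsWeight f) : IsWeight fun x => (f x)⁻¹ where
  posSemidef := by filter_upwards [hf.posSemidef] with x hx using hx.inv
  aesm ν μ := by
    have h : ∀ x, (f x)⁻¹ ν μ = (f x).det⁻¹ * ((f x).updateRow μ (Pi.single ν 1)).det := by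
      intro x
      rw [inv_def, Matrix.smul_apply, adjugate_apply, Ring.inverse_eq_inv', smul_eq_mul]
    simp only [h]
    refine (aesm_det hf.aesm).inv₀.mul (aesm_det fun i j => ?_)
    by_cases hi : i = μ
    · subst hi; simp only [updateRow_self]; exact aestronglyMeasurable_const
    · simp only [updateRow_ne hi]; exact hf.aesm i j

/-- The function `x ↦ b(x)ᵀ f(x)⁻¹`. The map `b ↦ mulInv f b` is an isometry of `L₂(f⁻¹)` onto
`L₂(f)`. -/
noncomputable def mulInv (f : ℝ → Matrix (Fin T) (Fin T) ℂ) (b : ℝ → Fin T → ℂ) (x : ℝ) :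
    Fin T → ℂ :=
  b x ᵥ* (f x)⁻¹

theorem mulInv_sub : mulInv f (a - b) = mulInv f a - mulInv f b := by
  funext x; simp [mulInv, sub_vecMul]

theorem form_mulInv_right {x : ℝ} (hx : (f x).PosSemidef) (hu : IsUnit (f x).det) :
    form f a (mulInv f b) x = a x ⬝ᵥ star (b x) := by
  rw [form, mulInv, star_vecMul, hx.isHermitian.inv.eq, mulVec_mulVec, mul_nonsing_inv _ hu,
    one_mulVec]

theorem form_mulInv_left {x : ℝ} (hu : IsUnit (f x).det) :
    form f (mulInv f a) b x = a x ⬝ᵥ star (b x) := by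
  rw [form, mulInv, dotProduct_mulVec, vecMul_vecMul, nonsing_inv_mul _ hu, vecMul_one]

theorem quad_mulInv {x : ℝ} (hx : (f x).PosSemidef) (hu : IsUnit (f x).det) :
    quad f (mulInv f b) x = quad (fun x => (f x)⁻¹) b x := by
  rw [← form_self, form_mulInv_right hx hu, quad, mulInv, dotProduct_mulVec]

theorem aesm_mulInv (hf : IsWeight f) (hb : AEStronglyMeasurable b freq) :
    AEStronglyMeasurable (mulInv f b) freq := by
  refine aesm_pi fun ν => ?_
  simp only [mulInv, vecMul, dotProduct]
  exact Finset.aestronglyMeasurable_fun_sum _ fun μ _ => (aesm_eval hb μ).mul (hf.inv.aesm μ ν)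

theorem MemL2.mulInv (hf : IsWeight f) (hinv : ∀ᵐ x ∂freq, IsUnit (f x).det)
    (hb : MemL2 (fun x => (f x)⁻¹) b) : MemL2 f (mulInv f b) := by
  refine ⟨aesm_mulInv hf hb.1, hb.2.congr ?_⟩
  filter_upwards [hf.posSemidef, hinv] with x hx hu
  exact (quad_mulInv hx hu).symm

theorem normSq_mulInv (hf : IsWeight f) (hinv : ∀ᵐ x ∂freq, IsUnit (f x).det) :
    normSq f (mulInv f b) = normSq (fun x => (f x)⁻¹) b := by
  unfold normSq
  congr 1
  refine integral_congr_ae ?_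
  filter_upwards [hf.posSemidef, hinv] with x hx hu
  rw [quad_mulInv hx hu]

theorem ip_mulInv_right (hf : IsWeight f) (hinv : ∀ᵐ x ∂freq, IsUnit (f x).det) :
    ip f a (mulInv f b) = (1 / (2 * Real.pi) : ℂ) * ∫ x, a x ⬝ᵥ star (b x) ∂freq := by
  unfold ip
  congr 1
  refine integral_congr_ae ?_
  filter_upwards [hf.posSemidef, hinv] with x hx hu
  exact form_mulInv_right hx hu

theorem ip_mulInv_left (hinv : ∀ᵐ x ∂freq, IsUnit (f x).det) :
    ip f (mulInv f a) b = (1 / (2 * Real.pi) : ℂ) * ∫ x, a x ⬝ᵥ star (b x) ∂freq := by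
  unfold ip
  congr 1
  refine integral_congr_ae ?_
  filter_upwards [hinv] with x hu
  exact form_mulInv_left hu

theorem MinimalityCondition.integrable_inv_diag (hmin : MinimalityCondition f) (hf : IsWeight f)
    (ν : Fin T) : Integrable (fun x => (f x)⁻¹ ν ν) freq := by
  refine hmin.2.mono (hf.inv.aesm ν ν) ?_
  filter_upwards [hf.inv.posSemidef] with x hx
  have h : (f x)⁻¹ ν ν ≤ (f x)⁻¹.trace :=
    Finset.single_le_sum (f := fun i => (f x)⁻¹ i i) (fun i _ => hx.diag_nonneg)
      (Finset.mem_univ ν)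
  have h0 : 0 ≤ (f x)⁻¹ ν ν := hx.diag_nonneg
  exact CStarAlgebra.norm_le_norm_of_nonneg_of_le h0 h

/-- A weight with the minimality condition, whose diagonal is integrable. -/
structure IsMinimalWeight (f : ℝ → Matrix (Fin T) (Fin T) ℂ) : Prop extends IsWeight f where
  integrable_diag : ∀ ν, Integrable (fun x => f x ν ν) freq
  isUnit_det : ∀ᵐ x ∂freq, IsUnit (f x).det
  integrable_inv_diag : ∀ ν, Integrable (fun x => (f x)⁻¹ ν ν) freq

namespace IsMinimalWeight

variable (hf : IsMinimalWeight f)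
include hf

theorem memL2_trigPoly (p : ℤ →₀ (Fin T → ℂ)) : MemL2 f (trigPoly p) :=
  PCSeq.memL2_trigPoly hf.toIsWeight hf.integrable_diag p

theorem memL2_inv_trigPoly (p : ℤ →₀ (Fin T → ℂ)) : MemL2 (fun x => (f x)⁻¹) (trigPoly p) :=
  PCSeq.memL2_trigPoly hf.inv hf.integrable_inv_diag p

theorem memL2_unitExp (j : ℤ) (ν : Fin T) : MemL2 f (unitExp j ν) :=
  PCSeq.memL2_unitExp hf.toIsWeight hf.integrable_diag j ν

theorem memL2_mulInv_unitExp (j : ℤ) (ν : Fin T) : MemL2 f (mulInv f (unitExp j ν)) :=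
  (PCSeq.memL2_unitExp hf.inv hf.integrable_inv_diag j ν).mulInv hf.toIsWeight hf.isUnit_det

theorem memL2_mulInv_trigPoly (p : ℤ →₀ (Fin T → ℂ)) : MemL2 f (mulInv f (trigPoly p)) :=
  (hf.memL2_inv_trigPoly p).mulInv hf.toIsWeight hf.isUnit_det

/-- The pairing with `e^{ijx} δ_ν f⁻¹` is a Fourier coefficient; by the Cauchy–Schwarz inequality
Fourier coefficients are therefore continuous on `L₂(f)`. -/
theorem ip_mulInv_unitExp (b : ℝ → Fin T → ℂ) (j : ℤ) (ν : Fin T) :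
    ip f b (mulInv f (unitExp j ν)) =
      (1 / (2 * Real.pi) : ℂ) * ∫ x, b x ν * expi (-j) x ∂freq := by
  rw [ip_mulInv_right hf.toIsWeight hf.isUnit_det]
  simp only [dotProduct_star_unitExp]

theorem integrable_of_memL2 (hb : MemL2 f b) (ν : Fin T) : Integrable (fun x => b x ν) freq := by
  refine (hb.integrable_form hf.toIsWeight (hf.memL2_mulInv_unitExp 0 ν)).congr ?_
  filter_upwards [hf.posSemidef, hf.isUnit_det] with x hx hu
  rw [form_mulInv_right hx hu, dotProduct_star_unitExp, neg_zero, expi_zero, mul_one]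

theorem ip_mulInv_trigPoly (hb : MemL2 f b) (p : ℤ →₀ (Fin T → ℂ)) :
    ip f b (mulInv f (trigPoly p)) =
      ∑ j ∈ p.support, ∑ ν, conj (p j ν) * ip f b (mulInv f (unitExp j ν)) := by
  have h := fun j ν => (hf.memL2_mulInv_unitExp j ν).smul hf.toIsWeight (p j ν)
  have e : mulInv f (trigPoly p) =
      ∑ j ∈ p.support, ∑ ν, p j ν • mulInv f (unitExp j ν) := by
    rw [trigPoly_eq_sum]
    funext x
    simp [mulInv, Finset.sum_apply, sum_vecMul, smul_vecMul]
  rw [e, ip_sum_right hf.toIsWeight hb _ fun j => memL2_sum hf.toIsWeight _ (h j)]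
  refine Finset.sum_congr rfl fun j _ => ?_
  rw [ip_sum_right hf.toIsWeight hb _ (h j)]
  exact Finset.sum_congr rfl fun ν _ => ip_smul_right hf.toIsWeight _

theorem ip_trigPoly_unitExp (p : ℤ →₀ (Fin T → ℂ)) (j : ℤ) (ν : Fin T) :
    ip f (trigPoly p) (mulInv f (unitExp j ν)) = p j ν := by
  rw [hf.ip_mulInv_unitExp]
  have : ∀ x, trigPoly p x ν * expi (-j) x = ∑ k ∈ p.support, p k ν * expi (k - j) x := by
    intro x
    simp only [trigPoly, Finsupp.sum, Finset.sum_apply, Finset.sum_mul]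
    refine Finset.sum_congr rfl fun k _ => ?_
    rw [sub_eq_add_neg, expi_add]; simp; ring
  simp only [this]
  rw [integral_finsetSum _ fun k _ => (integrable_expi _).const_mul _]
  simp only [integral_const_mul, integral_expi, sub_eq_zero]
  have hpi : (Real.pi : ℂ) ≠ 0 := by exact_mod_cast Real.pi_ne_zero
  by_cases hj : j ∈ p.support
  · simp only [mul_ite, mul_zero, Finset.sum_ite_eq', hj, if_true]
    field_simp
  · simp only [mul_ite, mul_zero, Finset.sum_ite_eq', hj, if_false]
    simp [Finsupp.notMem_support_iff.1 hj]

theorem memSpan_trigPoly {D : Set ℤ} {p : ℤ →₀ (Fin T → ℂ)} (hp : (p.support : Set ℤ) ⊆ D) :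
    MemSpan f D (trigPoly p) := by
  refine ⟨hf.memL2_trigPoly p, fun ε hε => ⟨p, hp, ?_⟩⟩
  rw [sub_self]
  simpa [normSq, quad] using hε

end IsMinimalWeight

end Exponentials

/-! ### The operator `B` and its inverse -/

section Operator

variable {T : ℕ} {f : ℝ → Matrix (Fin T) (Fin T) ℂ} {G : Set ℤ}

/-- The sequence of `ℓ²(G; ℂ^T)` with the only nonzero component `δ_ν` at `k`. -/
noncomputable def unitSeq (k : G) (ν : Fin T) : l2 G T :=
  lp.single 2 k (EuclideanSpace.single ν 1)

theorem unitSeq_mem (hmat : IsMatrixOperator f G) (k : G) (ν : Fin T) :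
    unitSeq k ν ∈ Bdom f G := by
  refine hmat _ ((Set.finite_singleton k).subset fun j hj => ?_)
  by_contra h
  exact hj (lp.single_apply_ne (E := fun _ : G => EuclideanSpace ℂ (Fin T)) 2 k _ h)

/-- The column of the matrix `{B(k-j)}` with the indices `k`, `ν`. -/
noncomputable def column (hmat : IsMatrixOperator f G) (k : G) (ν : Fin T) : l2 G T :=
  Bop f G ⟨unitSeq k ν, unitSeq_mem hmat k ν⟩

theorem column_apply (hmat : IsMatrixOperator f G) (k j : G) (ν μ : Fin T) :
    column hmat k ν j μ = Bcoef f ((j : ℤ) - k) μ ν := by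
  change Bapply f G (⇑(unitSeq k ν)) j μ = _
  rw [Bapply, tsum_eq_single k]
  · have : (unitSeq k ν : l2 G T) k = EuclideanSpace.single ν 1 :=
      lp.single_apply_self (E := fun _ : G => EuclideanSpace ℂ (Fin T)) 2 k _
    rw [Bterm, this]
    simp
  · intro i hi
    have : (unitSeq k ν : l2 G T) i = 0 :=
      lp.single_apply_ne (E := fun _ : G => EuclideanSpace ℂ (Fin T)) 2 k _ hi
    rw [Bterm, this, map_zero]

theorem IsMinimalWeight.ip_mulInv_unitExp_mulInv_unitExp (hf : IsMinimalWeight f) (j k : ℤ)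
    (ν μ : Fin T) :
    ip f (mulInv f (unitExp j μ)) (mulInv f (unitExp k ν)) = Bcoef f (k - j) ν μ := by
  rw [hf.ip_mulInv_unitExp]
  simp only [Bcoef, Matrix.of_apply, transpose_apply]
  congr 1
  refine integral_congr_ae (Eventually.of_forall fun x => ?_)
  have : (-(k - j) : ℤ) = j + -k := by ring
  simp only [mulInv, unitExp, smul_vecMul, Pi.smul_apply, single_one_vecMul, this, expi_add,
    smul_eq_mul, row_apply]
  ring

theorem IsMinimalWeight.conj_Bcoef (hf : IsMinimalWeight f) (j k : ℤ) (ν μ : Fin T) :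
    conj (Bcoef f (k - j) ν μ) = Bcoef f (j - k) μ ν := by
  rw [← hf.ip_mulInv_unitExp_mulInv_unitExp, ip_conj hf.toIsWeight,
    hf.ip_mulInv_unitExp_mulInv_unitExp]

theorem Bterm_eq_inner (hf : IsMinimalWeight f) (hmat : IsMatrixOperator f G) (x : l2 G T)
    (k j : G) (ν : Fin T) :
    Bterm f G (⇑x) k j ν = inner ℂ (column hmat k ν j) (x j) := by
  rw [Bterm, Matrix.toLpLin_apply, PiLp.inner_apply]
  simp only [mulVec, dotProduct, RCLike.inner_apply, column_apply, hf.conj_Bcoef]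
  exact Finset.sum_congr rfl fun μ _ => mul_comm _ _

/-- As the columns are square-summable and the matrix is Hermitian, the series of `B x` converge
for every `x ∈ ℓ²`: the components of `B x` are the inner products of `x` with the columns. -/
theorem hasSum_Bterm (hf : IsMinimalWeight f) (hmat : IsMatrixOperator f G) (x : l2 G T) (k : G) :
    HasSum (Bterm f G (⇑x) k)
      (WithLp.toLp 2 fun ν => (inner ℂ (column hmat k ν) x : ℂ)) := by
  have h : HasSum (fun j => WithLp.ofLp (Bterm f G (⇑x) k j))
      (fun ν => (inner ℂ (column hmat k ν) x : ℂ)) := by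
    rw [Pi.hasSum]
    intro ν
    simp only [Bterm_eq_inner hf hmat]
    exact lp.hasSum_inner _ _
  exact h.mapL (PiLp.continuousLinearEquiv 2 ℂ fun _ : Fin T => ℂ).symm.toContinuousLinearMap

theorem Bapply_apply (hf : IsMinimalWeight f) (hmat : IsMatrixOperator f G) (x : l2 G T) (k : G)
    (ν : Fin T) : Bapply f G (⇑x) k ν = inner ℂ (column hmat k ν) x := by
  rw [Bapply, (hasSum_Bterm hf hmat x k).tsum_eq]

/-- If the components of `y` are the inner products of `x` with the columns, then `B x = y`. -/
theorem exists_Bop_eq (hf : IsMinimalWeight f) (hmat : IsMatrixOperator f G) {x y : l2 G T}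
    (h : ∀ k ν, (inner ℂ (column hmat k ν) x : ℂ) = y k ν) :
    ∃ hx : x ∈ Bdom f G, Bop f G ⟨x, hx⟩ = y := by
  have e : Bapply f G (⇑x) = ⇑y := by
    funext k; ext ν; rw [Bapply_apply hf hmat, h]
  have hx : x ∈ Bdom f G := ⟨fun k => (hasSum_Bterm hf hmat x k).summable, by
    rw [e]; exact lp.memℓp y⟩
  exact ⟨hx, Subtype.ext e⟩

theorem continuous_l2_eval (k : G) (ν : Fin T) : Continuous fun x : l2 G T => x k ν := by
  have h1 : Continuous fun x : l2 G T => x k :=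
    (continuous_apply k).comp (lp.uniformContinuous_coe (p := 2)).continuous
  exact (EuclideanSpace.proj ν : EuclideanSpace ℂ (Fin T) →L[ℂ] ℂ).continuous.comp h1

/-- By the closed graph theorem the inverse of `B` is bounded. -/
theorem continuous_Binv (hf : IsMinimalWeight f) (hmat : IsMatrixOperator f G)
    (hB : BInvertible f G) : Continuous (Binv hB) := by
  let g : l2 G T →ₗ[ℂ] l2 G T :=
    (Bdom f G).subtype ∘ₗ (LinearEquiv.ofBijective (Bop f G) hB).symm.toLinearMap
  refine LinearMap.continuous_of_seq_closed_graph (g := g) fun u x y hu hy => ?_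
  have hkey : ∀ n k ν, (inner ℂ (column hmat k ν) (g (u n)) : ℂ) = u n k ν := by
    intro n k ν
    rw [← Bapply_apply hf hmat]
    have := (LinearEquiv.ofBijective (Bop f G) hB).apply_symm_apply (u n)
    exact congrArg (fun z : l2 G T => z k ν) this
  have hlim : ∀ k ν, (inner ℂ (column hmat k ν) y : ℂ) = x k ν := by
    intro k ν
    have h1 := ((continuous_l2_eval k ν).tendsto x).comp hu
    have h2 : Tendsto (fun n => (inner ℂ (column hmat k ν) (g (u n)) : ℂ)) atTop
        (𝓝 (inner ℂ (column hmat k ν) y)) := tendsto_const_nhds.inner hy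
    simp only [hkey] at h2
    exact tendsto_nhds_unique h2 h1
  obtain ⟨hy', h⟩ := exists_Bop_eq hf hmat hlim
  have : (LinearEquiv.ofBijective (Bop f G) hB).symm x = ⟨y, hy'⟩ := by
    rw [LinearEquiv.symm_apply_eq]; exact h.symm
  exact congrArg Subtype.val this.symm

/-- A vector orthogonal to all columns is annihilated by `B`; as `B` is injective, the columns
span a dense subspace. -/
theorem topologicalClosure_span_column (hf : IsMinimalWeight f) (hmat : IsMatrixOperator f G)
    (hB : BInvertible f G) :
    (Submodule.span ℂ {y | ∃ k ν, y = column hmat k ν}).topologicalClosure = ⊤ := by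
  rw [Submodule.topologicalClosure_eq_top_iff, Submodule.eq_bot_iff]
  intro y hy
  have h : ∀ k ν, (inner ℂ (column hmat k ν) y : ℂ) = (0 : l2 G T) k ν := fun k ν =>
    (Submodule.mem_orthogonal _ _).1 hy _ (Submodule.subset_span ⟨k, ν, rfl⟩)
  obtain ⟨hy', h⟩ := exists_Bop_eq hf hmat h
  have : (⟨y, hy'⟩ : Bdom f G) = 0 := hB.1 (h.trans (map_zero _).symm)
  exact congrArg Subtype.val this

theorem exists_finsupp_of_mem_span_column (hf : IsMinimalWeight f) (hmat : IsMatrixOperator f G)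
    (hB : BInvertible f G) {y : l2 G T}
    (hy : y ∈ Submodule.span ℂ {y | ∃ k ν, y = column hmat k ν}) :
    ∃ p : ℤ →₀ (Fin T → ℂ), (p.support : Set ℤ) ⊆ G ∧
      (∀ k : G, Binv hB y k = WithLp.toLp 2 (p k)) ∧
      ∀ (k : G) ν, y k ν = ip f (mulInv f (trigPoly p)) (mulInv f (unitExp k ν)) := by
  let g : l2 G T →ₗ[ℂ] l2 G T :=
    (Bdom f G).subtype ∘ₗ (LinearEquiv.ofBijective (Bop f G) hB).symm.toLinearMap
  change ∃ p : ℤ →₀ (Fin T → ℂ), (p.support : Set ℤ) ⊆ G ∧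
      (∀ k : G, g y k = WithLp.toLp 2 (p k)) ∧ _
  have hw := hf.toIsWeight
  induction hy using Submodule.span_induction with
  | mem y hy =>
    classical
    obtain ⟨j, μ, rfl⟩ := hy
    refine ⟨Finsupp.single j (Pi.single μ 1), ?_, fun k => ?_, fun k ν => ?_⟩
    · intro i hi
      have := Finsupp.support_single_subset hi
      rw [Finset.mem_singleton] at this
      exact this ▸ j.2
    · have h1 : g (column hmat j μ) = unitSeq j μ := by
        change (((LinearEquiv.ofBijective (Bop f G) hB).symm (column hmat j μ) : Bdom f G) :
          l2 G T) = _
        have : (LinearEquiv.ofBijective (Bop f G) hB).symm (column hmat j μ) =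
            ⟨unitSeq j μ, unitSeq_mem hmat j μ⟩ := by
          rw [LinearEquiv.symm_apply_eq]; rfl
        rw [this]
      rw [h1]
      by_cases hk : k = j
      · subst hk
        rw [Finsupp.single_eq_same]
        exact lp.single_apply_self (E := fun _ : G => EuclideanSpace ℂ (Fin T)) 2 k _
      · rw [Finsupp.single_eq_of_ne (fun h => hk (Subtype.ext h))]
        exact lp.single_apply_ne (E := fun _ : G => EuclideanSpace ℂ (Fin T)) 2 j _ hk
    · rw [column_apply, trigPoly_single, ← hf.ip_mulInv_unitExp_mulInv_unitExp]
      rfl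
  | zero =>
    refine ⟨0, by simp, fun k => by rw [map_zero]; rfl, fun k ν => ?_⟩
    simp [ip, form, mulInv, trigPoly]
  | add y z _ _ ihy ihz =>
    obtain ⟨p, hp, hp1, hp2⟩ := ihy
    obtain ⟨q, hq, hq1, hq2⟩ := ihz
    refine ⟨p + q, ?_, fun k => ?_, fun k ν => ?_⟩
    · classical
      intro i hi
      rcases Finset.mem_union.1 (Finsupp.support_add hi) with h | h
      exacts [hp h, hq h]
    · rw [map_add, lp.coeFn_add, Pi.add_apply, hp1, hq1]; rfl
    · have : mulInv f (trigPoly (p + q)) = mulInv f (trigPoly p) + mulInv f (trigPoly q) := by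
        funext x; simp [mulInv, trigPoly_add, add_vecMul]
      rw [this, ip_add_left hw (hf.memL2_mulInv_trigPoly p) (hf.memL2_mulInv_trigPoly q)
        (hf.memL2_mulInv_unitExp k ν), ← hp2, ← hq2]
      rfl
  | smul r y _ ih =>
    obtain ⟨p, hp, hp1, hp2⟩ := ih
    refine ⟨r • p, fun i hi => hp (Finsupp.support_smul hi), fun k => ?_, fun k ν => ?_⟩
    · rw [map_smul, lp.coeFn_smul, Pi.smul_apply, hp1]; rfl
    · have : mulInv f (trigPoly (r • p)) = r • mulInv f (trigPoly p) := by
        funext x; simp only [← trigLin_apply, map_smul]; simp [mulInv, smul_vecMul]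
      rw [this, ip_smul_left, ← hp2]
      rfl

/-- The solution `c = B⁻¹ b` is a limit of finitely supported sequences `p_n` such that also
`B p_n → b`. The components of `B p_n` are expressed through the semi-inner product of `L₂(f)`. -/
theorem exists_seq_tendsto_Binv (hf : IsMinimalWeight f) (hmat : IsMatrixOperator f G)
    (hB : BInvertible f G) (b : l2 G T) :
    ∃ (p : ℕ → ℤ →₀ (Fin T → ℂ)) (x y : ℕ → l2 G T), (∀ n, ((p n).support : Set ℤ) ⊆ G) ∧
      (∀ n (k : G), x n k = WithLp.toLp 2 (p n k)) ∧
      (∀ n (k : G) ν, y n k ν = ip f (mulInv f (trigPoly (p n))) (mulInv f (unitExp k ν))) ∧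
      Tendsto x atTop (𝓝 (Binv hB b)) ∧ Tendsto y atTop (𝓝 b) := by
  have hb : b ∈ closure (Submodule.span ℂ {y | ∃ k ν, y = column hmat k ν} : Set (l2 G T)) := by
    rw [← Submodule.topologicalClosure_coe, topologicalClosure_span_column hf hmat hB]; trivial
  obtain ⟨y, hy, hlim⟩ := mem_closure_iff_seq_limit.1 hb
  choose p hp hp1 hp2 using fun n => exists_finsupp_of_mem_span_column hf hmat hB (hy n)
  exact ⟨p, fun n => Binv hB (y n), y, hp, hp1, hp2,
    ((continuous_Binv hf hmat hB).tendsto b).comp hlim, hlim⟩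

end Operator

/-! ### The function `C(e^{ix})` -/

section Synthesis

variable {T : ℕ} {f : ℝ → Matrix (Fin T) (Fin T) ℂ} {G : Set ℤ}

theorem expVec_coeFn (n : ℤ) (v : EuclideanSpace ℂ (Fin T)) :
    expVec n v =ᵐ[freq] fun x => expi n x • v := MemLp.coeFn_toLp _

theorem inner_expVec (m n : ℤ) (v w : EuclideanSpace ℂ (Fin T)) :
    (inner ℂ (expVec m v) (expVec n w) : ℂ) = if m = n then 2 * Real.pi * inner ℂ v w else 0 := by
  have h : (inner ℂ (expVec m v) (expVec n w) : ℂ) =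
      ∫ x, expi (n - m) x * inner ℂ v w ∂freq := by
    rw [L2.inner_def]
    refine integral_congr_ae ?_
    filter_upwards [expVec_coeFn m v, expVec_coeFn n w] with x h1 h2
    rw [h1, h2, inner_smul_left, inner_smul_right, conj_expi, sub_eq_add_neg, expi_add]; ring
  rw [h, integral_mul_const, integral_expi]
  by_cases hmn : m = n
  · simp [hmn]
  · rw [if_neg hmn, if_neg (fun h => hmn (by omega)), zero_mul]

theorem expVec_add (n : ℤ) (v w : EuclideanSpace ℂ (Fin T)) :
    expVec n (v + w) = expVec n v + expVec n w := by
  refine Lp.ext ?_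
  filter_upwards [expVec_coeFn n v, expVec_coeFn n w, expVec_coeFn n (v + w),
    Lp.coeFn_add (expVec n v) (expVec n w)] with x h1 h2 h3 h4
  rw [h3, h4, Pi.add_apply, h1, h2, smul_add]

theorem expVec_smul (n : ℤ) (r : ℂ) (v : EuclideanSpace ℂ (Fin T)) :
    expVec n (r • v) = r • expVec n v := by
  refine Lp.ext ?_
  filter_upwards [expVec_coeFn n v, expVec_coeFn n (r • v), Lp.coeFn_smul r (expVec n v)]
    with x h1 h3 h4
  rw [h3, h4, Pi.smul_apply, h1, smul_comm]

theorem expVec_zero (n : ℤ) : expVec n (0 : EuclideanSpace ℂ (Fin T)) = 0 := by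
  simpa using expVec_smul n 0 (0 : EuclideanSpace ℂ (Fin T))

/-- The linear map `v ↦ (2π)^{-1/2} e^{inx} v` of `ℂ^T` into `L²((-π, π]; ℂ^T)`. -/
noncomputable def expLinear (T : ℕ) (n : ℤ) :
    EuclideanSpace ℂ (Fin T) →ₗ[ℂ] Lp (EuclideanSpace ℂ (Fin T)) 2 freq where
  toFun v := ((Real.sqrt (2 * Real.pi) : ℝ) : ℂ)⁻¹ • expVec n v
  map_add' v w := by rw [expVec_add, smul_add]
  map_smul' r v := by rw [expVec_smul, RingHom.id_apply, smul_comm r]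

theorem inner_expLinear (n : ℤ) (v w : EuclideanSpace ℂ (Fin T)) :
    (inner ℂ (expLinear T n v) (expLinear T n w) : ℂ) = inner ℂ v w := by
  have h : (Real.sqrt (2 * Real.pi) : ℂ) * Real.sqrt (2 * Real.pi) = 2 * Real.pi := by
    rw [← Complex.ofReal_mul, Real.mul_self_sqrt (by positivity)]; push_cast; rfl
  have h0 : (Real.sqrt (2 * Real.pi) : ℂ) ≠ 0 := by
    rw [Complex.ofReal_ne_zero]; positivity
  change (inner ℂ (((Real.sqrt (2 * Real.pi) : ℝ) : ℂ)⁻¹ • expVec n v)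
    (((Real.sqrt (2 * Real.pi) : ℝ) : ℂ)⁻¹ • expVec n w) : ℂ) = _
  rw [inner_smul_left, inner_smul_right, inner_expVec, if_pos rfl, ← h, map_inv₀,
    Complex.conj_ofReal]
  field_simp

/-- The isometry `v ↦ (2π)^{-1/2} e^{inx} v` of `ℂ^T` into `L²((-π, π]; ℂ^T)`. -/
noncomputable def expIsometry (T : ℕ) (n : ℤ) :
    EuclideanSpace ℂ (Fin T) →ₗᵢ[ℂ] Lp (EuclideanSpace ℂ (Fin T)) 2 freq :=
  (expLinear T n).isometryOfInner (inner_expLinear n)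

theorem expIsometry_apply (n : ℤ) (v : EuclideanSpace ℂ (Fin T)) :
    expIsometry T n v = ((Real.sqrt (2 * Real.pi) : ℝ) : ℂ)⁻¹ • expVec n v := rfl

theorem orthogonalFamily_expIsometry (T : ℕ) (G : Set ℤ) :
    OrthogonalFamily ℂ (fun _ : G => EuclideanSpace ℂ (Fin T)) fun n => expIsometry T n := by
  intro m n hmn v w
  rw [expIsometry_apply, expIsometry_apply, inner_smul_left, inner_smul_right, inner_expVec,
    if_neg (fun h => hmn (Subtype.ext h)), mul_zero, mul_zero]

/-- The linear map `c ↦ ∑_{n ∈ G} c(n) e^{inx}` from `ℓ²` to `L²`. -/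
noncomputable def synthesis (T : ℕ) (G : Set ℤ) :
    l2 G T →L[ℂ] Lp (EuclideanSpace ℂ (Fin T)) 2 freq :=
  ((Real.sqrt (2 * Real.pi) : ℝ) : ℂ) •
    (orthogonalFamily_expIsometry T G).linearIsometry.toContinuousLinearMap

theorem hasSum_synthesis (c : l2 G T) :
    HasSum (fun n : G => expVec (n : ℤ) (c n)) (synthesis T G c) := by
  have h0 : ((Real.sqrt (2 * Real.pi) : ℝ) : ℂ) ≠ 0 := by
    rw [Complex.ofReal_ne_zero]; positivity
  have h := ((orthogonalFamily_expIsometry T G).hasSum_linearIsometry c).const_smul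
    ((Real.sqrt (2 * Real.pi) : ℝ) : ℂ)
  simp only [expIsometry_apply, smul_inv_smul₀ h0] at h
  exact h

theorem Cfun_eq (c : l2 G T) (x : ℝ) : Cfun c x = WithLp.ofLp (synthesis T G c x) := by
  rw [Cfun, (hasSum_synthesis c).tsum_eq]

theorem inner_expVec_synthesis_of_notMem (c : l2 G T) {j : ℤ} (hj : j ∉ G)
    (v : EuclideanSpace ℂ (Fin T)) :
    (inner ℂ (expVec j v) (synthesis T G c) : ℂ) = 0 := by
  have h := (hasSum_synthesis c).mapL (innerSL ℂ (expVec j v))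
  simp only [innerSL_apply_apply, inner_expVec] at h
  refine h.unique ?_
  convert! (hasSum_zero : HasSum (fun _ : G => (0 : ℂ)) 0) using 2 with k
  exact if_neg fun h : j = k => hj (h ▸ k.2)

theorem integral_Cfun_dotProduct_star_unitExp (c : l2 G T) (j : ℤ) (ν : Fin T) :
    ∫ x, Cfun c x ⬝ᵥ star (unitExp j ν x) ∂freq =
      inner ℂ (expVec j (EuclideanSpace.single ν 1)) (synthesis T G c) := by
  rw [L2.inner_def]
  refine integral_congr_ae ?_
  filter_upwards [expVec_coeFn j (EuclideanSpace.single ν (1 : ℂ))] with x h1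
  rw [h1, dotProduct_star_unitExp, inner_smul_left, EuclideanSpace.inner_single_left, conj_expi,
    Cfun_eq, map_one, one_mul, mul_comm]

theorem synthesis_coeFn_of_finsupp {x : l2 G T} {p : ℤ →₀ (Fin T → ℂ)}
    (hp : (p.support : Set ℤ) ⊆ G) (hx : ∀ k : G, x k = WithLp.toLp 2 (p k)) :
    synthesis T G x =ᵐ[freq] fun t => WithLp.toLp 2 (trigPoly p t) := by
  classical
  have h1 : synthesis T G x = ∑ j ∈ p.support, expVec j (WithLp.toLp 2 (p j)) := by
    refine (hasSum_synthesis x).unique ?_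
    have h2 : HasSum (fun n : ℤ => expVec n (WithLp.toLp 2 (p n)))
        (∑ j ∈ p.support, expVec j (WithLp.toLp 2 (p j))) := by
      refine hasSum_sum_of_ne_finset_zero fun j hj => ?_
      rw [Finsupp.notMem_support_iff.1 hj, WithLp.toLp_zero, expVec_zero]
    have h3 : Function.support (fun n : ℤ => expVec n (WithLp.toLp 2 (p n))) ⊆
        Set.range (Subtype.val : G → ℤ) := by
      rw [Subtype.range_coe]
      intro j hj
      refine hp (Finsupp.mem_support_iff.2 fun h0 => hj ?_)
      change expVec j (WithLp.toLp 2 (p j)) = 0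
      rw [h0, WithLp.toLp_zero, expVec_zero]
    simp only [hx]
    refine (Function.Injective.hasSum_iff (f := fun n : ℤ => expVec n (WithLp.toLp 2 (p n)))
      Subtype.val_injective fun j hj => ?_).2 h2
    exact Function.notMem_support.1 fun h => hj (h3 h)
  rw [h1]
  filter_upwards [Lp.coeFn_finsetSum p.support fun j => expVec j (WithLp.toLp 2 (p j)),
    (Finset.eventually_all p.support).2 fun j _ => expVec_coeFn j (WithLp.toLp 2 (p j))] with t h2 h3
  rw [h2, Finset.sum_apply, Finset.sum_congr rfl h3]
  simp [trigPoly, Finsupp.sum]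

/-- Fatou's lemma in `L₂(F)`: a Cauchy sequence that converges almost everywhere converges in
`L₂(F)` to its pointwise limit. -/
theorem memL2_and_tendsto_of_cauchy {F : ℝ → Matrix (Fin T) (Fin T) ℂ} (hF : IsWeight F)
    {u : ℕ → ℝ → Fin T → ℂ} {v : ℝ → Fin T → ℂ} (hu : ∀ n, MemL2 F (u n))
    (hv : ∀ᵐ x ∂freq, Tendsto (fun n => u n x) atTop (𝓝 (v x)))
    (hC : ∀ ε > 0, ∃ n₀, ∀ n ≥ n₀, ∀ m ≥ n₀, normSq F (u n - u m) ≤ ε) :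
    MemL2 F v ∧ Tendsto (fun n => normSq F (v - u n)) atTop (𝓝 0) := by
  have hvm : AEStronglyMeasurable v freq := aestronglyMeasurable_of_tendsto_ae _ (fun n => (hu n).1) hv
  have key : ∀ ε > 0, ∃ n₀, ∀ n ≥ n₀, MemL2 F (v - u n) ∧ normSq F (v - u n) ≤ ε := by
    intro ε hε
    obtain ⟨n₀, h₀⟩ := hC ε hε
    refine ⟨n₀, fun n hn => ?_⟩
    have hq : ∀ m, ∫⁻ x, ENNReal.ofReal (quad F (u m - u n) x).re ∂freq =
        ENNReal.ofReal (2 * Real.pi * normSq F (u m - u n)) := by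
      intro m
      rw [← ofReal_integral_eq_lintegral_ofReal ((hu m).sub hF (hu n)).integrable_re]
      · congr 1
        unfold normSq
        field_simp
      · filter_upwards [hF.posSemidef] with x hx
        exact quad_re_nonneg hx
    have hlim : ∀ᵐ x ∂freq, Tendsto (fun m => ENNReal.ofReal (quad F (u m - u n) x).re) atTop
        (𝓝 (ENNReal.ofReal (quad F (v - u n) x).re)) := by
      filter_upwards [hv] with x hx
      refine (ENNReal.continuous_ofReal.tendsto _).comp ((Complex.continuous_re.tendsto _).comp ?_)
      have hc : Continuous fun z : Fin T → ℂ => (z - u n x) ⬝ᵥ (F x *ᵥ star (z - u n x)) := by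
        fun_prop
      exact (hc.tendsto (v x)).comp hx
    have haem : ∀ w : ℝ → Fin T → ℂ, AEStronglyMeasurable w freq →
        AEStronglyMeasurable (fun x => (quad F w x).re) freq := fun w hw =>
      (form_aesm hF.aesm hw hw).re
    have hle : ∫⁻ x, ENNReal.ofReal (quad F (v - u n) x).re ∂freq ≤
        ENNReal.ofReal (2 * Real.pi * ε) := by
      calc ∫⁻ x, ENNReal.ofReal (quad F (v - u n) x).re ∂freq
          = ∫⁻ x, liminf (fun m => ENNReal.ofReal (quad F (u m - u n) x).re) atTop ∂freq := by
            refine lintegral_congr_ae ?_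
            filter_upwards [hlim] with x hx
            exact hx.liminf_eq.symm
        _ ≤ liminf (fun m => ∫⁻ x, ENNReal.ofReal (quad F (u m - u n) x).re ∂freq) atTop :=
            lintegral_liminf_le' fun m =>
              (haem _ ((hu m).1.sub (hu n).1)).aemeasurable.ennreal_ofReal
        _ ≤ ENNReal.ofReal (2 * Real.pi * ε) := by
            refine liminf_le_of_frequently_le' (Eventually.frequently ?_)
            filter_upwards [eventually_ge_atTop n₀] with m hm
            rw [hq]
            have := h₀ m hm n hn
            gcongr
    have hnn : 0 ≤ᵐ[freq] fun x => (quad F (v - u n) x).re := by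
      filter_upwards [hF.posSemidef] with x hx
      exact quad_re_nonneg hx
    have hint : Integrable (fun x => (quad F (v - u n) x).re) freq :=
      (lintegral_ofReal_ne_top_iff_integrable (haem _ (hvm.sub (hu n).1)) hnn).1
        (hle.trans_lt ENNReal.ofReal_lt_top).ne
    refine ⟨memL2_of_quad_le hF (hvm.sub (hu n).1) hint (Eventually.of_forall fun x => le_rfl), ?_⟩
    rw [← ofReal_integral_eq_lintegral_ofReal hint hnn,
      ENNReal.ofReal_le_ofReal_iff (by positivity)] at hle
    unfold normSq
    rw [one_div, inv_mul_le_iff₀ (by positivity)]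
    exact hle
  refine ⟨?_, ?_⟩
  · obtain ⟨n₀, h₀⟩ := key 1 one_pos
    have := (h₀ n₀ le_rfl).1.add hF (hu n₀)
    rwa [sub_add_cancel] at this
  · rw [Metric.tendsto_atTop]
    intro ε hε
    obtain ⟨n₀, h₀⟩ := key (ε / 2) (half_pos hε)
    refine ⟨n₀, fun n hn => ?_⟩
    rw [Real.dist_0_eq_abs, abs_of_nonneg (normSq_nonneg hF)]
    linarith [(h₀ n hn).2]

/-- The semi-inner product in `L₂(f)` with `trigPoly p · f⁻¹` is an inner product in `ℓ²`. -/
theorem IsMinimalWeight.ip_mulInv_trigPoly_eq_inner (hf : IsMinimalWeight f)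
    {b : ℝ → Fin T → ℂ} (hb : MemL2 f b) {p : ℤ →₀ (Fin T → ℂ)} (hp : (p.support : Set ℤ) ⊆ G)
    {x y : l2 G T} (hx : ∀ k : G, x k = WithLp.toLp 2 (p k))
    (hy : ∀ (k : G) ν, y k ν = ip f b (mulInv f (unitExp k ν))) :
    ip f b (mulInv f (trigPoly p)) = inner ℂ x y := by
  rw [hf.ip_mulInv_trigPoly hb]
  symm
  rw [lp.inner_eq_tsum]
  have h1 : ∀ k : G, (inner ℂ (x k) (y k) : ℂ) =
      ∑ ν, conj (p k ν) * ip f b (mulInv f (unitExp k ν)) := by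
    intro k
    rw [PiLp.inner_apply]
    refine Finset.sum_congr rfl fun ν _ => ?_
    rw [RCLike.inner_apply, hx, hy, mul_comm]
  simp only [h1]
  rw [tsum_subtype G fun k : ℤ => ∑ ν, conj (p k ν) * ip f b (mulInv f (unitExp k ν)),
    tsum_eq_sum (s := p.support)]
  · exact Finset.sum_congr rfl fun k hk => Set.indicator_of_mem (hp hk) _
  · intro k hk
    rw [Set.indicator_apply_eq_zero]
    intro _
    simp [Finsupp.notMem_support_iff.1 hk]

/-- The properties of `r = C f⁻¹`, where `C = ∑ c(n) e^{inx}` and `c = B⁻¹ b`: it belongs to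
`L₂(f)`, its Fourier coefficients with indices in `G` are those of `b`, it is orthogonal to
`e^{ijx} δ_ν` for `j ∉ G`, and its norm is given by `⟨c, b⟩`. -/
theorem IsMinimalWeight.mulInv_Cfun (hf : IsMinimalWeight f) (hmat : IsMatrixOperator f G)
    (hB : BInvertible f G) (b : l2 G T) :
    MemL2 f (mulInv f (Cfun (Binv hB b))) ∧
    (∀ (k : G) ν, ip f (mulInv f (Cfun (Binv hB b))) (mulInv f (unitExp k ν)) = b k ν) ∧
    (∀ j ∉ G, ∀ ν, ip f (mulInv f (Cfun (Binv hB b))) (unitExp j ν) = 0) ∧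
    ((normSq f (mulInv f (Cfun (Binv hB b))) : ℝ) : ℂ) = inner ℂ b (Binv hB b) := by
  have hw := hf.toIsWeight
  obtain ⟨p, x, y, hp, hx, hy, hxlim, hylim⟩ := exists_seq_tendsto_Binv hf hmat hB b
  set c := Binv hB b with hc
  have hS : Tendsto (fun n => synthesis T G (x n)) atTop (𝓝 (synthesis T G c)) :=
    ((synthesis T G).continuous.tendsto c).comp hxlim
  obtain ⟨φ, hφ, hae⟩ := (tendstoInMeasure_of_tendsto_Lp hS).exists_seq_tendsto_ae
  have hae' : ∀ᵐ t ∂freq, Tendsto (fun n => trigPoly (p (φ n)) t) atTop (𝓝 (Cfun c t)) := by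
    filter_upwards [hae, ae_all_iff.2 fun n => synthesis_coeFn_of_finsupp (hp (φ n)) (hx (φ n))]
      with t h1 h2
    have h3 := ((PiLp.continuous_ofLp 2 fun _ : Fin T => ℂ).tendsto _).comp h1
    rw [Cfun_eq]
    refine h3.congr fun n => ?_
    simp only [Function.comp, h2 n]
  have hxlim' := hxlim.comp hφ.tendsto_atTop
  have hylim' := hylim.comp hφ.tendsto_atTop
  -- the squared distance of two approximants is `⟨x_n - x_m, y_n - y_m⟩`
  have hdist : ∀ n m, normSq (fun x => (f x)⁻¹) (trigPoly (p n) - trigPoly (p m)) =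
      (inner ℂ (x n - x m) (y n - y m) : ℂ).re := by
    intro n m
    have hmem := hf.memL2_mulInv_trigPoly (p n - p m)
    rw [← trigPoly_sub, ← normSq_mulInv hw hf.isUnit_det, ← ip_self_re hmem]
    refine congrArg Complex.re (hf.ip_mulInv_trigPoly_eq_inner hmem ?_ (fun k => ?_)
      fun k ν => ?_)
    · classical
      intro i hi
      rcases Finset.mem_union.1 (Finsupp.support_sub hi) with h | h
      exacts [hp n h, hp m h]
    · rw [lp.coeFn_sub, Pi.sub_apply, hx, hx]; rfl
    · rw [trigPoly_sub, mulInv_sub, ip_sub_left hw (hf.memL2_mulInv_trigPoly _)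
        (hf.memL2_mulInv_trigPoly _) (hf.memL2_mulInv_unitExp k ν), ← hy, ← hy]
      rfl
  have hcauchy : ∀ ε > 0, ∃ n₀, ∀ n ≥ n₀, ∀ m ≥ n₀,
      normSq (fun x => (f x)⁻¹) (trigPoly (p (φ n)) - trigPoly (p (φ m))) ≤ ε := by
    intro ε hε
    have hs : 0 < Real.sqrt ε := Real.sqrt_pos.2 hε
    obtain ⟨n₁, h₁⟩ := Metric.cauchySeq_iff.1 hxlim'.cauchySeq _ hs
    obtain ⟨n₂, h₂⟩ := Metric.cauchySeq_iff.1 hylim'.cauchySeq _ hs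
    refine ⟨max n₁ n₂, fun n hn m hm => ?_⟩
    have e1 := h₁ n (le_of_max_le_left hn) m (le_of_max_le_left hm)
    have e2 := h₂ n (le_of_max_le_right hn) m (le_of_max_le_right hm)
    rw [dist_eq_norm] at e1 e2
    rw [hdist]
    refine (Complex.re_le_norm _).trans ((norm_inner_le_norm _ _).trans ?_)
    calc _ ≤ Real.sqrt ε * Real.sqrt ε :=
          mul_le_mul e1.le e2.le (norm_nonneg _) hs.le
      _ = ε := Real.mul_self_sqrt hε.le
  obtain ⟨hC, hClim⟩ := memL2_and_tendsto_of_cauchy hf.inv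
    (fun n => hf.memL2_inv_trigPoly (p (φ n))) hae' hcauchy
  have hr : MemL2 f (mulInv f (Cfun c)) := hC.mulInv hw hf.isUnit_det
  have hrn := fun n => hf.memL2_mulInv_trigPoly (p (φ n))
  have hrlim : Tendsto (fun n => normSq f (mulInv f (Cfun c) - mulInv f (trigPoly (p (φ n)))))
      atTop (𝓝 0) := by
    refine hClim.congr fun n => ?_
    rw [← normSq_mulInv hw hf.isUnit_det, mulInv_sub]
  have hcoef : ∀ (k : G) ν, ip f (mulInv f (Cfun c)) (mulInv f (unitExp k ν)) = b k ν := by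
    intro k ν
    refine tendsto_nhds_unique
      (tendsto_ip_left hw hrn hr (hf.memL2_mulInv_unitExp k ν) hrlim) ?_
    simp only [← hy]
    exact ((continuous_l2_eval k ν).tendsto b).comp hylim'
  refine ⟨hr, hcoef, fun j hj ν => ?_, ?_⟩
  · rw [ip_mulInv_left hf.isUnit_det, integral_Cfun_dotProduct_star_unitExp,
      inner_expVec_synthesis_of_notMem c hj, mul_zero]
  · rw [← ip_self hw hr]
    refine tendsto_nhds_unique (tendsto_ip_left hw hrn hr hr hrlim) ?_
    have : ∀ n, ip f (mulInv f (trigPoly (p (φ n)))) (mulInv f (Cfun c)) =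
        inner ℂ b (x (φ n)) := by
      intro n
      rw [← ip_conj hw, hf.ip_mulInv_trigPoly_eq_inner hr (hp _) (hx _) fun k ν =>
        (hcoef k ν).symm, inner_conj_symm]
    simp only [this]
    exact tendsto_const_nhds.inner hxlim'

end Synthesis

/-! ### Density of trigonometric polynomials -/

/-- The scalar trigonometric polynomial `∑_j p(j) e^{ijx}`. -/
noncomputable def scalarTrig (p : ℤ →₀ ℂ) (x : ℝ) : ℂ := p.sum fun j z => z * expi j x

theorem continuous_scalarTrig (p : ℤ →₀ ℂ) : Continuous (scalarTrig p) := by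
  unfold scalarTrig Finsupp.sum
  exact continuous_finsetSum _ fun j _ => continuous_const.mul (continuous_expi j)

theorem eLpNorm_two_eq {X E : Type*} [MeasurableSpace X] {μ : Measure X} [NormedAddCommGroup E]
    {h : X → E} (hh : MemLp h 2 μ) :
    eLpNorm h 2 μ = ENNReal.ofReal (Real.sqrt (∫ x, ‖h x‖ ^ 2 ∂μ)) := by
  rw [hh.eLpNorm_eq_integral_rpow_norm two_ne_zero ENNReal.ofNat_ne_top, Real.sqrt_eq_rpow]
  norm_num

theorem norm_toLp_sq {X E : Type*} [MeasurableSpace X] {μ : Measure X} [NormedAddCommGroup E]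
    {h : X → E} (hh : MemLp h 2 μ) : ‖hh.toLp h‖ ^ 2 = ∫ x, ‖h x‖ ^ 2 ∂μ := by
  rw [Lp.norm_toLp, eLpNorm_two_eq hh, ENNReal.toReal_ofReal (Real.sqrt_nonneg _),
    Real.sq_sqrt (integral_nonneg fun x => by positivity)]

theorem integral_norm_sq_le_of_eLpNorm_le {E : Type*} [NormedAddCommGroup E] {h : ℝ → E}
    (hh : MemLp h 2 freq) {δ : ℝ} (hδ : 0 ≤ δ) (hle : eLpNorm h 2 freq ≤ ENNReal.ofReal δ) :
    ∫ x, ‖h x‖ ^ 2 ∂freq ≤ δ ^ 2 := by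
  rw [eLpNorm_two_eq hh, ENNReal.ofReal_le_ofReal_iff hδ, Real.sqrt_le_left hδ] at hle
  exact hle

instance factTwoPiPos : Fact (0 < 2 * Real.pi) := ⟨by positivity⟩

theorem measurePreserving_freq :
    MeasurePreserving (fun x : ℝ => (x : AddCircle (2 * Real.pi))) freq volume := by
  have := AddCircle.measurePreserving_mk (2 * Real.pi) (-Real.pi)
  rwa [show -Real.pi + 2 * Real.pi = Real.pi by ring] at this

theorem exists_continuousMap_eLpNorm_sub_le {g : ℝ → ℂ} (hg : MemLp g 2 freq) {δ : ℝ≥0∞}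
    (hδ : δ ≠ 0) :
    ∃ φ : C(AddCircle (2 * Real.pi), ℂ),
      eLpNorm (fun x => g x - φ (x : AddCircle (2 * Real.pi))) 2 freq ≤ δ := by
  have hpi : -Real.pi + 2 * Real.pi = Real.pi := by ring
  have h1 : MemLp (AddCircle.liftIoc (2 * Real.pi) (-Real.pi) g) 2 := by
    refine MemLp.memLp_liftIoc ?_
    rwa [hpi]
  obtain ⟨φ, hφ, hφm⟩ := h1.exists_boundedContinuous_eLpNorm_sub_le ENNReal.ofNat_ne_top hδ
  refine ⟨φ.toContinuousMap, le_of_eq_of_le ?_ hφ⟩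
  rw [← eLpNorm_comp_measurePreserving (h1.1.sub hφm.1) measurePreserving_freq]
  refine eLpNorm_congr_ae ?_
  filter_upwards [ae_restrict_mem measurableSet_Ioc] with x hx
  rw [Function.comp, Pi.sub_apply, AddCircle.liftIoc_coe_apply (by rwa [hpi])]
  rfl

theorem fourier_eq_expi (n : ℤ) (x : ℝ) :
    fourier n (x : AddCircle (2 * Real.pi)) = expi n x := by
  rw [fourier_coe_apply, expi]
  congr 1
  have : (Real.pi : ℂ) ≠ 0 := by exact_mod_cast Real.pi_ne_zero
  push_cast
  field_simp

theorem exists_scalarTrig_norm_sub_le (φ : C(AddCircle (2 * Real.pi), ℂ)) {δ : ℝ} (hδ : 0 < δ) :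
    ∃ p : ℤ →₀ ℂ, ∀ x : ℝ, ‖φ (x : AddCircle (2 * Real.pi)) - scalarTrig p x‖ ≤ δ := by
  have h : φ ∈ closure (Submodule.span ℂ (Set.range (fourier (T := 2 * Real.pi))) :
      Set C(AddCircle (2 * Real.pi), ℂ)) := by
    rw [← Submodule.topologicalClosure_coe, span_fourier_closure_eq_top]; trivial
  obtain ⟨q, hq, hd⟩ := Metric.mem_closure_iff.1 h δ hδ
  obtain ⟨p, rfl⟩ := Finsupp.mem_span_range_iff_exists_finsupp.1 hq
  refine ⟨p, fun x => ?_⟩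
  have h1 := ContinuousMap.norm_coe_le_norm (φ - p.sum fun j z => z • fourier j)
    (x : AddCircle (2 * Real.pi))
  rw [dist_eq_norm] at hd
  refine le_trans (le_of_eq ?_) (h1.trans hd.le)
  rw [ContinuousMap.sub_apply, Finsupp.sum, ContinuousMap.sum_apply]
  simp [scalarTrig, Finsupp.sum, ← fourier_eq_expi]

theorem memLp_of_continuous_norm_le {E : Type*} [NormedAddCommGroup E]
    [SecondCountableTopology E] {u : ℝ → E} (hu : Continuous u) {K : ℝ}
    (hK : ∀ x, ‖u x‖ ≤ K) : MemLp u 2 freq :=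
  MemLp.of_bound hu.aestronglyMeasurable K (Eventually.of_forall hK)

theorem norm_scalarTrig_le (p : ℤ →₀ ℂ) (x : ℝ) : ‖scalarTrig p x‖ ≤ ∑ j ∈ p.support, ‖p j‖ := by
  refine (norm_sum_le _ _).trans (Finset.sum_le_sum fun j _ => ?_)
  rw [norm_mul, norm_expi, mul_one]

theorem memLp_scalarTrig (p : ℤ →₀ ℂ) : MemLp (scalarTrig p) 2 freq :=
  memLp_of_continuous_norm_le (continuous_scalarTrig p) (norm_scalarTrig_le p)

/-- The constant `4` bounds `√(2π)`, the `L²` norm of the function `1`. -/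
theorem eLpNorm_const_freq_le {δ : ℝ} (hδ : 0 ≤ δ) :
    eLpNorm (fun _ : ℝ => δ) 2 freq ≤ ENNReal.ofReal (4 * δ) := by
  have hm : MemLp (fun _ : ℝ => δ) 2 freq := memLp_const δ
  rw [eLpNorm_two_eq hm]
  refine ENNReal.ofReal_le_ofReal ?_
  rw [Real.sqrt_le_left (by positivity)]
  have hv : (freq).real Set.univ = 2 * Real.pi := by
    rw [measureReal_restrict_apply MeasurableSet.univ, Set.univ_inter, Real.volume_real_Ioc_of_le
      (by linarith [Real.pi_pos])]
    ring
  rw [integral_const, hv, smul_eq_mul, Real.norm_of_nonneg hδ]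
  nlinarith [Real.pi_le_four, sq_nonneg δ, mul_nonneg (sub_nonneg.2 Real.pi_le_four) (sq_nonneg δ)]

/-- Trigonometric polynomials are dense in `L²(-π, π)`. -/
theorem exists_scalarTrig_integral_le {g : ℝ → ℂ} (hg : MemLp g 2 freq) {ε : ℝ} (hε : 0 < ε) :
    ∃ p : ℤ →₀ ℂ, ∫ x, ‖g x - scalarTrig p x‖ ^ 2 ∂freq ≤ ε := by
  have hs : 0 < Real.sqrt ε := Real.sqrt_pos.2 hε
  obtain ⟨φ, hφ⟩ := exists_continuousMap_eLpNorm_sub_le hg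
    (δ := ENNReal.ofReal (Real.sqrt ε / 2)) (by simpa using hs)
  obtain ⟨p, hp⟩ := exists_scalarTrig_norm_sub_le φ (δ := Real.sqrt ε / 8) (by positivity)
  refine ⟨p, ?_⟩
  rw [← Real.sq_sqrt hε.le]
  have hφc : Continuous fun x : ℝ => φ (x : AddCircle (2 * Real.pi)) :=
    φ.continuous.comp (AddCircle.continuous_mk' _)
  refine integral_norm_sq_le_of_eLpNorm_le (hg.sub (memLp_scalarTrig p)) hs.le ?_
  have h2 : eLpNorm (fun x : ℝ => φ (x : AddCircle (2 * Real.pi)) - scalarTrig p x) 2 freq ≤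
      ENNReal.ofReal (4 * (Real.sqrt ε / 8)) := by
    refine (eLpNorm_mono_real hp).trans (eLpNorm_const_freq_le (by positivity))
  have h3 := eLpNorm_add_le (p := 2) (μ := freq)
    (hg.1.sub hφc.aestronglyMeasurable)
    (hφc.aestronglyMeasurable.sub (continuous_scalarTrig p).aestronglyMeasurable) (by norm_num)
  have e : (g - fun x : ℝ => φ (x : AddCircle (2 * Real.pi))) +
      ((fun x : ℝ => φ (x : AddCircle (2 * Real.pi))) - scalarTrig p) =
      fun x => g x - scalarTrig p x := by
    funext x; simp
  rw [e] at h3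
  refine h3.trans ((add_le_add hφ h2).trans (le_of_eq ?_))
  rw [← ENNReal.ofReal_add (by positivity) (by positivity)]
  congr 1; ring

/-! ### Analytic multipliers -/

/-- The value `P(e^{-ix})`. -/
noncomputable def polyExp (P : Polynomial ℂ) (x : ℝ) : ℂ := P.eval (expi (-1) x)

theorem expi_neg_natCast (k : ℕ) (x : ℝ) : expi (-(k : ℤ)) x = expi (-1) x ^ k := by
  induction k with
  | zero => simp [expi_zero]
  | succ k ih =>
    rw [pow_succ, ← ih, ← expi_add]
    congr 1
    push_cast; ring

theorem continuous_polyExp (P : Polynomial ℂ) : Continuous (polyExp P) :=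
  P.continuous.comp (continuous_expi (-1))

theorem polyExp_eq_sum (P : Polynomial ℂ) (x : ℝ) :
    polyExp P x = ∑ k ∈ P.support, P.coeff k * expi (-(k : ℤ)) x := by
  simp only [polyExp, Polynomial.eval_eq_sum, Polynomial.sum, expi_neg_natCast]

theorem norm_polyExp_le (P : Polynomial ℂ) (x : ℝ) :
    ‖polyExp P x‖ ≤ ∑ k ∈ P.support, ‖P.coeff k‖ := by
  rw [polyExp_eq_sum]
  refine (norm_sum_le _ _).trans (Finset.sum_le_sum fun k _ => ?_)
  rw [norm_mul, norm_expi, mul_one]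

theorem integral_polyExp (P : Polynomial ℂ) :
    ∫ x, polyExp P x ∂freq = 2 * Real.pi * P.coeff 0 := by
  simp only [polyExp_eq_sum]
  rw [integral_finsetSum _ fun k _ => (integrable_expi _).const_mul _]
  simp only [integral_const_mul, integral_expi, neg_eq_zero, Nat.cast_eq_zero, mul_ite, mul_zero,
    Finset.sum_ite_eq']
  split_ifs with h
  · ring
  · simp [Polynomial.notMem_support_iff.1 h]

/-- If `P(0)` is real, the imaginary part of `P` on the circle is dominated in `L²` by the real
part, because the mean value of `P²` is `P(0)² ≥ 0`. -/
theorem integral_norm_polyExp_sq_le {P : Polynomial ℂ} (hP : (P.coeff 0).im = 0) :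
    ∫ x, ‖polyExp P x‖ ^ 2 ∂freq ≤ 2 * ∫ x, (polyExp P x).re ^ 2 ∂freq := by
  have hb := norm_polyExp_le P
  set K := ∑ k ∈ P.support, ‖P.coeff k‖ with hK
  have hc := continuous_polyExp P
  have hre : Integrable (fun x => (polyExp P x).re ^ 2) freq := by
    refine integrable_of_continuous_norm_le (by fun_prop) (K := K ^ 2) fun x => ?_
    rw [norm_pow]
    gcongr
    exact (Complex.abs_re_le_norm _).trans (hb x)
  have him : Integrable (fun x => (polyExp P x).im ^ 2) freq := by
    refine integrable_of_continuous_norm_le (by fun_prop) (K := K ^ 2) fun x => ?_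
    rw [norm_pow]
    gcongr
    exact (Complex.abs_im_le_norm _).trans (hb x)
  have hsq : Integrable (polyExp (P * P)) freq :=
    integrable_of_continuous_norm_le (continuous_polyExp _) (norm_polyExp_le _)
  have h1 : ∫ x, ((polyExp P x).re ^ 2 - (polyExp P x).im ^ 2) ∂freq =
      2 * Real.pi * (P.coeff 0).re ^ 2 := by
    have h2 : ∀ x, (polyExp P x).re ^ 2 - (polyExp P x).im ^ 2 = (polyExp (P * P) x).re := by
      intro x
      simp only [polyExp, Polynomial.eval_mul, Complex.mul_re]; ring
    simp only [h2]
    have h3 := integral_re hsq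
    simp only [RCLike.re_to_complex] at h3
    rw [h3, integral_polyExp, Polynomial.mul_coeff_zero]
    have : (2 * Real.pi * (P.coeff 0 * P.coeff 0) : ℂ) =
        ((2 * Real.pi : ℝ) : ℂ) * (P.coeff 0 * P.coeff 0) := by push_cast; ring
    rw [this, Complex.re_ofReal_mul, Complex.mul_re, hP]; ring
  rw [integral_sub hre him] at h1
  have h4 : ∀ x, ‖polyExp P x‖ ^ 2 = (polyExp P x).re ^ 2 + (polyExp P x).im ^ 2 := by
    intro x
    rw [← Complex.normSq_eq_norm_sq, Complex.normSq_apply]; ring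
  simp only [h4]
  rw [integral_add hre him]
  have : 0 ≤ 2 * Real.pi * (P.coeff 0).re ^ 2 := by positivity
  linarith

/-- The real part of a trigonometric polynomial is the real part of a polynomial in `e^{-ix}`. -/
theorem exists_polyExp_re_eq (p : ℤ →₀ ℂ) :
    ∃ P : Polynomial ℂ, (P.coeff 0).im = 0 ∧ ∀ x, (polyExp P x).re = (scalarTrig p x).re := by
  let Q : ℤ → ℂ → Polynomial ℂ := fun j z =>
    if j = 0 then Polynomial.C (z.re : ℂ) else
    if 0 < j then Polynomial.monomial j.toNat (conj z) else Polynomial.monomial (-j).toNat z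
  refine ⟨∑ j ∈ p.support, Q j (p j), ?_, fun x => ?_⟩
  · rw [Polynomial.finsetSum_coeff, Complex.im_sum]
    refine Finset.sum_eq_zero fun j _ => ?_
    simp only [Q]
    split_ifs with h1 h2
    · simp
    · rw [Polynomial.coeff_monomial, if_neg (by omega)]; simp
    · rw [Polynomial.coeff_monomial, if_neg (by omega)]; simp
  · simp only [polyExp, Polynomial.eval_finsetSum, scalarTrig, Finsupp.sum, Complex.re_sum]
    refine Finset.sum_congr rfl fun j _ => ?_
    simp only [Q]
    split_ifs with h1 h2
    · subst h1; simp [expi_zero]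
    · rw [Polynomial.eval_monomial, ← expi_neg_natCast, Int.toNat_of_nonneg h2.le, ← conj_expi,
        ← map_mul, Complex.conj_re]
    · rw [Polynomial.eval_monomial, ← expi_neg_natCast, Int.toNat_of_nonneg (by omega), neg_neg]

theorem exists_polyExp_re_approx {g : ℝ → ℝ} (hg : MemLp g 2 freq) (hg0 : ∀ x, 0 ≤ g x) {ε : ℝ}
    (hε : 0 < ε) :
    ∃ P : Polynomial ℂ, (P.coeff 0).im = 0 ∧ (∀ x, 0 ≤ (polyExp P x).re) ∧
      ∫ x, ((polyExp P x).re - g x) ^ 2 ∂freq ≤ ε := by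
  have hs : 0 < Real.sqrt ε := Real.sqrt_pos.2 hε
  obtain ⟨φ, hφ⟩ := exists_continuousMap_eLpNorm_sub_le (g := fun x => (g x : ℂ)) hg.ofReal
    (δ := ENNReal.ofReal (Real.sqrt ε / 2)) (by simpa using hs)
  set δ := Real.sqrt ε / 16 with hδ
  have hδ0 : 0 < δ := by positivity
  -- the shift by `δ` keeps the real part of the approximating polynomial nonnegative
  let ψ : C(AddCircle (2 * Real.pi), ℂ) :=
    ⟨fun t => ((max (φ t).re 0 + δ : ℝ) : ℂ), by fun_prop⟩
  obtain ⟨p, hp⟩ := exists_scalarTrig_norm_sub_le ψ hδ0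
  obtain ⟨P, hP0, hP⟩ := exists_polyExp_re_eq p
  have hψ : ∀ x : ℝ, |max (φ (x : AddCircle (2 * Real.pi))).re 0 + δ - (polyExp P x).re| ≤ δ := by
    intro x
    rw [hP]
    have := (Complex.abs_re_le_norm _).trans (hp x)
    simpa [ψ] using this
  have hφc : Continuous fun x : ℝ => φ (x : AddCircle (2 * Real.pi)) :=
    φ.continuous.comp (AddCircle.continuous_mk' _)
  refine ⟨P, hP0, fun x => ?_, ?_⟩
  · have h1 := (abs_le.1 (hψ x)).2
    have h2 : 0 ≤ max (φ (x : AddCircle (2 * Real.pi))).re 0 := le_max_right _ _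
    linarith
  · have hPm : MemLp (fun x => (polyExp P x).re) 2 freq :=
      memLp_of_continuous_norm_le (Complex.continuous_re.comp (continuous_polyExp P))
        fun x => (Complex.abs_re_le_norm _).trans (norm_polyExp_le P x)
    have hm : MemLp (fun x => (polyExp P x).re - g x) 2 freq := hPm.sub hg
    have hle : ∀ x, ‖(polyExp P x).re - g x‖ ≤
        ‖g x - φ (x : AddCircle (2 * Real.pi))‖ + 2 * δ := by
      intro x
      have h1 := abs_le.1 (hψ x)
      have h2 : |max (φ (x : AddCircle (2 * Real.pi))).re 0 - g x| ≤
          ‖g x - φ (x : AddCircle (2 * Real.pi))‖ := by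
        have h3 : |g x - (φ (x : AddCircle (2 * Real.pi))).re| ≤
            ‖(g x : ℂ) - φ (x : AddCircle (2 * Real.pi))‖ := by
          simpa using Complex.abs_re_le_norm ((g x : ℂ) - φ (x : AddCircle (2 * Real.pi)))
        refine le_trans ?_ h3
        have h4 := abs_max_sub_max_le_abs (φ (x : AddCircle (2 * Real.pi))).re (g x) 0
        rw [max_eq_left (hg0 x)] at h4
        rwa [abs_sub_comm (g x)]
      rw [Real.norm_eq_abs]
      have h5 := abs_le.1 h2
      rw [abs_le]
      constructor <;> linarith
    have h6 : eLpNorm (fun x => (polyExp P x).re - g x) 2 freq ≤ ENNReal.ofReal (Real.sqrt ε) := by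
      refine (eLpNorm_mono_real hle).trans ?_
      have h7 := eLpNorm_add_le (p := 2) (μ := freq)
        (f := fun x => ‖(g x : ℂ) - φ (x : AddCircle (2 * Real.pi))‖) (g := fun _ => 2 * δ)
        (hg.ofReal.1.sub hφc.aestronglyMeasurable).norm aestronglyMeasurable_const (by norm_num)
      refine h7.trans ?_
      have h8 := eLpNorm_const_freq_le (δ := 2 * δ) (by positivity)
      rw [eLpNorm_norm]
      refine (add_le_add hφ h8).trans (le_of_eq ?_)
      rw [← ENNReal.ofReal_add (by positivity) (by positivity)]
      congr 1
      rw [hδ]; ring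
    have h9 := integral_norm_sq_le_of_eLpNorm_le hm hs.le h6
    rw [Real.sq_sqrt hε.le] at h9
    simpa using h9

theorem memLp_polyExp (P : Polynomial ℂ) : MemLp (polyExp P) 2 freq :=
  memLp_of_continuous_norm_le (continuous_polyExp P) (norm_polyExp_le P)

theorem memLp_polyExp_re (P : Polynomial ℂ) : MemLp (fun x => (polyExp P x).re) 2 freq :=
  memLp_of_continuous_norm_le (Complex.continuous_re.comp (continuous_polyExp P))
    fun x => (Complex.abs_re_le_norm _).trans (norm_polyExp_le P x)

theorem polyExp_sub (P Q : Polynomial ℂ) (x : ℝ) :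
    polyExp (P - Q) x = polyExp P x - polyExp Q x := by simp [polyExp]

/-- A nonnegative `g ∈ L²` is the real part of a function `H` that is the almost everywhere limit
of polynomials in `e^{-ix}` with nonnegative real parts. -/
theorem exists_analytic_completion {g : ℝ → ℝ} (hg : MemLp g 2 freq) (hg0 : ∀ x, 0 ≤ g x) :
    ∃ (H : ℝ → ℂ) (P : ℕ → Polynomial ℂ), (∀ᵐ x ∂freq, (H x).re = g x) ∧
      (∀ n x, 0 ≤ (polyExp (P n) x).re) ∧
      ∀ᵐ x ∂freq, Tendsto (fun n => polyExp (P n) x) atTop (𝓝 (H x)) := by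
  choose P hP0 hPre hPg using fun n : ℕ =>
    exists_polyExp_re_approx hg hg0 (ε := (1 / ((n : ℝ) + 1)) ^ 2) (by positivity)
  have hre : ∀ n, ‖(memLp_polyExp_re (P n)).toLp _ - hg.toLp g‖ ≤ 1 / ((n : ℝ) + 1) := by
    intro n
    rw [← MemLp.toLp_sub, ← Real.sqrt_sq (norm_nonneg _), Real.sqrt_le_left (by positivity),
      norm_toLp_sq]
    simpa using hPg n
  have hrelim : Tendsto (fun n => (memLp_polyExp_re (P n)).toLp _) atTop (𝓝 (hg.toLp g)) := by
    rw [tendsto_iff_norm_sub_tendsto_zero]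
    exact squeeze_zero (fun n => norm_nonneg _) hre tendsto_one_div_add_atTop_nhds_zero_nat
  have hdist : ∀ n m, ‖(memLp_polyExp (P n)).toLp _ - (memLp_polyExp (P m)).toLp _‖ ≤
      2 * ‖(memLp_polyExp_re (P n)).toLp _ - (memLp_polyExp_re (P m)).toLp _‖ := by
    intro n m
    rw [← abs_of_nonneg (norm_nonneg ((memLp_polyExp (P n)).toLp _ - _)),
      ← abs_of_nonneg (by positivity : 0 ≤ 2 * ‖(memLp_polyExp_re (P n)).toLp _ - _‖), ← sq_le_sq,
      mul_pow, ← MemLp.toLp_sub, ← MemLp.toLp_sub, norm_toLp_sq, norm_toLp_sq]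
    have h := integral_norm_polyExp_sq_le (P := P n - P m) (by simp [hP0])
    have h0 : 0 ≤ ∫ x, (polyExp (P n - P m) x).re ^ 2 ∂freq :=
      integral_nonneg fun x => sq_nonneg _
    simp only [polyExp_sub, Complex.sub_re] at h h0
    simp only [Pi.sub_apply, Real.norm_eq_abs, sq_abs]
    linarith
  have hcau : CauchySeq fun n => (memLp_polyExp (P n)).toLp _ := by
    rw [Metric.cauchySeq_iff]
    intro ε hε
    obtain ⟨n₀, h₀⟩ := Metric.cauchySeq_iff.1 hrelim.cauchySeq (ε / 2) (half_pos hε)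
    refine ⟨n₀, fun n hn m hm => ?_⟩
    have := h₀ n hn m hm
    rw [dist_eq_norm] at this ⊢
    linarith [hdist n m]
  obtain ⟨H, hH⟩ := cauchySeq_tendsto_of_complete hcau
  obtain ⟨φ, hφ, hφae⟩ := (tendstoInMeasure_of_tendsto_Lp hH).exists_seq_tendsto_ae
  obtain ⟨χ, hχ, hχae⟩ := (tendstoInMeasure_of_tendsto_Lp
    (hrelim.comp hφ.tendsto_atTop)).exists_seq_tendsto_ae
  have hlim : ∀ᵐ x ∂freq, Tendsto (fun n => polyExp (P (φ (χ n))) x) atTop (𝓝 (H x)) := by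
    filter_upwards [hφae, ae_all_iff.2 fun n => (memLp_polyExp (P n)).coeFn_toLp] with x h1 h2
    refine (h1.comp hχ.tendsto_atTop).congr fun n => ?_
    exact h2 _
  refine ⟨H, fun n => P (φ (χ n)), ?_, fun n x => hPre _ x, hlim⟩
  filter_upwards [hlim, hχae, hg.coeFn_toLp,
    ae_all_iff.2 fun n => (memLp_polyExp_re (P n)).coeFn_toLp] with x h1 h2 h3 h4
  refine tendsto_nhds_unique ((Complex.continuous_re.tendsto _).comp h1) ?_
  rw [← h3]
  refine h2.congr fun n => ?_
  exact h4 _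

/-- If `Re P ≥ 0` on the circle, then `1 / (1 + P)` is a uniform limit of polynomials: for
`s` large `|s - 1 - P| < s` on the circle, and the Neumann series in `(s - 1 - P) / s` converges. -/
theorem exists_polyExp_inv_approx {P : Polynomial ℂ} (hP : ∀ x, 0 ≤ (polyExp P x).re) {ε : ℝ}
    (hε : 0 < ε) : ∃ Q : Polynomial ℂ, ∀ x, ‖polyExp Q x - (1 + polyExp P x)⁻¹‖ ≤ ε := by
  set R := 1 + ∑ k ∈ P.support, ‖P.coeff k‖ with hR
  have hR1 : 1 ≤ R := by
    have : 0 ≤ ∑ k ∈ P.support, ‖P.coeff k‖ := Finset.sum_nonneg fun k _ => norm_nonneg _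
    linarith
  set s := R ^ 2 with hs
  have hs1 : 1 ≤ s := one_le_pow₀ hR1
  have hs0 : (s : ℂ) ≠ 0 := by rw [Complex.ofReal_ne_zero]; positivity
  set ρ := Real.sqrt (1 - 1 / s) with hρ
  have hρ1 : ρ < 1 := by
    rw [hρ, Real.sqrt_lt' one_pos]
    have : 0 < 1 / s := by positivity
    linarith
  obtain ⟨n, hn⟩ := exists_pow_lt_of_lt_one hε hρ1
  let t : Polynomial ℂ := Polynomial.C (s : ℂ)⁻¹ * (Polynomial.C ((s : ℂ) - 1) - P)
  refine ⟨Polynomial.C (s : ℂ)⁻¹ * ∑ k ∈ Finset.range n, t ^ k, fun x => ?_⟩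
  set z := polyExp P x with hz
  have hz1 : 1 ≤ ‖1 + z‖ := by
    refine le_trans ?_ (Complex.re_le_norm _)
    simpa using hP x
  have hz0 : 1 + z ≠ 0 := norm_pos_iff.1 (by linarith)
  have hzR : ‖1 + z‖ ≤ R := by
    refine (norm_add_le _ _).trans ?_
    rw [norm_one]
    exact add_le_add le_rfl (norm_polyExp_le P x)
  set τ : ℂ := (s : ℂ)⁻¹ * ((s : ℂ) - 1 - z) with hτ
  have hte : t.eval (expi (-1) x) = τ := by simp [t, hτ, hz, polyExp]
  have hτ1 : 1 - τ = (s : ℂ)⁻¹ * (1 + z) := by rw [hτ]; field_simp; ring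
  have hτne : τ ≠ 1 := by
    intro h
    have h0 : (s : ℂ)⁻¹ * (1 + z) = 0 := by rw [← hτ1, h, sub_self]
    exact (mul_ne_zero (inv_ne_zero hs0) hz0) h0
  have hτρ : ‖τ‖ ≤ ρ := by
    rw [hρ]
    refine Real.le_sqrt_of_sq_le ?_
    have h1 : ‖(s : ℂ) - 1 - z‖ ^ 2 ≤ s ^ 2 - s := by
      have e : (s : ℂ) - 1 - z = (s : ℂ) - (1 + z) := by ring
      have h2 : ‖1 + z‖ ^ 2 ≤ s := by rw [hs]; gcongr
      have h3 : 1 ≤ (1 + z).re := by simpa using hP x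
      rw [← Complex.normSq_eq_norm_sq, Complex.normSq_apply] at h2 ⊢
      rw [e, Complex.sub_re, Complex.sub_im, Complex.ofReal_re, Complex.ofReal_im]
      nlinarith
    rw [hτ, norm_mul, mul_pow, norm_inv, Complex.norm_real, Real.norm_of_nonneg (by linarith)]
    have : (1 - 1 / s) = s⁻¹ ^ 2 * (s ^ 2 - s) := by field_simp
    rw [this]
    gcongr
  have hval : polyExp (Polynomial.C (s : ℂ)⁻¹ * ∑ k ∈ Finset.range n, t ^ k) x - (1 + z)⁻¹ =
      -(τ ^ n * (1 + z)⁻¹) := by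
    rw [polyExp, Polynomial.eval_mul, Polynomial.eval_C, Polynomial.eval_finsetSum]
    simp only [Polynomial.eval_pow, hte]
    rw [geom_sum_eq hτne, ← neg_sub 1 τ, hτ1]
    field_simp
    ring
  rw [hval, norm_neg, norm_mul, norm_pow, norm_inv]
  calc ‖τ‖ ^ n * ‖1 + z‖⁻¹ ≤ ρ ^ n * 1 := by
        gcongr
        exact inv_le_one_of_one_le₀ hz1
    _ ≤ ε := by rw [mul_one]; exact hn.le

theorem norm_one_add_inv_le {z : ℂ} (hz : 0 ≤ z.re) : ‖(1 + z)⁻¹‖ ≤ (1 + z.re)⁻¹ := by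
  rw [norm_inv]
  refine inv_anti₀ (by linarith) ?_
  simpa using Complex.re_le_norm (1 + z)

/-- Multipliers `u_n` that tame a given nonnegative `g ∈ L²`, tend to `1`, and are bounded limits
of polynomials in `e^{-ix}`. With `H` the analytic completion of `g` they are
`u_n = 1 / (1 + H / (n + 1))`. -/
theorem exists_multipliers {g : ℝ → ℝ} (hg : MemLp g 2 freq) (hg0 : ∀ x, 0 ≤ g x) :
    ∃ (u : ℕ → ℝ → ℂ) (Q : ℕ → ℕ → Polynomial ℂ),
      (∀ n, AEStronglyMeasurable (u n) freq) ∧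
      (∀ n, ∀ᵐ x ∂freq, ‖u n x‖ ≤ 1) ∧
      (∀ n, ∀ᵐ x ∂freq, ‖u n x‖ * g x ≤ n + 1) ∧
      (∀ᵐ x ∂freq, Tendsto (fun n => u n x) atTop (𝓝 1)) ∧
      (∀ n m x, ‖polyExp (Q n m) x‖ ≤ 2) ∧
      ∀ n, ∀ᵐ x ∂freq, Tendsto (fun m => polyExp (Q n m) x) atTop (𝓝 (u n x)) := by
  obtain ⟨H, P, hHre, hPre, hPH⟩ := exists_analytic_completion hg hg0
  let r : ℕ → ℝ := fun n => 1 / ((n : ℝ) + 1)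
  have hr : ∀ n, 0 < r n := fun n => by positivity
  have hpoly : ∀ n m x, polyExp (Polynomial.C (r n : ℂ) * P m) x = r n * polyExp (P m) x := by
    intro n m x; simp [polyExp]
  have hpre : ∀ n m x, 0 ≤ (polyExp (Polynomial.C (r n : ℂ) * P m) x).re := by
    intro n m x
    rw [hpoly, Complex.re_ofReal_mul]
    exact mul_nonneg (hr n).le (hPre m x)
  choose Q hQ using fun n m => exists_polyExp_inv_approx (hpre n m) (hr m)
  have hlim : ∀ n, ∀ᵐ x ∂freq,
      Tendsto (fun m => polyExp (Q n m) x) atTop (𝓝 (1 + r n * H x)⁻¹) := by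
    intro n
    filter_upwards [hPH, hHre] with x hx hre
    have h1 : Tendsto (fun m => (1 + (r n : ℂ) * polyExp (P m) x)⁻¹) atTop
        (𝓝 (1 + r n * H x)⁻¹) := by
      refine ((hx.const_mul (r n : ℂ)).const_add 1).inv₀ fun h => ?_
      have h2 := congrArg Complex.re h
      rw [Complex.add_re, Complex.re_ofReal_mul, hre, Complex.one_re, Complex.zero_re] at h2
      have := mul_nonneg (hr n).le (hg0 x)
      linarith
    have h2 : Tendsto (fun m => polyExp (Q n m) x - (1 + (r n : ℂ) * polyExp (P m) x)⁻¹) atTop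
        (𝓝 0) := by
      refine squeeze_zero_norm (fun m => ?_) tendsto_one_div_add_atTop_nhds_zero_nat
      rw [← hpoly]; exact hQ n m x
    simpa using h2.add h1
  have hbd : ∀ n, ∀ᵐ x ∂freq, ‖(1 + r n * H x)⁻¹‖ ≤ (1 + r n * g x)⁻¹ := by
    intro n
    filter_upwards [hHre] with x hx
    have := norm_one_add_inv_le (z := r n * H x) (by
      rw [Complex.re_ofReal_mul, hx]; exact mul_nonneg (hr n).le (hg0 x))
    rwa [Complex.re_ofReal_mul, hx] at this
  refine ⟨fun n x => (1 + r n * H x)⁻¹, Q, fun n => ?_, fun n => ?_, fun n => ?_, ?_,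
    fun n m x => ?_, hlim⟩
  · exact aestronglyMeasurable_of_tendsto_ae _
      (fun m => (continuous_polyExp (Q n m)).aestronglyMeasurable) (hlim n)
  · filter_upwards [hbd n] with x hx
    have := mul_nonneg (hr n).le (hg0 x)
    exact hx.trans (inv_le_one_of_one_le₀ (by linarith))
  · filter_upwards [hbd n] with x hx
    have h0 := mul_nonneg (hr n).le (hg0 x)
    calc ‖(1 + r n * H x)⁻¹‖ * g x ≤ (1 + r n * g x)⁻¹ * g x :=
          mul_le_mul_of_nonneg_right hx (hg0 x)
      _ ≤ n + 1 := by
          rw [inv_mul_le_iff₀ (by linarith)]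
          have e : r n * ((n : ℝ) + 1) = 1 := by simp only [r]; field_simp
          have e2 : (1 + r n * g x) * ((n : ℝ) + 1) = n + 1 + g x := by
            linear_combination g x * e
          have hn : (0 : ℝ) ≤ n := n.cast_nonneg
          linarith
  · refine Eventually.of_forall fun x => ?_
    have h1 : Tendsto (fun n => (r n : ℂ)) atTop (𝓝 ((0 : ℝ) : ℂ)) :=
      (Complex.continuous_ofReal.tendsto _).comp tendsto_one_div_add_atTop_nhds_zero_nat
    have h2 := ((h1.mul_const (H x)).const_add 1).inv₀ (by simp)
    simpa using h2
  · have h1 := hQ n m x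
    have h2 := norm_one_add_inv_le (hpre n m x)
    have h3 : (1 + (polyExp (Polynomial.C (r n : ℂ) * P m) x).re)⁻¹ ≤ 1 :=
      inv_le_one_of_one_le₀ (by linarith [hpre n m x])
    have h4 : r m ≤ 1 := by
      simp only [r]
      rw [div_le_one (by positivity)]
      linarith [(m.cast_nonneg : (0 : ℝ) ≤ m)]
    calc ‖polyExp (Q n m) x‖ = ‖(polyExp (Q n m) x - (1 + polyExp (Polynomial.C (r n : ℂ) * P m) x)⁻¹)
          + (1 + polyExp (Polynomial.C (r n : ℂ) * P m) x)⁻¹‖ := by rw [sub_add_cancel]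
      _ ≤ 1 + 1 := (norm_add_le _ _).trans (add_le_add (h1.trans h4) (h2.trans h3))
      _ = 2 := by norm_num

/-! ### Closed spans of exponentials in `L₂(f)` -/

section Spectrum

variable {T : ℕ} {f : ℝ → Matrix (Fin T) (Fin T) ℂ} {b h : ℝ → Fin T → ℂ}

theorem MemSpan.of_approx {E : Set ℤ} (hf : IsMinimalWeight f) (hb : MemL2 f b)
    (happ : ∀ ε > 0, ∃ b', MemSpan f E b' ∧ normSq f (b - b') < ε) : MemSpan f E b := by
  refine ⟨hb, fun ε hε => ?_⟩
  obtain ⟨b', hb', h1⟩ := happ (ε / 4) (by positivity)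
  obtain ⟨p, hp, h2⟩ := hb'.2 (ε / 4) (by positivity)
  refine ⟨p, hp, ?_⟩
  have := normSq_sub_le hf.toIsWeight hb hb'.1 (hf.memL2_trigPoly p)
  linarith

theorem normSq_smul (r : ℂ) : normSq f (r • b) = ‖r‖ ^ 2 * normSq f b := by
  have : ∀ x, (quad f (r • b) x).re = ‖r‖ ^ 2 * (quad f b x).re := by
    intro x
    have h := quad_smul (f := f) (b := b) (fun _ => r) x
    rw [← Complex.re_ofReal_mul, ← h]; rfl
  simp only [normSq, this, integral_const_mul]
  ring

theorem tendsto_normSq_sum {ι : Type*} (hf : IsWeight f) (s : Finset ι)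
    {u : ι → ℕ → ℝ → Fin T → ℂ} (hu : ∀ i n, MemL2 f (u i n))
    (h : ∀ i ∈ s, Tendsto (fun n => normSq f (u i n)) atTop (𝓝 0)) :
    Tendsto (fun n => normSq f (∑ i ∈ s, u i n)) atTop (𝓝 0) := by
  classical
  induction s using Finset.induction_on with
  | empty => simp [normSq, quad]
  | insert i s hi ih =>
    have h1 := (((h i (Finset.mem_insert_self i s)).const_mul 2).add
      ((ih fun j hj => h j (Finset.mem_insert_of_mem hj)).const_mul 2))
    simp only [mul_zero, add_zero] at h1
    refine squeeze_zero (fun n => normSq_nonneg hf) (fun n => ?_) h1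
    rw [Finset.sum_insert hi]
    exact normSq_add_le hf (hu i n) (memL2_sum hf s fun j => hu j n)

/-- Multiplication by bounded functions that tend to zero. -/
theorem tendsto_normSq_mul (hf : IsWeight f) (hb : MemL2 f b) {r : ℕ → ℝ → ℂ} {K : ℝ}
    (hr : ∀ n, AEStronglyMeasurable (r n) freq) (hK : ∀ n, ∀ᵐ x ∂freq, ‖r n x‖ ≤ K)
    (hlim : ∀ᵐ x ∂freq, Tendsto (fun n => r n x) atTop (𝓝 0)) :
    Tendsto (fun n => normSq f fun x => r n x • b x) atTop (𝓝 0) := by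
  have hq : ∀ n x, (quad f (fun x => r n x • b x) x).re = ‖r n x‖ ^ 2 * (quad f b x).re := by
    intro n x
    rw [quad_smul, Complex.re_ofReal_mul]
  simp only [normSq, hq]
  rw [← mul_zero (1 / (2 * Real.pi)), ← integral_zero ℝ ℝ (μ := freq)]
  refine Tendsto.const_mul _ (tendsto_integral_of_dominated_convergence
    (fun x => K ^ 2 * (quad f b x).re) (fun n => ?_) (hb.integrable_re.const_mul _) (fun n => ?_) ?_)
  · exact ((hr n).norm.pow 2).mul hb.integrable_re.1
  · filter_upwards [hK n, hf.posSemidef] with x hx hp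
    have h0 := quad_re_nonneg (b := b) hp
    rw [Real.norm_of_nonneg (by positivity)]
    gcongr
  · filter_upwards [hlim] with x hx
    simpa using (hx.norm.pow 2).mul_const (quad f b x).re

/-- If `h` is approximated by trigonometric polynomials with negative frequencies and has no
spectrum in the finite set of negative frequencies outside `D`, these frequencies can be removed
from the approximating polynomials. -/
theorem MemSpan.of_Iio (hf : IsMinimalWeight f) {D : Set ℤ} (hfin : (Set.Iio 0 \ D).Finite)
    (hh : MemSpan f (Set.Iio 0) h)
    (hspec : ∀ k ∉ D, ∀ ν, ip f h (mulInv f (unitExp k ν)) = 0) : MemSpan f D h := by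
  classical
  have hw := hf.toIsWeight
  choose q hq hqlim using fun n : ℕ => hh.2 (1 / ((n : ℝ) + 1)) (by positivity)
  have hlim : Tendsto (fun n => normSq f (h - trigPoly (q n))) atTop (𝓝 0) :=
    squeeze_zero (fun n => normSq_nonneg hw) (fun n => (hqlim n).le)
      tendsto_one_div_add_atTop_nhds_zero_nat
  -- the part of `q_n` with frequencies outside `D` is small, as its coefficients are
  have hcoef : ∀ j ∉ D, ∀ ν, Tendsto (fun n => q n j ν) atTop (𝓝 0) := by
    intro j hj ν
    have := tendsto_ip_left hw (fun n => hf.memL2_trigPoly (q n)) hh.1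
      (hf.memL2_mulInv_unitExp j ν) hlim
    simpa only [hspec j hj ν, hf.ip_trigPoly_unitExp] using this
  have hgap : Tendsto (fun n => normSq f (trigPoly ((q n).filter (· ∉ D)))) atTop (𝓝 0) := by
    have e : ∀ n, trigPoly ((q n).filter (· ∉ D)) =
        ∑ j ∈ hfin.toFinset, ∑ ν, q n j ν • unitExp j ν := by
      intro n
      rw [trigPoly_eq_sum]
      refine (Finset.sum_subset (fun j hj => ?_) fun j _ hj => ?_).trans
        (Finset.sum_congr rfl fun j hj => ?_)
      · rw [Finsupp.support_filter, Finset.mem_filter] at hj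
        rw [Set.Finite.mem_toFinset]
        exact ⟨hq n hj.1, hj.2⟩
      · simp [Finsupp.notMem_support_iff.1 hj]
      · rw [Set.Finite.mem_toFinset] at hj
        rw [Finsupp.filter_apply_pos (· ∉ D) _ hj.2]
    simp only [e]
    refine tendsto_normSq_sum hw _ (fun j n => memL2_sum hw _ fun ν =>
      (hf.memL2_unitExp j ν).smul hw _) fun j hj => tendsto_normSq_sum hw _
      (fun ν n => (hf.memL2_unitExp j ν).smul hw _) fun ν _ => ?_
    rw [Set.Finite.mem_toFinset] at hj
    simp only [normSq_smul]
    simpa using ((hcoef j hj.2 ν).norm.pow 2).mul_const (normSq f (unitExp j ν))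
  refine ⟨hh.1, fun ε hε => ?_⟩
  have hsum := (hlim.const_mul 2).add (hgap.const_mul 2)
  simp only [mul_zero, add_zero] at hsum
  obtain ⟨n, hn⟩ := (hsum.eventually_lt_const hε).exists
  refine ⟨(q n).filter (· ∈ D), fun j hj => ?_, lt_of_le_of_lt ?_ hn⟩
  · rw [Finset.mem_coe, Finsupp.support_filter, Finset.mem_filter] at hj
    exact hj.2
  · have e : trigPoly (q n) - trigPoly ((q n).filter (· ∈ D)) =
        trigPoly ((q n).filter (· ∉ D)) := by
      rw [sub_eq_iff_eq_add, ← trigPoly_add, add_comm, Finsupp.filter_add_filter_not]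
    have := normSq_sub_le hw hh.1 (hf.memL2_trigPoly (q n))
      (hf.memL2_trigPoly ((q n).filter (· ∈ D)))
    rwa [e] at this

/-! ### Approximation in the unweighted space -/

theorem quad_one (x : ℝ) : (quad (fun _ => (1 : Matrix (Fin T) (Fin T) ℂ)) b x).re =
    ∑ ν, ‖b x ν‖ ^ 2 := by
  simp only [quad, one_mulVec, dotProduct, Complex.re_sum]
  refine Finset.sum_congr rfl fun ν _ => ?_
  rw [← Complex.normSq_eq_norm_sq, Pi.star_apply, ← starRingEnd_apply, Complex.mul_conj,
    Complex.ofReal_re]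

theorem isMinimalWeight_one : IsMinimalWeight fun _ => (1 : Matrix (Fin T) (Fin T) ℂ) where
  posSemidef := Eventually.of_forall fun _ => Matrix.PosSemidef.one
  aesm _ _ := aestronglyMeasurable_const
  integrable_diag _ := integrable_const _
  isUnit_det := Eventually.of_forall fun _ => by simp
  integrable_inv_diag _ := integrable_const _

theorem exists_trigPoly_normSq_one_lt
    (hb : MemL2 (fun _ => (1 : Matrix (Fin T) (Fin T) ℂ)) b) {ε : ℝ} (hε : 0 < ε) :
    ∃ p : ℤ →₀ (Fin T → ℂ), normSq (fun _ => 1) (b - trigPoly p) < ε := by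
  have hbint := hb.integrable_re
  simp only [quad_one] at hbint
  have hbν : ∀ ν, MemLp (fun x => b x ν) 2 freq := by
    intro ν
    rw [memLp_two_iff_integrable_sq_norm (aesm_eval hb.1 ν)]
    refine hbint.mono' ((aesm_eval hb.1 ν).norm.pow 2) (Eventually.of_forall fun x => ?_)
    rw [Real.norm_of_nonneg (by positivity)]
    exact Finset.single_le_sum (f := fun ν => ‖b x ν‖ ^ 2) (fun i _ => by positivity)
      (Finset.mem_univ ν)
  choose p hp using fun ν => exists_scalarTrig_integral_le (hbν ν)
    (ε := ε / (T + 1)) (by positivity)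
  have hval : ∀ x μ, trigPoly (∑ ν, Finsupp.mapRange.linearMap
      (LinearMap.single ℂ (fun _ : Fin T => ℂ) ν) (p ν)) x μ = scalarTrig (p μ) x := by
    intro x μ
    simp only [← trigLin_apply, map_sum, Finset.sum_apply]
    simp only [trigLin_apply, trigPoly, Finsupp.mapRange.linearMap_apply]
    rw [Finset.sum_eq_single μ]
    · rw [Finsupp.sum_mapRange_index (by simp)]
      simp [Finsupp.sum, Finset.sum_apply, scalarTrig, mul_comm]
    · intro ν _ hν
      rw [Finsupp.sum_mapRange_index (by simp)]
      simp [Finsupp.sum, Finset.sum_apply, hν.symm]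
    · simp
  refine ⟨∑ ν, Finsupp.mapRange.linearMap (LinearMap.single ℂ (fun _ : Fin T => ℂ) ν) (p ν), ?_⟩
  simp only [normSq, quad_one, Pi.sub_apply, hval]
  have hI : ∀ ν, Integrable (fun x => ‖b x ν - scalarTrig (p ν) x‖ ^ 2) freq := fun ν =>
    (memLp_two_iff_integrable_sq_norm ((hbν ν).sub (memLp_scalarTrig (p ν))).1).1
      ((hbν ν).sub (memLp_scalarTrig (p ν)))
  rw [integral_finsetSum _ fun ν _ => hI ν]
  have h1 : ∑ ν, ∫ x, ‖b x ν - scalarTrig (p ν) x‖ ^ 2 ∂freq ≤ ∑ _ν : Fin T, ε / (T + 1) :=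
    Finset.sum_le_sum fun ν _ => hp ν
  have h2 : ∑ _ν : Fin T, ε / (T + 1) < ε := by
    rw [Finset.sum_const, Finset.card_univ, Fintype.card_fin, nsmul_eq_mul, ← mul_div_assoc,
      div_lt_iff₀ (by positivity)]
    linarith
  have h3 : 1 / (2 * Real.pi) ≤ 1 := by
    rw [div_le_one (by positivity)]
    linarith [Real.pi_gt_three]
  have h4 : 0 ≤ ∑ ν, ∫ x, ‖b x ν - scalarTrig (p ν) x‖ ^ 2 ∂freq :=
    Finset.sum_nonneg fun ν _ => integral_nonneg fun x => by positivity
  calc _ ≤ 1 * ∑ ν, ∫ x, ‖b x ν - scalarTrig (p ν) x‖ ^ 2 ∂freq := by gcongr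
    _ < ε := by rw [one_mul]; exact h1.trans_lt h2

/-- A function of `L²` with spectrum in the negative integers is approximated by trigonometric
polynomials with negative frequencies. -/
theorem memSpan_one_Iio (hb : MemL2 (fun _ => (1 : Matrix (Fin T) (Fin T) ℂ)) b)
    (hspec : ∀ k : ℤ, 0 ≤ k → ∀ ν, ∫ x, b x ν * expi (-k) x ∂freq = 0) :
    MemSpan (fun _ => (1 : Matrix (Fin T) (Fin T) ℂ)) (Set.Iio 0) b := by
  have h1 := isMinimalWeight_one (T := T)
  have hw := h1.toIsWeight
  have hmul : ∀ c : ℝ → Fin T → ℂ, mulInv (fun _ => (1 : Matrix (Fin T) (Fin T) ℂ)) c = c := by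
    intro c; funext x; simp [mulInv]
  refine ⟨hb, fun ε hε => ?_⟩
  obtain ⟨p, hp⟩ := exists_trigPoly_normSq_one_lt hb hε
  refine ⟨p.filter (· < 0), fun j hj => ?_, ?_⟩
  · rw [Finset.mem_coe, Finsupp.support_filter, Finset.mem_filter] at hj
    exact hj.2
  set p₁ := p.filter (· < 0)
  set p₂ := p.filter (¬ · < 0)
  have hsplit : p₁ + p₂ = p := Finsupp.filter_add_filter_not p _
  have hc := hb.sub hw (h1.memL2_trigPoly p₁)
  have horth : ip (fun _ => (1 : Matrix (Fin T) (Fin T) ℂ)) (b - trigPoly p₁) (trigPoly (-p₂)) =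
      0 := by
    rw [ip_trigPoly_right hw h1.integrable_diag hc]
    refine Finset.sum_eq_zero fun j hj => Finset.sum_eq_zero fun ν _ => ?_
    rw [Finsupp.support_neg, Finsupp.support_filter, Finset.mem_filter] at hj
    have e := h1.ip_mulInv_unitExp b j ν
    have e2 := h1.ip_trigPoly_unitExp p₁ j ν
    rw [hmul] at e e2
    rw [ip_sub_left hw hb (h1.memL2_trigPoly p₁) (h1.memL2_unitExp j ν), e, e2,
      hspec j (not_lt.1 hj.2) ν, Finsupp.filter_apply_neg (· < 0) _ hj.2]
    simp
  have e : b - trigPoly p = (b - trigPoly p₁) + trigPoly (-p₂) := by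
    rw [← hsplit, trigPoly_add, trigPoly_neg]
    abel
  rw [e, normSq_add_of_ip_eq_zero hw hc (h1.memL2_trigPoly _) horth] at hp
  have := normSq_nonneg (b := trigPoly (-p₂)) hw
  linarith

/-! ### Functions with negative spectrum -/

/-- The entrywise norm `∑ |f_{νμ}(x)|`, which dominates the quadratic form of `f(x)`. -/
noncomputable def entrySum (f : ℝ → Matrix (Fin T) (Fin T) ℂ) (x : ℝ) : ℝ :=
  ∑ ν, ∑ μ, ‖f x ν μ‖

theorem entrySum_nonneg (x : ℝ) : 0 ≤ entrySum f x := by unfold entrySum; positivity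

theorem quad_re_le_entrySum (x : ℝ) : (quad f b x).re ≤ entrySum f x * ‖b x‖ ^ 2 := by
  refine (Complex.re_le_norm _).trans ?_
  simp only [quad, entrySum, dotProduct, mulVec, Finset.mul_sum, Finset.sum_mul]
  refine (norm_sum_le _ _).trans (Finset.sum_le_sum fun ν _ => ?_)
  refine (norm_sum_le _ _).trans (Finset.sum_le_sum fun μ _ => ?_)
  rw [norm_mul, norm_mul, Pi.star_apply, norm_star]
  have h1 := norm_le_pi_norm (b x) ν
  have h2 := norm_le_pi_norm (b x) μ
  calc ‖b x ν‖ * (‖f x ν μ‖ * ‖b x μ‖) ≤ ‖b x‖ * (‖f x ν μ‖ * ‖b x‖) := by gcongr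
    _ = ‖f x ν μ‖ * ‖b x‖ ^ 2 := by ring

theorem norm_sq_le_sum (v : Fin T → ℂ) : ‖v‖ ^ 2 ≤ ∑ ν, ‖v ν‖ ^ 2 := by
  have h0 : 0 ≤ ∑ ν, ‖v ν‖ ^ 2 := Finset.sum_nonneg fun ν _ => by positivity
  rw [← Real.le_sqrt (norm_nonneg _) h0, pi_norm_le_iff_of_nonneg (Real.sqrt_nonneg _)]
  intro ν
  rw [Real.le_sqrt (norm_nonneg _) h0]
  exact Finset.single_le_sum (f := fun ν => ‖v ν‖ ^ 2) (fun i _ => by positivity)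
    (Finset.mem_univ ν)

theorem sum_norm_sq_le (v : Fin T → ℂ) : ∑ ν, ‖v ν‖ ^ 2 ≤ T * ‖v‖ ^ 2 := by
  have : ∑ ν, ‖v ν‖ ^ 2 ≤ ∑ _ν : Fin T, ‖v‖ ^ 2 :=
    Finset.sum_le_sum fun ν _ => by gcongr; exact norm_le_pi_norm v ν
  simpa using this

theorem exists_trigPoly_eq_polyExp_smul (Q : Polynomial ℂ) {p : ℤ →₀ (Fin T → ℂ)}
    (hp : (p.support : Set ℤ) ⊆ Set.Iio 0) :
    ∃ q : ℤ →₀ (Fin T → ℂ), (q.support : Set ℤ) ⊆ Set.Iio 0 ∧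
      trigPoly q = fun x => polyExp Q x • trigPoly p x := by
  classical
  refine ⟨∑ k ∈ Q.support, Q.coeff k • p.mapDomain (· - (k : ℤ)), ?_, ?_⟩
  · rw [← Finsupp.mem_supported ℂ]
    refine Submodule.sum_mem _ fun k _ => Submodule.smul_mem _ _ ?_
    rw [Finsupp.mem_supported]
    intro j hj
    obtain ⟨i, hi, rfl⟩ := Finset.mem_image.1 (Finsupp.mapDomain_support hj)
    have : i < 0 := hp hi
    change i - (k : ℤ) < 0
    omega
  · have h1 : ∀ k : ℕ, ∀ x, trigPoly (p.mapDomain (· - (k : ℤ))) x =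
        expi (-(k : ℤ)) x • trigPoly p x := by
      intro k x
      rw [trigPoly, Finsupp.sum_mapDomain_index (by simp) (by intros; rw [smul_add])]
      simp only [trigPoly, Finsupp.sum, Finset.smul_sum, smul_smul]
      refine Finset.sum_congr rfl fun j _ => ?_
      rw [sub_eq_add_neg, expi_add, mul_comm]
    funext x
    rw [← trigLin_apply, map_sum, Finset.sum_apply, polyExp_eq_sum, Finset.sum_smul]
    refine Finset.sum_congr rfl fun k _ => ?_
    rw [map_smul, Pi.smul_apply, trigLin_apply, h1, smul_smul]

/-- Multiplication by a bounded limit of polynomials in `e^{-ix}` preserves a spectrum contained in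
the negative integers. -/
theorem integral_mul_expi_eq_zero {u φ : ℝ → ℂ} {Q : ℕ → Polynomial ℂ} (hφ : Integrable φ freq)
    (hspec : ∀ k : ℤ, 0 ≤ k → ∫ x, φ x * expi (-k) x ∂freq = 0)
    (hQ : ∀ m x, ‖polyExp (Q m) x‖ ≤ 2)
    (hlim : ∀ᵐ x ∂freq, Tendsto (fun m => polyExp (Q m) x) atTop (𝓝 (u x)))
    {k : ℤ} (hk : 0 ≤ k) : ∫ x, u x * φ x * expi (-k) x ∂freq = 0 := by
  have hφe : ∀ j : ℤ, Integrable (fun x => φ x * expi j x) freq := fun j =>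
    hφ.mul_bdd (c := 1) (continuous_expi j).aestronglyMeasurable
      (Eventually.of_forall fun x => (norm_expi j x).le)
  have h0 : ∀ m, ∫ x, polyExp (Q m) x * φ x * expi (-k) x ∂freq = 0 := by
    intro m
    have e : ∀ x, polyExp (Q m) x * φ x * expi (-k) x =
        ∑ i ∈ (Q m).support, (Q m).coeff i * (φ x * expi (-(k + i)) x) := by
      intro x
      rw [polyExp_eq_sum, Finset.sum_mul, Finset.sum_mul]
      refine Finset.sum_congr rfl fun i _ => ?_
      rw [neg_add, expi_add]; ring
    simp only [e]
    rw [integral_finsetSum _ fun i _ => (hφe _).const_mul _]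
    refine Finset.sum_eq_zero fun i _ => ?_
    rw [integral_const_mul, hspec _ (by positivity), mul_zero]
  have h1 : Tendsto (fun m => ∫ x, polyExp (Q m) x * φ x * expi (-k) x ∂freq) atTop
      (𝓝 (∫ x, u x * φ x * expi (-k) x ∂freq)) := by
    refine tendsto_integral_of_dominated_convergence (fun x => 2 * ‖φ x‖) (fun m => ?_)
      (hφ.norm.const_mul 2) (fun m => Eventually.of_forall fun x => ?_) ?_
    · exact ((continuous_polyExp _).aestronglyMeasurable.mul hφ.1).mul
        (continuous_expi _).aestronglyMeasurable
    · rw [norm_mul, norm_mul, norm_expi, mul_one]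
      gcongr
      exact hQ m x
    · filter_upwards [hlim] with x hx
      exact (hx.mul_const _).mul_const _
  simp only [h0] at h1
  exact tendsto_nhds_unique h1 tendsto_const_nhds

/-- A function of `L₂(f)` with spectrum in the negative integers belongs to the closed span of the
exponentials with negative frequencies. Since `f` is only integrable, the partial sums of the
Fourier series need not converge in `L₂(f)`; the function is first multiplied by the square of a
bounded analytic function `u` for which `u h ∈ L²` and `|u|² f` is bounded. -/
theorem memSpan_Iio_of_spectrum (hf : IsMinimalWeight f)
    (hint : ∀ ν μ, Integrable (fun x => f x ν μ) freq) (hh : MemL2 f h)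
    (hspec : ∀ k : ℤ, 0 ≤ k → ∀ ν, ∫ x, h x ν * expi (-k) x ∂freq = 0) :
    MemSpan f (Set.Iio 0) h := by
  have hw := hf.toIsWeight
  have hone := isMinimalWeight_one (T := T)
  have hhint : Integrable h freq := Integrable.of_eval fun ν => hf.integrable_of_memL2 hh ν
  have hK : Integrable (entrySum f) freq :=
    integrable_finsetSum _ fun ν _ => integrable_finsetSum _ fun μ _ => (hint ν μ).norm
  have hsqrt : ∀ φ : ℝ → ℝ, Integrable φ freq → (∀ x, 0 ≤ φ x) →
      MemLp (fun x => Real.sqrt (φ x)) 2 freq := by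
    intro φ hφ hφ0
    rw [memLp_two_iff_integrable_sq (Real.continuous_sqrt.comp_aestronglyMeasurable hφ.1)]
    simpa only [Real.sq_sqrt (hφ0 _)] using hφ
  obtain ⟨u, Q, hum, hu1, hug, hulim, hQ2, hQlim⟩ := exists_multipliers
    (g := fun x => Real.sqrt ‖h x‖ + Real.sqrt (entrySum f x))
    ((hsqrt _ hhint.norm fun x => norm_nonneg _).add (hsqrt _ hK entrySum_nonneg))
    fun x => add_nonneg (Real.sqrt_nonneg _) (Real.sqrt_nonneg _)
  have hug1 : ∀ n : ℕ, ∀ᵐ x ∂freq, ‖u n x‖ ^ 2 * ‖h x‖ ≤ ((n : ℝ) + 1) ^ 2 := by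
    intro n
    filter_upwards [hug n] with x hx
    have : ‖u n x‖ * Real.sqrt ‖h x‖ ≤ n + 1 :=
      le_trans (mul_le_mul_of_nonneg_left (le_add_of_nonneg_right (Real.sqrt_nonneg _))
        (norm_nonneg _)) hx
    calc ‖u n x‖ ^ 2 * ‖h x‖ = (‖u n x‖ * Real.sqrt ‖h x‖) ^ 2 := by
          rw [mul_pow, Real.sq_sqrt (norm_nonneg _)]
      _ ≤ _ := by gcongr
  have hug2 : ∀ n : ℕ, ∀ᵐ x ∂freq, ‖u n x‖ ^ 2 * entrySum f x ≤ ((n : ℝ) + 1) ^ 2 := by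
    intro n
    filter_upwards [hug n] with x hx
    have : ‖u n x‖ * Real.sqrt (entrySum f x) ≤ n + 1 :=
      le_trans (mul_le_mul_of_nonneg_left (le_add_of_nonneg_left (Real.sqrt_nonneg _))
        (norm_nonneg _)) hx
    calc ‖u n x‖ ^ 2 * entrySum f x = (‖u n x‖ * Real.sqrt (entrySum f x)) ^ 2 := by
          rw [mul_pow, Real.sq_sqrt (entrySum_nonneg _)]
      _ ≤ _ := by gcongr
  -- `u p` for a trigonometric polynomial `p`: replace `u` by polynomials in `e^{-ix}`
  have step1 : ∀ n, ∀ p : ℤ →₀ (Fin T → ℂ), (p.support : Set ℤ) ⊆ Set.Iio 0 →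
      MemSpan f (Set.Iio 0) fun x => u n x • trigPoly p x := by
    intro n p hp
    have hpm := hf.memL2_trigPoly p
    refine MemSpan.of_approx hf (hpm.mul hw (hum n) (hu1 n)) fun ε hε => ?_
    have hlim := tendsto_normSq_mul hw hpm (r := fun m x => u n x - polyExp (Q n m) x) (K := 3)
      (fun m => (hum n).sub (continuous_polyExp _).aestronglyMeasurable)
      (fun m => by
        filter_upwards [hu1 n] with x hx
        exact (norm_sub_le _ _).trans (by linarith [hQ2 n m x]))
      (by
        filter_upwards [hQlim n] with x hx
        simpa using hx.const_sub (u n x))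
    obtain ⟨m, hm⟩ := (hlim.eventually_lt_const hε).exists
    obtain ⟨q, hq, hqe⟩ := exists_trigPoly_eq_polyExp_smul (Q n m) hp
    refine ⟨_, hf.memSpan_trigPoly hq, lt_of_eq_of_lt ?_ hm⟩
    rw [hqe]
    congr 1
    funext x
    simp only [Pi.sub_apply, sub_smul]
  -- `u² h`: replace `u h` by a trigonometric polynomial close in `L²`
  have step2 : ∀ n, MemSpan f (Set.Iio 0) fun x => u n x • u n x • h x := by
    intro n
    have hv : MemL2 (fun _ => (1 : Matrix (Fin T) (Fin T) ℂ)) fun x => u n x • h x := by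
      refine memL2_of_quad_le hone.toIsWeight ((hum n).smul hh.1)
        (hhint.norm.const_mul (T * ((n : ℝ) + 1) ^ 2)) ?_
      filter_upwards [hug1 n] with x hx
      rw [quad_one]
      refine (sum_norm_sq_le _).trans ?_
      rw [norm_smul, mul_assoc]
      refine mul_le_mul_of_nonneg_left ?_ (Nat.cast_nonneg T)
      calc (‖u n x‖ * ‖h x‖) ^ 2 = ‖u n x‖ ^ 2 * ‖h x‖ * ‖h x‖ := by ring
        _ ≤ _ := by gcongr
    have hvspan := memSpan_one_Iio hv fun k hk ν => by
      simp only [Pi.smul_apply, smul_eq_mul]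
      exact integral_mul_expi_eq_zero (hf.integrable_of_memL2 hh ν)
        (fun k hk => hspec k hk ν) (hQ2 n) (hQlim n) hk
    have hv' : MemL2 f fun x => u n x • h x := hh.mul hw (hum n) (hu1 n)
    refine MemSpan.of_approx hf (hv'.mul hw (hum n) (hu1 n)) fun ε hε => ?_
    have hn0 : 0 < ((n : ℝ) + 1) ^ 2 := by positivity
    obtain ⟨p, hp, hpε⟩ := hvspan.2 (ε / ((n : ℝ) + 1) ^ 2) (by positivity)
    refine ⟨_, step1 n p hp, ?_⟩
    set d : ℝ → Fin T → ℂ := (fun x => u n x • h x) - trigPoly p with hd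
    have hd1 : MemL2 (fun _ => (1 : Matrix (Fin T) (Fin T) ℂ)) d :=
      hv.sub hone.toIsWeight (hone.memL2_trigPoly p)
    have hdf : MemL2 f d := hv'.sub hw (hf.memL2_trigPoly p)
    have e : ((fun x => u n x • u n x • h x) - fun x => u n x • trigPoly p x) =
        fun x => u n x • d x := by
      funext x; simp [hd, smul_sub]
    rw [e]
    have hle : ∫ x, (quad f (fun x => u n x • d x) x).re ∂freq ≤
        ∫ x, ((n : ℝ) + 1) ^ 2 * (quad (fun _ => (1 : Matrix (Fin T) (Fin T) ℂ)) d x).re ∂freq := by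
      refine integral_mono_ae (hdf.mul hw (hum n) (hu1 n)).integrable_re
        (hd1.integrable_re.const_mul _) ?_
      filter_upwards [hug2 n] with x hx
      rw [quad_smul, Complex.re_ofReal_mul, quad_one]
      calc ‖u n x‖ ^ 2 * (quad f d x).re ≤ ‖u n x‖ ^ 2 * (entrySum f x * ‖d x‖ ^ 2) := by
            gcongr; exact quad_re_le_entrySum x
        _ = ‖u n x‖ ^ 2 * entrySum f x * ‖d x‖ ^ 2 := by ring
        _ ≤ _ := by
            gcongr
            exact norm_sq_le_sum _
    rw [integral_const_mul] at hle
    rw [lt_div_iff₀ hn0] at hpε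
    have := mul_le_mul_of_nonneg_left hle (by positivity : 0 ≤ 1 / (2 * Real.pi))
    unfold normSq at hpε ⊢
    linarith
  refine MemSpan.of_approx hf hh fun ε hε => ?_
  have hlim := tendsto_normSq_mul hw hh (r := fun n x => 1 - u n x * u n x) (K := 2)
    (fun n => aestronglyMeasurable_const.sub ((hum n).mul (hum n)))
    (fun n => by
      filter_upwards [hu1 n] with x hx
      refine (norm_sub_le _ _).trans ?_
      rw [norm_one, norm_mul]
      nlinarith [norm_nonneg (u n x)])
    (by
      filter_upwards [hulim] with x hx
      simpa using (hx.mul hx).const_sub 1)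
  obtain ⟨n, hn⟩ := (hlim.eventually_lt_const hε).exists
  refine ⟨_, step2 n, lt_of_eq_of_lt ?_ hn⟩
  congr 1
  funext x
  simp only [Pi.sub_apply, sub_smul, one_smul, smul_smul]

/-- A function of `L₂(f)` with spectrum in `D`, where `D` consists of all but finitely many
negative integers, belongs to the closed span of the exponentials with frequencies in `D`. -/
theorem memSpan_of_spectrum (hf : IsMinimalWeight f)
    (hint : ∀ ν μ, Integrable (fun x => f x ν μ) freq) {D : Set ℤ} (hD : D ⊆ Set.Iio 0)
    (hfin : (Set.Iio 0 \ D).Finite) (hh : MemL2 f h)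
    (hspec : ∀ k ∉ D, ∀ ν, ip f h (mulInv f (unitExp k ν)) = 0) : MemSpan f D h := by
  refine MemSpan.of_Iio hf hfin (memSpan_Iio_of_spectrum hf hint hh fun k hk ν => ?_) hspec
  have h1 := hspec k (fun h => absurd (hD h) (not_lt.2 hk)) ν
  rw [hf.ip_mulInv_unitExp] at h1
  have h2 : (1 / (2 * Real.pi) : ℂ) ≠ 0 := by
    have : (Real.pi : ℂ) ≠ 0 := by exact_mod_cast Real.pi_ne_zero
    simp [this]
  exact (mul_eq_zero.1 h1).resolve_left h2

end Spectrum

/-! ### The isometry between `L₂(f)` and the time domain -/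

section Estimate

variable {T : ℕ} {f : ℝ → Matrix (Fin T) (Fin T) ℂ}

section TimeDomain

variable {Ω : Type*} [MeasurableSpace Ω] {P : Measure Ω}

/-- The sequence `ξ` in `L²(P)` has the covariances given by the weight `f`. -/
def HasWeight (ξ : ℤ → Fin T → Lp ℂ 2 P) (f : ℝ → Matrix (Fin T) (Fin T) ℂ) : Prop :=
  ∀ j k ν μ, (inner ℂ (ξ k μ) (ξ j ν) : ℂ) = ip f (unitExp j ν) (unitExp k μ)

/-- The linear combination `∑_j p(j)ᵀ ξ(j)`. -/
noncomputable def linComb (ξ : ℤ → Fin T → Lp ℂ 2 P) :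
    (ℤ →₀ (Fin T → ℂ)) →ₗ[ℂ] Lp ℂ 2 P :=
  Finsupp.lsum ℂ fun j => Fintype.linearCombination ℂ (ξ j)

variable {ξ : ℤ → Fin T → Lp ℂ 2 P}

theorem linComb_apply (p : ℤ →₀ (Fin T → ℂ)) :
    linComb ξ p = p.sum fun j v => ∑ ν, v ν • ξ j ν := rfl

theorem inner_linComb (hf : IsMinimalWeight f) (hξ : HasWeight ξ f) (p q : ℤ →₀ (Fin T → ℂ)) :
    (inner ℂ (linComb ξ q) (linComb ξ p) : ℂ) = ip f (trigPoly p) (trigPoly q) := by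
  have hw := hf.toIsWeight
  have h1 : ∀ k μ, (inner ℂ (ξ k μ) (linComb ξ p) : ℂ) = ip f (trigPoly p) (unitExp k μ) := by
    intro k μ
    rw [← ip_conj hw, ip_trigPoly_right hw hf.integrable_diag (hf.memL2_unitExp k μ),
      linComb_apply, Finsupp.sum, inner_sum, map_sum]
    refine Finset.sum_congr rfl fun j _ => ?_
    rw [inner_sum, map_sum]
    refine Finset.sum_congr rfl fun ν _ => ?_
    rw [inner_smul_right, hξ, map_mul, Complex.conj_conj, ip_conj hw]
  rw [ip_trigPoly_right hw hf.integrable_diag (hf.memL2_trigPoly p), linComb_apply q, Finsupp.sum,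
    sum_inner]
  refine Finset.sum_congr rfl fun k _ => ?_
  rw [sum_inner]
  refine Finset.sum_congr rfl fun μ _ => ?_
  rw [inner_smul_left, h1]

theorem norm_linComb_sq (hf : IsMinimalWeight f) (hξ : HasWeight ξ f) (p : ℤ →₀ (Fin T → ℂ)) :
    ‖linComb ξ p‖ ^ 2 = normSq f (trigPoly p) := by
  rw [← ip_self_re (hf.memL2_trigPoly p), ← inner_linComb hf hξ, inner_self_eq_norm_sq_to_K]
  norm_cast

theorem linComb_mem_obsSpace {D : Set ℤ} {p : ℤ →₀ (Fin T → ℂ)} (hp : (p.support : Set ℤ) ⊆ D) :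
    linComb ξ p ∈ obsSpace ξ D := by
  refine Submodule.le_topologicalClosure _ ?_
  rw [linComb_apply]
  refine Submodule.sum_mem _ fun j hj => Submodule.sum_mem _ fun ν _ =>
    Submodule.smul_mem _ _ (Submodule.subset_span ?_)
  exact ⟨j, hp hj, ν, rfl⟩

theorem exists_linComb_of_mem_span {D : Set ℤ} {y : Lp ℂ 2 P}
    (hy : y ∈ Submodule.span ℂ {y | ∃ j ∈ D, ∃ ν, y = ξ j ν}) :
    ∃ p : ℤ →₀ (Fin T → ℂ), (p.support : Set ℤ) ⊆ D ∧ linComb ξ p = y := by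
  have h : Submodule.span ℂ {y | ∃ j ∈ D, ∃ ν, y = ξ j ν} ≤
      (Finsupp.supported (Fin T → ℂ) ℂ D).map (linComb ξ) := by
    rw [Submodule.span_le]
    rintro _ ⟨j, hj, ν, rfl⟩
    refine (Submodule.mem_map).2 ⟨Finsupp.single j (Pi.single ν 1), ?_, ?_⟩
    · exact Finsupp.single_mem_supported (R := ℂ) (Pi.single ν 1 : Fin T → ℂ) hj
    · simp [linComb_apply, Pi.single_apply, ite_smul]
  obtain ⟨p, hp, hpy⟩ := h hy
  exact ⟨p, hp, hpy⟩

/-! ### Projection onto the closed span of the observations -/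

variable {D : Set ℤ}

theorem ip_eq_zero_of_memSpan (hf : IsMinimalWeight f) {r h : ℝ → Fin T → ℂ} (hr : MemL2 f r)
    (horth : ∀ j ∈ D, ∀ ν, ip f r (unitExp j ν) = 0) (hh : MemSpan f D h) : ip f r h = 0 := by
  have hw := hf.toIsWeight
  choose q hq hqlim using fun n : ℕ => hh.2 (1 / ((n : ℝ) + 1)) (by positivity)
  have hlim : Tendsto (fun n => normSq f (h - trigPoly (q n))) atTop (𝓝 0) :=
    squeeze_zero (fun n => normSq_nonneg hw) (fun n => (hqlim n).le)
      tendsto_one_div_add_atTop_nhds_zero_nat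
  have h1 := tendsto_ip_left hw (fun n => hf.memL2_trigPoly (q n)) hh.1 hr hlim
  have h2 : ∀ n, ip f (trigPoly (q n)) r = 0 := by
    intro n
    rw [← ip_conj hw, ip_trigPoly_right hw hf.integrable_diag hr]
    rw [Finset.sum_eq_zero fun j hj => Finset.sum_eq_zero fun ν _ => by
      rw [horth j (hq n hj) ν, mul_zero], map_zero]
  simp only [h2] at h1
  rw [← ip_conj hw, tendsto_nhds_unique h1 tendsto_const_nhds, map_zero]

/-- If `A = h + r` with `h` in the closed span of the exponentials with frequencies in `D` and `r`
orthogonal to them, the optimal estimate of `∑_j p(j)ᵀ ξ(j)`, where `A = ∑_j p(j) e^{ijx}`,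
is approximated by the linear combinations whose trigonometric polynomials approximate `h`. -/
theorem norm_optEstimate_sub_sq_le (hf : IsMinimalWeight f) (hξ : HasWeight ξ f)
    {r h : ℝ → Fin T → ℂ} {p q : ℤ →₀ (Fin T → ℂ)} (hr : MemL2 f r)
    (horth : ∀ j ∈ D, ∀ ν, ip f r (unitExp j ν) = 0) (hh : MemSpan f D h)
    (hp : trigPoly p = h + r) (hq : (q.support : Set ℤ) ⊆ D) :
    ‖optEstimate ξ D (linComb ξ p) - linComb ξ q‖ ^ 2 ≤ normSq f (h - trigPoly q) := by
  have hw := hf.toIsWeight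
  have : CompleteSpace (obsSpace ξ D) :=
    (Submodule.isClosed_topologicalClosure _).completeSpace_coe
  set z := optEstimate ξ D (linComb ξ p) - linComb ξ q with hz
  have hzmem : z ∈ obsSpace ξ D := Submodule.sub_mem _
    (Submodule.starProjection_apply_mem _ _) (linComb_mem_obsSpace hq)
  have hbound : ∀ y ∈ obsSpace ξ D, ‖(inner ℂ y (linComb ξ p - linComb ξ q) : ℂ)‖ ≤
      ‖y‖ * Real.sqrt (normSq f (h - trigPoly q)) := by
    intro y hy
    have hcl : IsClosed {y : Lp ℂ 2 P | ‖(inner ℂ y (linComb ξ p - linComb ξ q) : ℂ)‖ ≤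
        ‖y‖ * Real.sqrt (normSq f (h - trigPoly q))} :=
      isClosed_le (by fun_prop) (by fun_prop)
    refine closure_minimal ?_ hcl hy
    intro s hs
    obtain ⟨t, ht, rfl⟩ := exists_linComb_of_mem_span hs
    have hd : MemL2 f (h - trigPoly q) := hh.1.sub hw (hf.memL2_trigPoly q)
    have e : trigPoly p - trigPoly q = (h - trigPoly q) + r := by rw [hp]; abel
    rw [Set.mem_ofPred_eq, ← map_sub, inner_linComb hf hξ, trigPoly_sub, e,
      ip_add_left hw hd hr (hf.memL2_trigPoly t),
      ip_eq_zero_of_memSpan hf hr horth (hf.memSpan_trigPoly ht), add_zero]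
    refine le_of_sq_le_sq ?_ (by positivity)
    rw [mul_pow, norm_linComb_sq hf hξ, Real.sq_sqrt (normSq_nonneg hw), mul_comm]
    exact norm_ip_sq_le hw hd (hf.memL2_trigPoly t)
  have hzz : (inner ℂ z z : ℂ) = inner ℂ z (linComb ξ p - linComb ξ q) := by
    have h1 : z = (obsSpace ξ D).starProjection (linComb ξ p - linComb ξ q) := by
      rw [map_sub, Submodule.starProjection_eq_self_iff.2 (linComb_mem_obsSpace hq)]
      rfl
    conv_lhs => rw [h1, ← Submodule.inner_starProjection_left_eq_right,
      Submodule.starProjection_eq_self_iff.2 (h1 ▸ hzmem), ← h1]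
  have hle := hbound z hzmem
  rw [← hzz, inner_self_eq_norm_sq_to_K, norm_pow, RCLike.norm_ofReal, abs_norm, pow_two] at hle
  rcases (norm_nonneg z).eq_or_lt with h0 | h0
  · rw [← h0]
    simpa using normSq_nonneg hw
  · rw [← Real.le_sqrt (norm_nonneg z) (normSq_nonneg hw)]
    exact le_of_mul_le_mul_left hle h0

theorem norm_sub_optEstimate_sq (hf : IsMinimalWeight f) (hξ : HasWeight ξ f)
    {r h : ℝ → Fin T → ℂ} {p : ℤ →₀ (Fin T → ℂ)} (hr : MemL2 f r)
    (horth : ∀ j ∈ D, ∀ ν, ip f r (unitExp j ν) = 0) (hh : MemSpan f D h)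
    (hp : trigPoly p = h + r) :
    ‖linComb ξ p - optEstimate ξ D (linComb ξ p)‖ ^ 2 = normSq f r := by
  have hw := hf.toIsWeight
  choose q hq hqlim using fun n : ℕ => hh.2 (1 / ((n : ℝ) + 1)) (by positivity)
  have hlim : Tendsto (fun n => normSq f (h - trigPoly (q n))) atTop (𝓝 0) :=
    squeeze_zero (fun n => normSq_nonneg hw) (fun n => (hqlim n).le)
      tendsto_one_div_add_atTop_nhds_zero_nat
  have h1 : ∀ n, ‖linComb ξ p - linComb ξ (q n)‖ ^ 2 =
      normSq f r + normSq f (h - trigPoly (q n)) := by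
    intro n
    have hd : MemL2 f (h - trigPoly (q n)) := hh.1.sub hw (hf.memL2_trigPoly _)
    have e : trigPoly p - trigPoly (q n) = r + (h - trigPoly (q n)) := by rw [hp]; abel
    rw [← map_sub, norm_linComb_sq hf hξ, trigPoly_sub, e, normSq_add_of_ip_eq_zero hw hr hd]
    rw [ip_sub_right hw hr hh.1 (hf.memL2_trigPoly _), ip_eq_zero_of_memSpan hf hr horth hh,
      ip_eq_zero_of_memSpan hf hr horth (hf.memSpan_trigPoly (hq n)), sub_zero]
  have h2 : Tendsto (fun n => linComb ξ (q n)) atTop (𝓝 (optEstimate ξ D (linComb ξ p))) := by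
    rw [tendsto_iff_norm_sub_tendsto_zero]
    have h3 := hlim.sqrt
    rw [Real.sqrt_zero] at h3
    refine squeeze_zero (fun n => norm_nonneg _) (fun n => ?_) h3
    rw [norm_sub_rev]
    exact Real.le_sqrt_of_sq_le (norm_optEstimate_sub_sq_le hf hξ hr horth hh hp (hq n))
  have h4 := ((h2.const_sub (linComb ξ p)).norm.pow 2)
  simp only [h1] at h4
  have h5 := hlim.const_add (normSq f r)
  rw [add_zero] at h5
  exact tendsto_nhds_unique h4 h5

/-- In this decomposition `h` is the spectral characteristic of the optimal estimate, and it is the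
only one up to null sets, since the spectral integral is isometric. -/
theorem isSpectralCharacteristic_iff (hf : IsMinimalWeight f) (hξ : HasWeight ξ f)
    {r h : ℝ → Fin T → ℂ} {p : ℤ →₀ (Fin T → ℂ)} (hr : MemL2 f r)
    (horth : ∀ j ∈ D, ∀ ν, ip f r (unitExp j ν) = 0) (hh : MemSpan f D h)
    (hp : trigPoly p = h + r) (h' : ℝ → Fin T → ℂ) :
    IsSpectralCharacteristic ξ f D (linComb ξ p) h' ↔ h' =ᵐ[freq] h := by
  have hw := hf.toIsWeight
  have happrox : ∀ ε > 0, ∃ q : ℤ →₀ (Fin T → ℂ), (q.support : Set ℤ) ⊆ D ∧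
      normSq f (h - trigPoly q) < ε ∧ ‖optEstimate ξ D (linComb ξ p) - linComb ξ q‖ < ε := by
    intro ε hε
    obtain ⟨q, hq, hqε⟩ := hh.2 (min ε (ε ^ 2)) (by positivity)
    refine ⟨q, hq, hqε.trans_le (min_le_left _ _), lt_of_pow_lt_pow_left₀ 2 hε.le ?_⟩
    exact (norm_optEstimate_sub_sq_le hf hξ hr horth hh hp hq).trans_lt
      (hqε.trans_le (min_le_right _ _))
  constructor
  · rintro ⟨hh', _, hint⟩
    refine ae_eq_of_normSq_sub_eq_zero hw hf.isUnit_det hh'.1 hh.1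
      (le_antisymm (le_of_forall_pos_lt_add fun ε hε => ?_) (normSq_nonneg hw))
    rw [zero_add]
    -- the three distances below add up to at most `2 δ + 4 ((2 δ)² + δ) ≤ 22 δ`
    set δ := min 1 (ε / 40) with hδ
    have hδ0 : 0 < δ := by positivity
    have hδ1 : δ ≤ 1 := min_le_left _ _
    have hδε : δ ≤ ε / 40 := min_le_right _ _
    obtain ⟨q, hq1, hq2⟩ := hint δ hδ0
    obtain ⟨t, _, ht1, ht2⟩ := happrox δ hδ0
    rw [← linComb_apply] at hq2
    have h1 : normSq f (trigPoly q - trigPoly t) ≤ (δ + δ) ^ 2 := by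
      rw [← trigPoly_sub, ← norm_linComb_sq hf hξ, map_sub]
      gcongr
      have e : linComb ξ q - linComb ξ t = (optEstimate ξ D (linComb ξ p) - linComb ξ t) -
          (optEstimate ξ D (linComb ξ p) - linComb ξ q) := by abel
      rw [e]
      exact (norm_sub_le _ _).trans (add_le_add ht2.le hq2.le)
    have h2 := normSq_sub_le hw hh'.1 (hf.memL2_trigPoly q) hh.1
    have h3 := normSq_sub_le hw (hf.memL2_trigPoly q) (hf.memL2_trigPoly t) hh.1
    rw [normSq_sub_comm (a := trigPoly t)] at h3
    nlinarith
  · intro hae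
    have h1 : ∀ q : ℤ →₀ (Fin T → ℂ), normSq f (h' - trigPoly q) = normSq f (h - trigPoly q) :=
      fun q => normSq_congr (by
        filter_upwards [hae] with x hx
        simp only [Pi.sub_apply, hx])
    have hm : MemL2 f h' := hh.1.congr hae.symm
    refine ⟨⟨hm, fun ε hε => ?_⟩, hm, fun ε hε => ?_⟩
    · obtain ⟨q, hq, hqε⟩ := hh.2 ε hε
      exact ⟨q, hq, by rwa [h1]⟩
    · obtain ⟨q, _, h2, h3⟩ := happrox ε hε
      exact ⟨q, by rwa [h1], h3⟩

theorem normSq_le_of_memSpan (hf : IsMinimalWeight f) {r h h' A : ℝ → Fin T → ℂ} (hr : MemL2 f r)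
    (horth : ∀ j ∈ D, ∀ ν, ip f r (unitExp j ν) = 0) (hh : MemSpan f D h) (hA : A = h + r)
    (hh' : MemSpan f D h') : normSq f (A - h) ≤ normSq f (A - h') := by
  have hw := hf.toIsWeight
  have e1 : A - h = r := by rw [hA]; abel
  have e2 : A - h' = r + (h - h') := by rw [hA]; abel
  rw [e1, e2, normSq_add_of_ip_eq_zero hw hr (hh.1.sub hw hh'.1)]
  · linarith [normSq_nonneg (b := h - h') hw]
  · rw [ip_sub_right hw hr hh.1 hh'.1, ip_eq_zero_of_memSpan hf hr horth hh,
      ip_eq_zero_of_memSpan hf hr horth hh', sub_zero]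

/-! ### The blocked sequence and the functional `A_N ζ` -/

theorem hasWeight_block {ζ : ℤ → Ω → ℂ} (hζ : ∀ n, MemLp (ζ n) 2 P)
    (hf : IsSpectralDensity P (block T ζ) f) : HasWeight (block T (toL2 hζ)) f := by
  intro j k ν μ
  have h1 : ip f (unitExp j ν) (unitExp k μ) =
      (1 / (2 * Real.pi) : ℂ) * ∫ x, expi (j - k) x * f x ν μ ∂freq := by
    unfold ip
    congr 1
    refine integral_congr_ae (Eventually.of_forall fun x => ?_)
    change form f (fun x => expi j x • Pi.single ν 1) (fun x => expi k x • Pi.single μ 1) x =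
      expi (j - k) x * f x ν μ
    have e : expi (j - k) x = expi j x * expi (-k) x := by rw [sub_eq_add_neg, expi_add]
    rw [form_mul_left, form_mul_right, conj_expi, e]
    simp [form]
    ring
  rw [h1, ← hf.covariance, L2.inner_def]
  refine integral_congr_ae ?_
  filter_upwards [(hζ (j * (T : ℤ) + ((ν : ℕ) + 1 : ℤ))).coeFn_toLp,
    (hζ (k * (T : ℤ) + ((μ : ℕ) + 1 : ℤ))).coeFn_toLp] with ω h2 h3
  simp only [block, toL2, RCLike.inner_apply]
  rw [h2, h3]

end TimeDomain

/-- The coefficients `a⃗(j)`, `0 ≤ j < N`, of `A_N(e^{ix})`. -/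
noncomputable def blockCoeff (T N : ℕ) (α : ℕ → ℂ) : ℤ →₀ (Fin T → ℂ) :=
  ∑ j ∈ Finset.range N, Finsupp.single (j : ℤ) (vecCoeff T α j)

theorem trigPoly_blockCoeff (N : ℕ) (α : ℕ → ℂ) : trigPoly (blockCoeff T N α) = AN T N α := by
  funext x
  rw [blockCoeff, ← trigLin_apply, map_sum, Finset.sum_apply, AN]
  refine Finset.sum_congr rfl fun j _ => ?_
  rw [trigLin_apply, trigPoly_single]

theorem blockCoeff_apply (N : ℕ) (α : ℕ → ℂ) (k : ℤ) (ν : Fin T) :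
    blockCoeff T N α k ν = aNfun T N α k ν := by
  rw [blockCoeff, Finsupp.finsetSum_apply, Finset.sum_apply, aNfun]
  split_ifs with h
  · rw [Finset.sum_eq_single k.toNat]
    · rw [Int.toNat_of_nonneg h.1, Finsupp.single_eq_same]
    · intro j _ hj
      rw [Finsupp.single_eq_of_ne (by omega)]; rfl
    · intro hk
      exact absurd (Finset.mem_range.2 (by omega)) hk
  · refine Finset.sum_eq_zero fun j hj => ?_
    rw [Finset.mem_range] at hj
    rw [Finsupp.single_eq_of_ne (by omega)]; rfl

theorem functional_eq_sum {E : Type*} [AddCommMonoid E] [Module ℂ E] (N : ℕ) {α a : ℕ → ℂ}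
    (ha : HasBlockForm T α a) (ζ : ℤ → E) :
    functional T N a ζ = ∑ j ∈ Finset.range N, ∑ ν, vecCoeff T α j ν • block T ζ j ν := by
  have h1 : ∀ n : ℕ, ∑ j ∈ Finset.Icc 1 n, a j • ζ (j : ℤ) =
      ∑ j ∈ Finset.range n, a (j + 1) • ζ ((j + 1 : ℕ) : ℤ) := by
    intro n
    rw [Finset.range_eq_Ico, Finset.sum_Ico_add' (fun j : ℕ => a j • ζ (j : ℤ)) 0 n 1]
    rfl
  rw [functional, h1]
  induction N with
  | zero => simp
  | succ N ih =>
    rw [Finset.sum_range_succ, ← ih, Nat.succ_mul, Finset.sum_range_add]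
    congr 1
    rw [Finset.sum_range]
    refine Finset.sum_congr rfl fun ν _ => ?_
    have e : N * T + (ν : ℕ) + 1 = (ν : ℕ) + 1 + N * T := by ring
    rw [e, ha N ν, block]
    congr 2
    push_cast; ring

theorem functional_eq_linComb {Ω : Type*} [MeasurableSpace Ω] {P : Measure Ω} (N : ℕ) {α a : ℕ → ℂ}
    (ha : HasBlockForm T α a) (ζ : ℤ → Lp ℂ 2 P) :
    functional T N a ζ = linComb (block T ζ) (blockCoeff T N α) := by
  rw [functional_eq_sum N ha, blockCoeff, map_sum]
  refine Finset.sum_congr rfl fun j _ => ?_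
  rw [linComb_apply, Finsupp.sum_single_index (by simp)]

theorem functional_toL2_coeFn {Ω : Type*} [MeasurableSpace Ω] {P : Measure Ω} (N : ℕ) (a : ℕ → ℂ)
    {ζ : ℤ → Ω → ℂ} (hζ : ∀ n, MemLp (ζ n) 2 P) :
    ⇑(functional T N a (toL2 hζ) : Lp ℂ 2 P) =ᵐ[P] fun ω => functional T N a fun j => ζ j ω := by
  unfold functional
  filter_upwards [Lp.coeFn_finsetSum (Finset.Icc 1 (N * T)) fun j => a j • toL2 hζ (j : ℤ),
    ae_all_iff.2 fun j : ℕ => Lp.coeFn_smul (a j) (toL2 hζ (j : ℤ)),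
    ae_all_iff.2 fun j : ℕ => (hζ j).coeFn_toLp] with ω h1 h2 h3
  rw [h1, Finset.sum_apply]
  refine Finset.sum_congr rfl fun j _ => ?_
  rw [h2, Pi.smul_apply, toL2, h3]

theorem pairing_eq_inner {G : Set ℤ} (c b : l2 G T) : pairing c b = inner ℂ b c := by
  rw [pairing, lp.inner_eq_tsum]
  refine tsum_congr fun k => ?_
  rw [PiLp.inner_apply]
  rfl

theorem IsSpectralDensity.isMinimalWeight {Ω : Type*} [MeasurableSpace Ω] {P : Measure Ω}
    {ξ : ℤ → Fin T → Ω → ℂ} (hf : IsSpectralDensity P ξ f) (hmin : MinimalityCondition f) :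
    IsMinimalWeight f :=
  have hw : IsWeight f := ⟨hf.posSemidef, fun ν μ => (hf.integrable ν μ).1⟩
  { toIsWeight := hw
    integrable_diag := fun ν => hf.integrable ν ν
    isUnit_det := hmin.1
    integrable_inv_diag := hmin.integrable_inv_diag hw }

/-! ### The pattern of observations -/

theorem mem_Gam_iff_notMem_observed (s : ℕ) (Nobs Kmis : ℕ → ℕ) (k : ℤ) :
    k ∈ Gam s Nobs Kmis ↔ k ∉ observed s Nobs Kmis := by
  simp only [Gam, observed, Set.mem_union, Set.mem_sdiff, Set.mem_Iio, Set.mem_Ici]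
  by_cases h : k < 0
  · simp [h]
  · simp [h, not_lt.1 h]

theorem finite_Iio_diff_observed (s : ℕ) (Nobs Kmis : ℕ → ℕ) :
    (Set.Iio 0 \ observed s Nobs Kmis).Finite := by
  have h : (missing s Nobs Kmis).Finite :=
    Set.Finite.biUnion (Finset.finite_toSet (Finset.Icc 1 s)) fun l _ => Set.finite_Icc _ _
  refine h.subset fun k hk => ?_
  by_contra hm
  exact hk.2 ⟨hk.1, hm⟩

end Estimate

end PCSeq

theorem mainTheorem8 {Ω : Type*} [MeasurableSpace Ω] (P : Measure Ω) [IsProbabilityMeasure P]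
    -- a `T`-PC sequence whose blocked sequence has the spectral density `f`
    (T : ℕ) (ζ : ℤ → Ω → ℂ) (hζ : IsPeriodicallyCorrelated P ζ T)
    (f : ℝ → Matrix (Fin T) (Fin T) ℂ) (hf : IsSpectralDensity P (block T ζ) f)
    (hmin : MinimalityCondition f)
    -- the pattern of missing observations
    (s : ℕ) (Nobs Kmis : ℕ → ℕ) (D G : Set ℤ)
    (hD : D = observed s Nobs Kmis) (hG : G = Gam s Nobs Kmis)
    -- the operator `B` in `ℓ²(G; ℂ^T)`
    (hmat : IsMatrixOperator f G) (hB : BInvertible f G)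
    -- the functional `A_N ζ`
    (N : ℕ) (α a : ℕ → ℂ) (ha : HasBlockForm T α a)
    (X : Lp ℂ 2 P) (hX : X = functional T N a (toL2 hζ.memLp))
    -- `c = B⁻¹ a_N`
    (c : l2 G T) (hc : c = Binv hB (aN T N α G)) :
    -- `h_N` is the spectral characteristic of the optimal estimate (unique up to null sets)
    (∀ h : ℝ → Fin T → ℂ,
      IsSpectralCharacteristic (block T (toL2 hζ.memLp)) f D X h ↔ h =ᵐ[freq] hN N α f c) ∧
    -- it minimizes the mean-square error `Δ(h; f)` over `L₂ˢ(f)`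
    (∀ h : ℝ → Fin T → ℂ, MemSpan f D h →
      normSq f (AN T N α - hN N α f c) ≤ normSq f (AN T N α - h)) ∧
    -- the mean-square error of the optimal estimate is `⟨c, a_N⟩`
    ((normSq f (AN T N α - hN N α f c) : ℝ) : ℂ) = pairing c (aN T N α G) ∧
    ((∫ ω, ‖functional T N a (fun j => ζ j ω) -
        (optEstimate (block T (toL2 hζ.memLp)) D X : Ω → ℂ) ω‖ ^ 2 ∂P : ℝ) : ℂ) =
      pairing c (aN T N α G) := by
  have hw : IsMinimalWeight f := hf.isMinimalWeight hmin
  have hξ : HasWeight (block T (toL2 hζ.memLp)) f := hasWeight_block hζ.memLp hf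
  have hGD : ∀ k, k ∉ D → k ∈ G := fun k hk => by
    rw [hG, mem_Gam_iff_notMem_observed, ← hD]; exact hk
  have hDG : ∀ k ∈ D, k ∉ G := fun k hk hk' => by
    rw [hG, mem_Gam_iff_notMem_observed, ← hD] at hk'; exact hk' hk
  obtain ⟨hr, hcoef, horth, hnorm⟩ := hw.mulInv_Cfun hmat hB (aN T N α G)
  rw [← hc] at hr hcoef horth hnorm
  have hAN : MemL2 f (AN T N α) := trigPoly_blockCoeff (T := T) N α ▸ hw.memL2_trigPoly _
  have hA : AN T N α = hN N α f c + mulInv f (Cfun c) := by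
    funext x; exact (sub_add_cancel (AN T N α x) _).symm
  have he : AN T N α - hN N α f c = mulInv f (Cfun c) := by rw [hA]; abel
  have hp : trigPoly (blockCoeff T N α) = hN N α f c + mulInv f (Cfun c) := by
    rw [trigPoly_blockCoeff, hA]
  have hmem : MemL2 f (hN N α f c) := hAN.sub hw.toIsWeight hr
  have horth' : ∀ j ∈ D, ∀ ν, ip f (mulInv f (Cfun c)) (unitExp j ν) = 0 :=
    fun j hj => horth j (hDG j hj)
  have hspan : MemSpan f D (hN N α f c) := by
    refine memSpan_of_spectrum hw hf.integrable (by rw [hD]; exact Set.sdiff_subset)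
      (by rw [hD]; exact finite_Iio_diff_observed s Nobs Kmis) hmem fun k hk ν => ?_
    -- on `G` the Fourier coefficients of `A_N` and of `C f⁻¹` are both those of `a_N`
    have h1 : hN N α f c = AN T N α - mulInv f (Cfun c) := rfl
    rw [h1, ip_sub_left hw.toIsWeight hAN hr (hw.memL2_mulInv_unitExp k ν),
      hcoef ⟨k, hGD k hk⟩ ν, ← trigPoly_blockCoeff, hw.ip_trigPoly_unitExp, blockCoeff_apply]
    exact sub_self _
  rw [functional_eq_linComb N ha] at hX
  refine ⟨fun h => ?_, fun h hh => ?_, ?_, ?_⟩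
  · rw [hX]
    exact isSpectralCharacteristic_iff hw hξ hr horth' hspan hp h
  · exact normSq_le_of_memSpan hw hr horth' hspan hA hh
  · rw [he, hnorm, pairing_eq_inner]
  · rw [pairing_eq_inner, ← hnorm, ← norm_sub_optEstimate_sq hw hξ hr horth' hspan hp, ← hX]
    congr 1
    rw [← Lp.toLp_coeFn _ (Lp.memLp (X - _)), norm_toLp_sq]
    refine integral_congr_ae ?_
    filter_upwards [Lp.coeFn_sub X (optEstimate (block T (toL2 hζ.memLp)) D X),
      functional_toL2_coeFn (T := T) N a hζ.memLp] with ω h1 h2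
    rw [h1, Pi.sub_apply, ← h2, hX, functional_eq_linComb N ha]
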